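/- **Setting.** For $t>0$ and $x\in\mathbb R^2$ let $G_t(x)=\frac1{2\pi t}e^{-|x|^2/(2t)}$ and, for $\mathfrak m\in\mathbb R$, $G^{\mathfrak m}_t=e^{\mathfrak m t}G_t$; $*$ is spatial convolution and $G^{\mathfrak m}_0*g=g$. Let $\eta$ be a spatial white noise on $\mathbb R^2$ on a probability space $(\Omega,\mathcal F,\mathbb P)$, that is, a random tempered distribution such that $\langle\eta,\varphi\rangle$ is centred Gaussian with variance $\int\varphi^2$ for every real Schwartz function $\varphi$. Let $\varepsilon\in(0,1)$ and $\eta_\varepsilon=G_{\varepsilon^2}*\eta$. For $f=f(t,u)$, $t>0$, $u\in\mathbb R$, write $f'=\partial_uf$ and define $F$ by $f(t,u)=t^{-3/2}F(t,t^{1/2}u)$. We say $f\in\bar S_1(L_1,L_2)$ ($L_1,L_2\ge0$) if $F$ is continuous on $(0,\infty)\times\mathbb R$ and for each $t>0$ the function $F(t,\cdot)$ is odd and differentiable with $\mathrm{Lip}(F(t,\cdot))\le L_1$ and $\mathrm{Lip}(F'(t,\cdot))\le L_2$. We say $f\in\bar S_2(\gamma_1,\gamma_2,\ell_1,\ell_2)$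 ($\gamma_1\ge2$, $\gamma_2\ge1$, $\ell_1,\ell_2\ge0$) if $F$ is continuous on $(0,\infty)\times\mathbb R$ and for each $t>0$ the function $F(t,\cdot)$ is odd, differentiable and non-decreasing with locally Lipschitz derivative, and $\mathrm{Lip}(F(t,\cdot)|_{[0,u]})\le\ell_1(1+u^{\gamma_1})$, $\mathrm{Lip}(F'(t,\cdot)|_{[0,u]})\le\ell_2(1+u^{\gamma_2})$ for all $u\ge0$. Finally $f\in\bar S$ if $f=f_1+f_2$ with $f_1\in\bar S_1(L_1,L_2)$ and $f_2\in\bar S_2(\gamma_1,\gamma_2,\ell_1,\ell_2)$ for some values of the parameters. A *solution* of the McKean–Vlasov equation $$\partial_tv=\tfrac12\Delta v+\mathfrak m v-\tfrac1{\log\varepsilon^{-1}}\mathbb E[f'(t+\varepsilon^2,v)]\,v,\qquad v(0,\cdot)=\eta_\varepsilon,\tag{1}$$ is a random field $v(t,x)$, $t\ge0$, $x\in\mathbb R^2$, such that $f'(t+\varepsilon^2,v(t,x))$ is integrable for all $t\ge 0$ and $x$ and, almost surely: $v$ is continuous on $[0,\infty)\times\mathbb R^2$; on $(0,\infty)\times\mathbb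 R^2$ it is $C^1$, and $C^\infty$ in $x$ with all spatial derivatives jointly continuous in $(t,x)$; (1) holds for all $t>0$ and $x$; and, for every $T$, the functions $\sup_{t\in[0,T]}|v(t,\cdot)|$ and $\sup_{t\in[0,T]}\mathbb E|f'(t+\varepsilon^2,v(t,\cdot))|$ are bounded by $Ce^{\lambda|x|}$ for some $C$ and $\lambda>0$. **Lemma.** Let $f\in\bar S$ and $\mathfrak m\in\mathbb R$. Then $f'(t+\varepsilon^2,s\,G^{\mathfrak m}_t*\eta_\varepsilon(x))$ is integrable for all $t\ge0$, $s\in\mathbb R$, $x\in\mathbb R^2$, and there is a function $\sigma_\varepsilon:[0,\infty)\to(0,\infty)$ such that for every $x\in\mathbb R^2$ $$\dot\sigma_\varepsilon(t)=-\tfrac1{\log\varepsilon^{-1}}\mathbb E\big[f'(t+\varepsilon^2,\sigma_\varepsilon(t)\,G^{\mathfrak m}_t*\eta_\varepsilon(x))\big]\sigma_\varepsilon(t)\quad(t\ge0),\qquad\sigma_\varepsilon(0)=1;\tag{2}$$ for every $x$ and $T$, any solution of (2) on $[0,T]$ agrees there with $\sigma_\varepsilon$. If $f=f_1+f_2$ with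 $f_1\in\bar S_1(L_1,L_2)$ and $f_2\in\bar S_2(\gamma_1,\gamma_2,\ell_1,\ell_2)$, then for all $t\ge0$ $$0<\sigma_\varepsilon(t)\le\exp\Big\{\frac{L_1}{\log\varepsilon^{-1}}\int_0^t\frac{ds}{s+\varepsilon^2}\Big\},$$ and hence $\sigma_\varepsilon(t)\le e^{3L_1}$ whenever $t+\varepsilon^2\le\varepsilon^{-1}$. The random field $$v_\varepsilon(t,x)=\sigma_\varepsilon(t)\,G^{\mathfrak m}_t*\eta_\varepsilon(x)$$ is a solution of (1), and every solution of (1) almost surely coincides with it on $[0,\infty)\times\mathbb R^2$. If moreover $f$ has the self-similar form $f(t,u)=t^{-3/2}F(t^{1/2}u)$, then almost surely $v_\varepsilon$ is $C^\infty$ on $(0,\infty)\times\mathbb R^2$. -/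

import Mathlib

open MeasureTheory ProbabilityTheory
open scoped SchwartzMap Laplacian

noncomputable section

namespace McKeanVlasov

/-- The plane `ℝ²` with its Euclidean norm. -/
abbrev Plane : Type := EuclideanSpace ℝ (Fin 2)

/-! ### Heat kernels -/

/-- The standard heat kernel `G_t(x) = (2πt)⁻¹ exp(-|x|²/(2t))`, for `t > 0`. -/
def heatKernel (t : ℝ) (x : Plane) : ℝ :=
  1 / (2 * Real.pi * t) * Real.exp (-‖x‖ ^ 2 / (2 * t))

/-- The massive heat kernel `G^m_t(x) = e^{mt} G_t(x)`, for `t > 0`. -/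
def massHeatKernel (m t : ℝ) (x : Plane) : ℝ :=
  Real.exp (m * t) * heatKernel t x

/-- The spatial convolution `G^m_t * g`; at `t = 0` the kernel `G^m_0` is the Dirac mass. -/
def heatFlow (m t : ℝ) (g : Plane → ℝ) (x : Plane) : ℝ :=
  if t = 0 then g x else ∫ y, massHeatKernel m t (x - y) * g y

lemma contDiff_heatKernel (t : ℝ) : ContDiff ℝ (⊤ : ℕ∞) (heatKernel t) := by
  unfold heatKernel
  exact contDiff_const.mul (Real.contDiff_exp.comp (((contDiff_norm_sq ℝ).neg).div_const _))

lemma one_add_pow_mul_exp_le {a : ℝ} (ha : 0 < a) (N : ℕ) {r : ℝ} (hr : 0 ≤ r) :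
    (1 + r) ^ N * Real.exp (-(a * r ^ 2)) ≤ (2 / a) ^ N * N.factorial * Real.exp a := by
  have h1 : (1 + r) ^ N ≤ (2 * (1 + r ^ 2)) ^ N := by
    apply pow_le_pow_left₀ (by positivity)
    nlinarith [sq_nonneg (r - 1)]
  have h2 : (a * (1 + r ^ 2)) ^ N / N.factorial ≤ Real.exp (a * (1 + r ^ 2)) :=
    Real.pow_div_factorial_le_exp _ (by positivity) N
  have h3 : (a * (1 + r ^ 2)) ^ N ≤ Real.exp (a * (1 + r ^ 2)) * N.factorial := by
    rwa [div_le_iff₀ (by positivity)] at h2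
  have h4 : (2 * (1 + r ^ 2)) ^ N = (2 / a) ^ N * (a * (1 + r ^ 2)) ^ N := by
    rw [← mul_pow]; congr 1; field_simp
  have h5 : Real.exp (a * (1 + r ^ 2)) * Real.exp (-(a * r ^ 2)) = Real.exp a := by
    rw [← Real.exp_add]; congr 1; ring
  calc (1 + r) ^ N * Real.exp (-(a * r ^ 2))
      ≤ ((2 / a) ^ N * (Real.exp (a * (1 + r ^ 2)) * N.factorial)) * Real.exp (-(a * r ^ 2)) := by
        apply mul_le_mul_of_nonneg_right _ (Real.exp_nonneg _)
        rw [h4] at h1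
        exact h1.trans (mul_le_mul_of_nonneg_left h3 (by positivity))
    _ = (2 / a) ^ N * N.factorial * (Real.exp (a * (1 + r ^ 2)) * Real.exp (-(a * r ^ 2))) := by
        ring
    _ = _ := by rw [h5]

lemma heatKernel_decay {t : ℝ} (ht : 0 < t) (k n : ℕ) :
    ∃ C : ℝ, ∀ x : Plane, ‖x‖ ^ k * ‖iteratedFDeriv ℝ n (heatKernel t) x‖ ≤ C := by
  set a : ℝ := 1 / (2 * t) with ha_def
  have ha : 0 < a := by positivity
  set q : Plane → ℝ := fun x => -‖x‖ ^ 2 / (2 * t) with hq_def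
  have hq_eq : ∀ x, q x = -(a * ‖x‖ ^ 2) := fun x => by simp only [hq_def, ha_def]; ring
  have hq : Function.HasTemperateGrowth q := by
    have h1 : Function.HasTemperateGrowth (fun x : Plane => ‖x‖ ^ 2) := by fun_prop
    have h2 : q = fun x => (-a) * ‖x‖ ^ 2 := by
      funext x; rw [hq_eq]; ring
    rw [h2]; fun_prop
  have hqs : ContDiff ℝ (⊤ : ℕ∞) q := hq.1
  obtain ⟨K, C, hC0, hC⟩ := hq.norm_iteratedFDeriv_le_uniform n
  set D : Plane → ℝ := fun x => (C + 1) * (1 + ‖x‖) ^ K with hD_def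
  have hD1 : ∀ x, 1 ≤ D x := fun x =>
    one_le_mul_of_one_le_of_one_le (by linarith) (one_le_pow₀ (by linarith [norm_nonneg x]))
  have hcomp : ∀ x, ‖iteratedFDeriv ℝ n (Real.exp ∘ q) x‖
      ≤ n.factorial * Real.exp (q x) * D x ^ n := by
    intro x
    refine norm_iteratedFDeriv_comp_le (N := ((⊤ : ℕ∞) : WithTop ℕ∞)) Real.contDiff_exp hqs
      (by exact_mod_cast le_top) x ?_ ?_
    · intro i _
      rw [norm_iteratedFDeriv_eq_norm_iteratedDeriv, iteratedDeriv_eq_iterate,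
        Real.iter_deriv_exp, Real.norm_eq_abs, abs_of_pos (Real.exp_pos _)]
    · intro i hi1 hin
      refine (hC i hin x).trans ?_
      refine le_trans ?_ (le_self_pow₀ (hD1 x) (by omega))
      exact mul_le_mul_of_nonneg_right (by linarith) (by positivity)
  have hker : heatKernel t = fun x => (1 / (2 * Real.pi * t)) • (Real.exp ∘ q) x := by
    funext x; simp [heatKernel, hq_def]
  have hexp : ContDiff ℝ (⊤ : ℕ∞) (Real.exp ∘ q) := Real.contDiff_exp.comp hqs
  refine ⟨(1 / (2 * Real.pi * t)) * (n.factorial * (C + 1) ^ n) *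
    ((2 / a) ^ (k + K * n) * (k + K * n).factorial * Real.exp a), fun x => ?_⟩
  have h1 : ‖iteratedFDeriv ℝ n (heatKernel t) x‖
      = (1 / (2 * Real.pi * t)) * ‖iteratedFDeriv ℝ n (Real.exp ∘ q) x‖ := by
    rw [hker, iteratedFDeriv_const_smul_apply' ((hexp.of_le (by exact_mod_cast le_top)).contDiffAt),
      norm_smul, Real.norm_eq_abs, abs_of_pos (by positivity)]
  have h2 : ‖x‖ ^ k ≤ (1 + ‖x‖) ^ k :=
    pow_le_pow_left₀ (norm_nonneg x) (by linarith) k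
  have h3 := one_add_pow_mul_exp_le ha (k + K * n) (norm_nonneg x)
  calc ‖x‖ ^ k * ‖iteratedFDeriv ℝ n (heatKernel t) x‖
      ≤ (1 + ‖x‖) ^ k * ((1 / (2 * Real.pi * t)) *
          (n.factorial * Real.exp (q x) * D x ^ n)) := by
        rw [h1]
        exact mul_le_mul h2 (mul_le_mul_of_nonneg_left (hcomp x) (by positivity))
          (by positivity) (by positivity)
    _ = (1 / (2 * Real.pi * t)) * (n.factorial * (C + 1) ^ n) *
          ((1 + ‖x‖) ^ (k + K * n) * Real.exp (-(a * ‖x‖ ^ 2))) := by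
        rw [hq_eq, hD_def]; simp only [mul_pow, ← pow_mul, pow_add]; ring
    _ ≤ _ := mul_le_mul_of_nonneg_left h3 (by positivity)

/-- For `t > 0`, the heat kernel `G_t` as a Schwartz function. -/
def heatKernelSchwartz (t : ℝ) (ht : 0 < t) : 𝓢(Plane, ℝ) where
  toFun := heatKernel t
  smooth' := contDiff_heatKernel t
  decay' := heatKernel_decay ht

/-! ### White noise -/

/-- `η` is a spatial white noise on `ℝ²` under `P`: a random tempered distribution such that for
every real Schwartz function `φ` the pairing `⟨η, φ⟩` is a centred Gaussian random variable with
variance `∫ φ²`. As `η` is linear in `φ`, this makes `φ ↦ ⟨η, φ⟩` a centred Gaussian process with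
covariance `E[⟨η, φ⟩ ⟨η, ψ⟩] = ∫ φ ψ`. -/
def IsWhiteNoise {Ω : Type*} [MeasurableSpace Ω] (P : Measure Ω)
    (η : Ω → 𝓢(Plane, ℝ) →L[ℝ] ℝ) : Prop :=
  ∀ φ : 𝓢(Plane, ℝ),
    HasLaw (fun ω => η ω φ) (gaussianReal 0 (Real.toNNReal (∫ y, φ y ^ 2))) P

/-- The mollification `(G_{ε²} * T)(x) = ⟨T, G_{ε²}(· - x)⟩` of a tempered distribution `T`
(the kernel is even). -/
def mollify (ε : ℝ) (hε : 0 < ε) (T : 𝓢(Plane, ℝ) →L[ℝ] ℝ) (x : Plane) : ℝ :=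
  T (SchwartzMap.compSubConstCLM ℝ x (heatKernelSchwartz (ε ^ 2) (pow_pos hε 2)))

/-! ### Classes of nonlinearities -/

/-- The class `S₁(L₁, L₂)`. -/
structure MemS₁ (L₁ L₂ : ℝ) (F : ℝ → ℝ → ℝ) : Prop where
  L₁_nonneg : 0 ≤ L₁
  L₂_nonneg : 0 ≤ L₂
  continuousOn : ContinuousOn (fun p : ℝ × ℝ => F p.1 p.2) (Set.Ioi 0 ×ˢ Set.univ)
  odd : ∀ t > 0, Function.Odd (F t)
  differentiable : ∀ t > 0, Differentiable ℝ (F t)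
  lipschitz : ∀ t > 0, LipschitzWith L₁.toNNReal (F t)
  lipschitz_deriv : ∀ t > 0, LipschitzWith L₂.toNNReal (deriv (F t))

/-- The class `S₂(γ₁, γ₂, ℓ₁, ℓ₂)`. -/
structure MemS₂ (γ₁ γ₂ l₁ l₂ : ℝ) (F : ℝ → ℝ → ℝ) : Prop where
  two_le_γ₁ : 2 ≤ γ₁
  one_le_γ₂ : 1 ≤ γ₂
  l₁_nonneg : 0 ≤ l₁
  l₂_nonneg : 0 ≤ l₂
  continuousOn : ContinuousOn (fun p : ℝ × ℝ => F p.1 p.2) (Set.Ioi 0 ×ˢ Set.univ)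
  odd : ∀ t > 0, Function.Odd (F t)
  differentiable : ∀ t > 0, Differentiable ℝ (F t)
  monotone : ∀ t > 0, Monotone (F t)
  locallyLipschitz_deriv : ∀ t > 0, LocallyLipschitz (deriv (F t))
  lipschitzOn : ∀ t > 0, ∀ u ≥ 0,
    LipschitzOnWith (Real.toNNReal (l₁ * (1 + u ^ γ₁))) (F t) (Set.Icc 0 u)
  lipschitzOn_deriv : ∀ t > 0, ∀ u ≥ 0,
    LipschitzOnWith (Real.toNNReal (l₂ * (1 + u ^ γ₂))) (deriv (F t)) (Set.Icc 0 u)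

/-- The class `S = S₁ + S₂`. Only positive times matter. -/
def MemS (F : ℝ → ℝ → ℝ) : Prop :=
  ∃ F₁ F₂ : ℝ → ℝ → ℝ, (∃ L₁ L₂, MemS₁ L₁ L₂ F₁) ∧ (∃ γ₁ γ₂ l₁ l₂, MemS₂ γ₁ γ₂ l₁ l₂ F₂) ∧
    ∀ t > 0, ∀ u, F t u = F₁ t u + F₂ t u

/-- The rescaled function `F` with `f(t,u) = t^{-3/2} F(t, t^{1/2} u)` for `t > 0`. -/
def rescale (f : ℝ → ℝ → ℝ) (t u : ℝ) : ℝ :=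
  t ^ (3 / 2 : ℝ) * f t (u / Real.sqrt t)

/-- `f ∈ S̄₁(L₁, L₂)`. -/
def MemSbar₁ (L₁ L₂ : ℝ) (f : ℝ → ℝ → ℝ) : Prop := MemS₁ L₁ L₂ (rescale f)

/-- `f ∈ S̄₂(γ₁, γ₂, ℓ₁, ℓ₂)`. -/
def MemSbar₂ (γ₁ γ₂ l₁ l₂ : ℝ) (f : ℝ → ℝ → ℝ) : Prop := MemS₂ γ₁ γ₂ l₁ l₂ (rescale f)

/-- `f ∈ S̄`. -/
def MemSbar (f : ℝ → ℝ → ℝ) : Prop := MemS (rescale f)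

/-! ### The McKean–Vlasov equation -/

/-- Regularity of classical solutions `v = v(t,x)`: continuous on `[0,∞) × ℝ²`; on `(0,∞) × ℝ²`
continuously differentiable, and infinitely differentiable in `x`, with all spatial derivatives
jointly continuous in `(t,x)`. -/
structure IsRegular (v : ℝ → Plane → ℝ) : Prop where
  continuousOn : ContinuousOn (fun p : ℝ × Plane => v p.1 p.2) (Set.Ici 0 ×ˢ Set.univ)
  contDiffOn_one : ContDiffOn ℝ 1 (fun p : ℝ × Plane => v p.1 p.2) (Set.Ioi 0 ×ˢ Set.univ)
  contDiff_space : ∀ t > 0, ContDiff ℝ (⊤ : ℕ∞) (v t)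
  continuousOn_space : ∀ n : ℕ,
    ContinuousOn (fun p : ℝ × Plane => iteratedFDeriv ℝ n (v p.1) p.2) (Set.Ioi 0 ×ˢ Set.univ)

/-- For every `T`, the function `sup_{t ∈ [0,T]} |g(t,·)|` grows at most exponentially:
`sup_x sup_{t ∈ [0,T]} |g(t,x)| e^{-a|x|} < ∞` for some `a > 0`. -/
def ExpGrowth (g : ℝ → Plane → ℝ) : Prop :=
  ∀ T : ℝ, ∃ a > 0, ∃ C : ℝ, ∀ t ∈ Set.Icc 0 T, ∀ x, |g t x| ≤ C * Real.exp (a * ‖x‖)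

variable {Ω : Type*} [MeasurableSpace Ω]

/-- The random field `v = v(ω,t,x)` is a solution of
`∂_t v = ½ Δv + m v - (log ε⁻¹)⁻¹ E[f'(t+ε², v)] v`, `v(0,·) = g`,
where `f'` is the derivative of `f` in its second argument. -/
structure IsSolution (P : Measure Ω) (m ε : ℝ) (f : ℝ → ℝ → ℝ) (g : Ω → Plane → ℝ)
    (v : Ω → ℝ → Plane → ℝ) : Prop where
  aemeasurable : ∀ t ≥ 0, ∀ x, AEMeasurable (fun ω => v ω t x) P
  regular : ∀ᵐ ω ∂P, IsRegular (v ω)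
  initial : ∀ᵐ ω ∂P, ∀ x, v ω 0 x = g ω x
  integrable : ∀ t ≥ 0, ∀ x, Integrable (fun ω => deriv (f (t + ε ^ 2)) (v ω t x)) P
  equation : ∀ᵐ ω ∂P, ∀ t > 0, ∀ x,
    deriv (fun s => v ω s x) t = 1 / 2 * (Δ (v ω t)) x + m * v ω t x
      - 1 / Real.log ε⁻¹ * (∫ ω', deriv (f (t + ε ^ 2)) (v ω' t x) ∂P) * v ω t x
  growth : ∀ᵐ ω ∂P, ExpGrowth (v ω)
  growth_coeff : ExpGrowth fun t x => ∫ ω, |deriv (f (t + ε ^ 2)) (v ω t x)| ∂P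

/-- `τ` solves, on the time set `I` (an interval containing `0`), the initial value problem
`τ'(t) = -(log ε⁻¹)⁻¹ E[f'(t+ε², τ(t) (G^m_t * g)(x))] τ(t)`, `τ(0) = 1`, where `x` is a fixed
point of the plane and `g` a random field. Derivatives at end points of `I` are one-sided. -/
def SolvesODE (P : Measure Ω) (m ε : ℝ) (f : ℝ → ℝ → ℝ) (g : Ω → Plane → ℝ) (x : Plane)
    (I : Set ℝ) (τ : ℝ → ℝ) : Prop :=
  τ 0 = 1 ∧ ∀ t ∈ I, HasDerivWithinAt τ
    (-(1 / Real.log ε⁻¹) *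
      (∫ ω, deriv (f (t + ε ^ 2)) (τ t * heatFlow m t (g ω) x) ∂P) * τ t) I t

end McKeanVlasov

end

/-!
The law of `G^m_t * η_ε(x)` is a centred Gaussian which does not depend on `x`. On fields
`v = σ(t) G^m_t * η_ε` the coefficient `E[f'(t+ε², v)]` is therefore a function of `t` and `σ(t)`
alone, and the nonlocal equation becomes a scalar ordinary differential equation for `σ`, with a
right-hand side which is locally Lipschitz in `σ`.

As `f₂` is non-decreasing in `u`, `f'(t, u) ≥ -L₁/t`. This keeps `σ` from exploding and gives its
explicit bound. By the maximum principle it also gives `|v| ≤ W` for every solution `v`, where `W`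
solves, with initial datum `|η_ε|`, the linear equation in which `E[f'(t+ε², v)]` is replaced by its
lower bound; the moments of `W` are controlled by Gaussian moments. If the coefficients of two
solutions differ by at most `N e^{bt}`, comparison with a multiple of `N b⁻¹ e^{bt} W` bounds the
difference of the solutions, hence again that of their coefficients. For large `b` this is a
contraction, so the coefficients agree, and with them the solutions.

In the self-similar case the coefficient is `(t+ε²)⁻¹ A(c e^{mt} σ(t))`, where `A(q)` is the mean of
a fixed function under the centred Gaussian law of standard deviation `q`. Such a mean is smooth in
`q > 0` without any smoothness of the function, so `σ` is smooth by a bootstrap.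
-/

noncomputable section

namespace McKeanVlasov

/-! ### Exponential integrals -/

section ExpIntegral

variable {Y : Type*} [MeasurableSpace Y] {μ : Measure Y}
  {E V : Type*} [NormedAddCommGroup E] [NormedSpace ℝ E] [NormedAddCommGroup V] [NormedSpace ℝ V]
  {S : Y → E →L[ℝ] ℝ} {h : Y → V} {θ : E}

/-- The exponential integral `θ ↦ ∫ e^{S(y) θ} h(y) dμ(y)`, a Laplace transform with sufficient
statistic `S`. -/
def expIntegral (μ : Measure Y) (S : Y → E →L[ℝ] ℝ) (h : Y → V) (θ : E) : V :=
  ∫ y, Real.exp (S y θ) • h y ∂μ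

/-- Absolute convergence of the exponential integral at `θ`, uniformly over some ball around `θ`;
the exponent `r ‖S y‖` is the largest value of `S y` on a ball of radius `r`. -/
def ExpIntegrableAt (μ : Measure Y) (S : Y → E →L[ℝ] ℝ) (h : Y → V) (θ : E) : Prop :=
  ∃ r > 0, Integrable (fun y => Real.exp (S y θ + r * ‖S y‖) * ‖h y‖) μ

lemma aestronglyMeasurable_exp_apply (hS : AEStronglyMeasurable S μ) (θ : E) :
    AEStronglyMeasurable (fun y => Real.exp (S y θ)) μ :=
  Real.continuous_exp.comp_aestronglyMeasurable
    ((ContinuousLinearMap.apply ℝ ℝ θ).continuous.comp_aestronglyMeasurable hS)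

lemma aestronglyMeasurable_smulRight (hS : AEStronglyMeasurable S μ)
    (hh : AEStronglyMeasurable h μ) :
    AEStronglyMeasurable (fun y => (S y).smulRight (h y)) μ :=
  isBoundedBilinearMap_smulRight.continuous.comp_aestronglyMeasurable (hS.prodMk hh)

lemma ExpIntegrableAt.smulRight (hS : AEStronglyMeasurable S μ) (hh : AEStronglyMeasurable h μ)
    (H : ExpIntegrableAt μ S h θ) : ExpIntegrableAt μ S (fun y => (S y).smulRight (h y)) θ := by
  obtain ⟨r, hr, hint⟩ := H
  refine ⟨r / 2, by positivity, (hint.const_mul (2 / r)).mono' ?_ (ae_of_all _ fun y => ?_)⟩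
  · simp only [Real.exp_add]
    exact ((aestronglyMeasurable_exp_apply hS θ).mul (Real.continuous_exp.comp_aestronglyMeasurable
      (hS.norm.const_mul _))).mul (aestronglyMeasurable_smulRight hS hh).norm
  · rw [Real.norm_eq_abs, abs_of_nonneg (by positivity), ContinuousLinearMap.norm_smulRight_apply]
    have norm_le_exp : ‖S y‖ ≤ 2 / r * Real.exp (r / 2 * ‖S y‖) := by
      have hexp : r / 2 * ‖S y‖ ≤ Real.exp (r / 2 * ‖S y‖) := by
        linarith [Real.add_one_le_exp (r / 2 * ‖S y‖)]
      calc ‖S y‖ = 2 / r * (r / 2 * ‖S y‖) := by field_simp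
        _ ≤ _ := by gcongr
    calc Real.exp (S y θ + r / 2 * ‖S y‖) * (‖S y‖ * ‖h y‖)
        ≤ Real.exp (S y θ + r / 2 * ‖S y‖) * ((2 / r * Real.exp (r / 2 * ‖S y‖)) * ‖h y‖) := by
          gcongr
      _ = 2 / r * (Real.exp (S y θ + r / 2 * ‖S y‖ + r / 2 * ‖S y‖) * ‖h y‖) := by
          rw [Real.exp_add (S y θ + r / 2 * ‖S y‖)]; ring
      _ = 2 / r * (Real.exp (S y θ + r * ‖S y‖) * ‖h y‖) := by rw [add_assoc, ← add_mul, add_halves]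

lemma ExpIntegrableAt.integrable (hS : AEStronglyMeasurable S μ) (hh : AEStronglyMeasurable h μ)
    (H : ExpIntegrableAt μ S h θ) : Integrable (fun y => Real.exp (S y θ) • h y) μ := by
  obtain ⟨r, hr, hint⟩ := H
  refine hint.mono' ((aestronglyMeasurable_exp_apply hS θ).smul hh) (ae_of_all _ fun y => ?_)
  rw [norm_smul, Real.norm_eq_abs, abs_of_pos (Real.exp_pos _)]
  gcongr
  exact le_add_of_nonneg_right (by positivity)

lemma ExpIntegrableAt.hasFDerivAt_expIntegral (hS : AEStronglyMeasurable S μ)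
    (hh : AEStronglyMeasurable h μ) (H : ExpIntegrableAt μ S h θ) :
    HasFDerivAt (expIntegral μ S h) (expIntegral μ S (fun y => (S y).smulRight (h y)) θ) θ := by
  obtain ⟨r, hr, hint⟩ := H.smulRight hS hh
  refine hasFDerivAt_integral_of_dominated_of_fderiv_le
    (F' := fun (θ : E) y => Real.exp (S y θ) • (S y).smulRight (h y)) (Metric.ball_mem_nhds θ hr)
    (Filter.Eventually.of_forall fun θ' => (aestronglyMeasurable_exp_apply hS θ').smul hh)
    (H.integrable hS hh)
    ((aestronglyMeasurable_exp_apply hS θ).smul (aestronglyMeasurable_smulRight hS hh))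
    (ae_of_all _ fun y θ' hθ' => ?_) hint (ae_of_all _ fun y θ' _ => ?_)
  · rw [norm_smul, Real.norm_eq_abs, abs_of_pos (Real.exp_pos _)]
    gcongr
    calc S y θ' = S y θ + S y (θ' - θ) := by rw [map_sub]; ring
      _ ≤ S y θ + ‖S y‖ * ‖θ' - θ‖ := by
          gcongr
          exact (le_abs_self _).trans ((S y).le_opNorm _)
      _ ≤ S y θ + r * ‖S y‖ := by
          rw [mul_comm r]
          gcongr
          exact (mem_ball_iff_norm.1 hθ').le
  · refine ((S y).hasFDerivAt.exp.smul_const (h y)).congr_fderiv ?_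
    ext v
    simp [mul_smul]

lemma ExpIntegrableAt.expIntegral_smulRight_apply (hS : AEStronglyMeasurable S μ)
    (hh : AEStronglyMeasurable h μ) (H : ExpIntegrableAt μ S h θ) (v : E) :
    expIntegral μ S (fun y => (S y).smulRight (h y)) θ v =
      expIntegral μ S (fun y => S y v • h y) θ := by
  unfold expIntegral
  rw [ContinuousLinearMap.integral_apply
    ((H.smulRight hS hh).integrable hS (aestronglyMeasurable_smulRight hS hh))]
  rfl

lemma ExpIntegrableAt.hasDerivAt_expIntegral_comp {γ : ℝ → E} {γ' : E} {r : ℝ}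
    (hS : AEStronglyMeasurable S μ) (hh : AEStronglyMeasurable h μ)
    (H : ExpIntegrableAt μ S h (γ r)) (hγ : HasDerivAt γ γ' r) :
    HasDerivAt (fun r => expIntegral μ S h (γ r))
      (expIntegral μ S (fun y => S y γ' • h y) (γ r)) r := by
  rw [← H.expIntegral_smulRight_apply hS hh]
  exact (H.hasFDerivAt_expIntegral hS hh).comp_hasDerivAt r hγ

lemma contDiffOn_expIntegral.{u} {E V : Type u} [NormedAddCommGroup E] [NormedSpace ℝ E]
    [NormedAddCommGroup V] [NormedSpace ℝ V] {S : Y → E →L[ℝ] ℝ} {h : Y → V} {Θ : Set E}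
    (hS : AEStronglyMeasurable S μ)
    (hh : AEStronglyMeasurable h μ) (H : ∀ θ ∈ Θ, ExpIntegrableAt μ S h θ) :
    ContDiffOn ℝ (⊤ : ℕ∞) (expIntegral μ S h) Θ := by
  refine contDiffOn_infty.2 fun n => ?_
  induction n generalizing V with
  | zero =>
    exact contDiffOn_zero.2 fun θ hθ =>
      ((H θ hθ).hasFDerivAt_expIntegral hS hh).continuousAt.continuousWithinAt
  | succ n ih =>
    rw [Nat.cast_succ, contDiffOn_succ_iff_hasFDerivWithinAt (by simp)]
    refine fun θ hθ => ⟨Θ, by simp [Set.insert_eq_of_mem hθ, self_mem_nhdsWithin], by simp,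
      expIntegral μ S (fun y => (S y).smulRight (h y)),
      fun θ' hθ' => ((H θ' hθ').hasFDerivAt_expIntegral hS hh).hasFDerivWithinAt,
      ih (aestronglyMeasurable_smulRight hS hh) fun θ' hθ' => (H θ' hθ').smulRight hS hh⟩

end ExpIntegral

/-! ### The parabolic maximum principle -/

lemma deriv_deriv_nonpos_of_isLocalMax {g : ℝ → ℝ} {x : ℝ} (hmax : IsLocalMax g x)
    (hg : ContinuousAt g x) : deriv (deriv g) x ≤ 0 := by
  by_contra! hpos
  have hmin : IsLocalMin g x := isLocalMin_of_deriv_deriv_pos hpos hmax.deriv_eq_zero hg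
  have hconst : g =ᶠ[nhds x] fun _ => g x := by
    filter_upwards [hmax, hmin] with y hle hge using le_antisymm hle hge
  have hzero : deriv (deriv g) x = 0 := by
    rw [hconst.deriv.deriv_eq, deriv_const', deriv_const]
  exact hpos.ne' hzero

lemma deriv_nonneg_of_isMaxOn_Icc {g : ℝ → ℝ} {g' t : ℝ} (ht : 0 < t) (hg : HasDerivAt g g' t)
    (hmax : IsMaxOn g (Set.Icc 0 t) t) : 0 ≤ g' := by
  have htend := (hasDerivWithinAt_iff_tendsto_slope' Set.self_notMem_Iio).1
    (hg.hasDerivWithinAt (s := Set.Iio t))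
  refine ge_of_tendsto htend ?_
  filter_upwards [Ioo_mem_nhdsLT ht] with s hs
  rw [slope_def_field]
  exact div_nonneg_of_nonpos (sub_nonpos.2 (hmax ⟨hs.1.le, hs.2.le⟩)) (sub_nonpos.2 hs.2.le)

section Laplacian

variable {E : Type*} [NormedAddCommGroup E] [InnerProductSpace ℝ E] {f : E → ℝ} {x : E}

lemma hasLineDerivAt_fderiv_apply (hf : ContDiff ℝ 2 f) (x v : E) :
    HasLineDerivAt ℝ (fun y => fderiv ℝ f y v) (iteratedFDeriv ℝ 2 f x ![v, v]) x v := by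
  have hd : HasFDerivAt (fderiv ℝ f) (fderiv ℝ (fderiv ℝ f) x) x :=
    ((hf.fderiv_right (m := 1) (by norm_num)).differentiable one_ne_zero x).hasFDerivAt
  rw [iteratedFDeriv_two_apply]
  exact ((ContinuousLinearMap.apply ℝ ℝ v).hasFDerivAt.comp x hd).hasLineDerivAt v

lemma deriv_comp_line (hf : ContDiff ℝ 2 f) (x v : E) :
    deriv (fun r : ℝ => f (x + r • v)) = fun r => fderiv ℝ f (x + r • v) v := by
  funext r
  have hline : HasDerivAt (fun r : ℝ => x + r • v) v r := by
    simpa using ((hasDerivAt_id r).smul_const v).const_add x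
  exact ((hf.differentiable two_ne_zero _).hasFDerivAt.comp_hasDerivAt r hline).deriv

lemma iteratedFDeriv_two_nonpos_of_isLocalMax (hf : ContDiff ℝ 2 f)
    (hmax : IsLocalMax f x) (v : E) : iteratedFDeriv ℝ 2 f x ![v, v] ≤ 0 := by
  have hline : Continuous fun r : ℝ => x + r • v := by fun_prop
  have hmax_line : IsLocalMax (fun r : ℝ => f (x + r • v)) 0 := by
    have htend : Filter.Tendsto (fun r : ℝ => x + r • v) (nhds 0) (nhds x) := by
      simpa using hline.tendsto 0
    simpa [IsLocalMax, IsMaxFilter] using htend.eventually hmax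
  have hle := deriv_deriv_nonpos_of_isLocalMax hmax_line (hf.continuous.comp hline).continuousAt
  rw [deriv_comp_line hf] at hle
  exact (hasLineDerivAt_fderiv_apply hf x v).deriv.symm.trans_le hle

variable [FiniteDimensional ℝ E]

lemma laplacian_eq_sum_of_hasLineDerivAt {ι : Type*} [Fintype ι] (b : OrthonormalBasis ι ℝ E)
    (hf : ContDiff ℝ 2 f) {d : ι → E → ℝ} {k : ι → ℝ}
    (hd : ∀ i y, HasLineDerivAt ℝ f (d i y) y (b i))
    (hk : ∀ i, HasLineDerivAt ℝ (d i) (k i) x (b i)) : (Δ f) x = ∑ i, k i := by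
  rw [InnerProductSpace.laplacian_eq_iteratedFDeriv_orthonormalBasis f b]
  refine Finset.sum_congr rfl fun i _ => ?_
  have hdi : d i = fun y => fderiv ℝ f y (b i) := funext fun y =>
    (hd i y).unique ((hf.differentiable two_ne_zero y).hasFDerivAt.hasLineDerivAt (b i))
  exact (hasLineDerivAt_fderiv_apply hf x (b i)).unique (hdi ▸ hk i)

lemma laplacian_const_mul (hf : ContDiffAt ℝ 2 f x) (k : ℝ) :
    (Δ fun y => k * f y) x = k * (Δ f) x :=
  InnerProductSpace.laplacian_smul k hf

lemma laplacian_nonpos_of_isLocalMax (hf : ContDiff ℝ 2 f) (hmax : IsLocalMax f x) :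
    (Δ f) x ≤ 0 := by
  rw [InnerProductSpace.laplacian_eq_iteratedFDeriv_stdOrthonormalBasis]
  exact Finset.sum_nonpos fun i _ =>
    iteratedFDeriv_two_nonpos_of_isLocalMax hf hmax _

end Laplacian

section CoshBarrier

variable {ι : Type*} [Fintype ι]

/-- The function `∑ᵢ cosh (a xᵢ)`. It is an eigenfunction of the Laplacian of exponential growth,
and serves as a barrier at infinity in the maximum principle. -/
def coshBarrier (a : ℝ) (x : EuclideanSpace ℝ ι) : ℝ := ∑ i, Real.cosh (a * x i)

lemma contDiff_coshBarrier (a : ℝ) {n : WithTop ℕ∞} :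
    ContDiff ℝ n (coshBarrier a : EuclideanSpace ℝ ι → ℝ) := by
  unfold coshBarrier
  fun_prop

lemma coshBarrier_nonneg (a : ℝ) (x : EuclideanSpace ℝ ι) : 0 ≤ coshBarrier a x :=
  Finset.sum_nonneg fun _ _ => (Real.cosh_pos _).le

lemma coshBarrier_pos [Nonempty ι] (a : ℝ) (x : EuclideanSpace ℝ ι) : 0 < coshBarrier a x :=
  Finset.sum_pos (fun _ _ => Real.cosh_pos _) Finset.univ_nonempty

lemma laplacian_coshBarrier (a : ℝ) (x : EuclideanSpace ℝ ι) :
    (Δ (coshBarrier a : EuclideanSpace ℝ ι → ℝ)) x = a ^ 2 * coshBarrier a x := by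
  classical
  have hline (i j : ι) (y : EuclideanSpace ℝ ι) :
      HasDerivAt (fun r : ℝ => a * (y + r • EuclideanSpace.basisFun ι ℝ i) j)
        (a * if j = i then 1 else 0) 0 := by
    have h := ((hasDerivAt_id (0 : ℝ)).mul_const (if j = i then (1 : ℝ) else 0)).const_add (y j)
    simpa [PiLp.single_apply] using h.const_mul a
  have hfirst (i : ι) (y : EuclideanSpace ℝ ι) : HasLineDerivAt ℝ (coshBarrier a)
      (a * Real.sinh (a * y i)) y (EuclideanSpace.basisFun ι ℝ i) := by
    have h := HasDerivAt.fun_sum (u := Finset.univ) fun j _ => (hline i j y).cosh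
    refine h.congr_deriv ?_
    simp [mul_comm]
  have hsecond (i : ι) : HasLineDerivAt ℝ (fun y : EuclideanSpace ℝ ι => a * Real.sinh (a * y i))
      (a ^ 2 * Real.cosh (a * x i)) x (EuclideanSpace.basisFun ι ℝ i) := by
    refine ((hline i i x).sinh.const_mul a).congr_deriv ?_
    simp only [zero_smul, add_zero, if_true]
    ring
  rw [laplacian_eq_sum_of_hasLineDerivAt (EuclideanSpace.basisFun ι ℝ) (contDiff_coshBarrier a)
    hfirst hsecond, coshBarrier, Finset.mul_sum]

lemma exp_mul_norm_le_coshBarrier [Nonempty ι] {a : ℝ} (ha : 0 ≤ a) (x : EuclideanSpace ℝ ι) :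
    Real.exp (a * ‖x‖) ≤ 2 * coshBarrier (Fintype.card ι * a) x := by
  obtain ⟨i, -, hi⟩ := Finset.exists_max_image Finset.univ (fun i => |x i|) Finset.univ_nonempty
  have norm_le : ‖x‖ ≤ Fintype.card ι * |x i| := by
    have hcard : (1 : ℝ) ≤ Fintype.card ι := by exact_mod_cast Fintype.card_pos
    have hsq : ‖x‖ ^ 2 ≤ Fintype.card ι * |x i| ^ 2 := by
      rw [EuclideanSpace.norm_sq_eq, ← nsmul_eq_mul]
      exact Finset.sum_le_card_nsmul _ _ _ fun j hj => by
        simpa using pow_le_pow_left₀ (abs_nonneg _) (hi j hj) 2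
    refine le_of_sq_le_sq ?_ (by positivity)
    nlinarith [sq_nonneg |x i|]
  have exp_abs_le (y : ℝ) : Real.exp |y| ≤ 2 * Real.cosh y := by
    rw [← Real.cosh_abs, Real.cosh_eq]
    linarith [Real.exp_pos (-|y|)]
  calc Real.exp (a * ‖x‖) ≤ Real.exp |Fintype.card ι * a * x i| := by
        rw [abs_mul, abs_of_nonneg (by positivity : 0 ≤ Fintype.card ι * a), Real.exp_le_exp]
        nlinarith
    _ ≤ 2 * Real.cosh (Fintype.card ι * a * x i) := exp_abs_le _
    _ ≤ 2 * coshBarrier (Fintype.card ι * a) x := by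
        gcongr
        exact Finset.single_le_sum (f := fun i => Real.cosh (Fintype.card ι * a * x i))
          (fun _ _ => (Real.cosh_pos _).le) (Finset.mem_univ i)

end CoshBarrier

section MaximumPrinciple

variable {E : Type*} [NormedAddCommGroup E] [InnerProductSpace ℝ E]

/-- `u` is continuous on `[0,T] × E` and, for `0 < t ≤ T`, twice continuously differentiable in
space and differentiable in time with time derivative `u'`: the regularity in which the maximum
principle is formulated. -/
structure IsParabolic (T : ℝ) (u u' : ℝ → E → ℝ) : Prop where
  continuousOn : ContinuousOn (fun p : ℝ × E => u p.1 p.2) (Set.Icc 0 T ×ˢ Set.univ)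
  contDiff : ∀ t ∈ Set.Ioc 0 T, ContDiff ℝ 2 (u t)
  hasDerivAt : ∀ t ∈ Set.Ioc 0 T, ∀ x, HasDerivAt (fun s => u s x) (u' t x) t

lemma IsParabolic.exp_mul {T : ℝ} {u u' : ℝ → E → ℝ} (hu : IsParabolic T u u') (b : ℝ) :
    IsParabolic T (fun t x => Real.exp (b * t) * u t x)
      (fun t x => Real.exp (b * t) * (u' t x + b * u t x)) where
  continuousOn := (by fun_prop : Continuous fun p : ℝ × E => Real.exp (b * p.1)).continuousOn.mul
    hu.continuousOn
  contDiff t ht := contDiff_const.mul (hu.contDiff t ht)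
  hasDerivAt t ht x := by
    have hexp : HasDerivAt (fun s : ℝ => Real.exp (b * s)) (Real.exp (b * t) * b) t := by
      simpa using ((hasDerivAt_id t).const_mul b).exp
    exact (hexp.mul (hu.hasDerivAt t ht x)).congr_deriv (by ring)

variable [FiniteDimensional ℝ E]

lemma IsParabolic.nonpos_of_lt {T R : ℝ} {w w' : ℝ → E → ℝ} (hw : IsParabolic T w w')
    (hineq : ∀ t ∈ Set.Ioc 0 T, ∀ x, 0 < w t x → w' t x < 1 / 2 * (Δ (w t)) x)
    (hinit : ∀ x, w 0 x ≤ 0) (hfar : ∀ t ∈ Set.Icc 0 T, ∀ x, R ≤ ‖x‖ → w t x ≤ 0) :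
    ∀ t ∈ Set.Icc 0 T, ∀ x, w t x ≤ 0 := by
  intro t₁ ht₁ x₁
  by_contra! hpos₁
  have norm_lt {t : ℝ} (ht : t ∈ Set.Icc 0 T) {x : E} (hx : 0 < w t x) : ‖x‖ < R := by
    by_contra! hR
    exact (hfar t ht x hR).not_gt hx
  have hK : IsCompact (Set.Icc 0 T ×ˢ Metric.closedBall (0 : E) R) :=
    isCompact_Icc.prod (isCompact_closedBall _ _)
  obtain ⟨⟨t₀, x₀⟩, ⟨ht₀, -⟩, hmax⟩ := hK.exists_isMaxOn
    ⟨(t₁, x₁), ht₁, by simpa using (norm_lt ht₁ hpos₁).le⟩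
    (hw.continuousOn.mono (Set.prod_mono_right (Set.subset_univ _)))
  have le_max {t : ℝ} (ht : t ∈ Set.Icc 0 T) {x : E} (hx : ‖x‖ ≤ R) : w t x ≤ w t₀ x₀ :=
    hmax (show (t, x) ∈ _ from ⟨ht, by simpa using hx⟩)
  have hpos₀ : 0 < w t₀ x₀ := hpos₁.trans_le (le_max ht₁ (norm_lt ht₁ hpos₁).le)
  have hx₀ : ‖x₀‖ < R := norm_lt ht₀ hpos₀
  have ht₀' : t₀ ∈ Set.Ioc 0 T := by
    refine ⟨ht₀.1.lt_of_ne ?_, ht₀.2⟩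
    rintro rfl
    exact (hinit x₀).not_gt hpos₀
  have time_deriv_nonneg : 0 ≤ w' t₀ x₀ :=
    deriv_nonneg_of_isMaxOn_Icc ht₀'.1 (hw.hasDerivAt t₀ ht₀' x₀) fun s hs =>
      le_max ⟨hs.1, hs.2.trans ht₀.2⟩ hx₀.le
  have laplacian_nonpos : (Δ (w t₀)) x₀ ≤ 0 := by
    refine laplacian_nonpos_of_isLocalMax (hw.contDiff t₀ ht₀') ?_
    filter_upwards [continuous_norm.continuousAt.eventually_lt_const hx₀] with x hx
    exact le_max ht₀ hx.le
  linarith [hineq t₀ ht₀' x₀ hpos₀]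

variable {ι : Type*} [Fintype ι]

lemma exists_forall_exp_le_coshBarrier [Nonempty ι] {a : ℝ} (ha : 0 < a) (C : ℝ) {δ : ℝ}
    (hδ : 0 < δ) : ∃ R : ℝ, ∀ x : EuclideanSpace ℝ ι, R ≤ ‖x‖ →
      C * Real.exp (a * ‖x‖) ≤ δ * coshBarrier (Fintype.card ι * (2 * a)) x := by
  have htend : Filter.Tendsto (fun r : ℝ => δ / 2 * Real.exp (a * r)) Filter.atTop Filter.atTop :=
    (Real.tendsto_exp_atTop.comp (Filter.tendsto_id.const_mul_atTop ha)).const_mul_atTop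
      (by positivity)
  obtain ⟨R, hR⟩ := Filter.eventually_atTop.1 (htend.eventually_ge_atTop C)
  refine ⟨R, fun x hx => ?_⟩
  calc C * Real.exp (a * ‖x‖) ≤ δ / 2 * Real.exp (a * ‖x‖) * Real.exp (a * ‖x‖) := by
        gcongr
        exact hR _ hx
    _ = δ / 2 * Real.exp (2 * a * ‖x‖) := by rw [mul_assoc, ← Real.exp_add]; ring_nf
    _ ≤ δ / 2 * (2 * coshBarrier (Fintype.card ι * (2 * a)) x) := by
        gcongr
        exact exp_mul_norm_le_coshBarrier (by positivity) x
    _ = _ := by ring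

lemma IsParabolic.sub_coshBarrier {T : ℝ} {u u' : ℝ → EuclideanSpace ℝ ι → ℝ}
    (hu : IsParabolic T u u') (c κ δ : ℝ) :
    IsParabolic T (fun t x => u t x - δ * Real.exp (c * t) * coshBarrier κ x)
      (fun t x => u' t x - c * (δ * Real.exp (c * t) * coshBarrier κ x)) where
  continuousOn := by
    have hψ : Continuous (coshBarrier κ : EuclideanSpace ℝ ι → ℝ) :=
      (contDiff_coshBarrier (n := 0) κ).continuous
    exact hu.continuousOn.sub (by fun_prop : Continuous fun p : ℝ × EuclideanSpace ℝ ι =>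
      δ * Real.exp (c * p.1) * coshBarrier κ p.2).continuousOn
  contDiff t ht := (hu.contDiff t ht).sub (contDiff_const.mul (contDiff_coshBarrier κ))
  hasDerivAt t ht x := by
    have hexp : HasDerivAt (fun s : ℝ => Real.exp (c * s)) (Real.exp (c * t) * c) t := by
      simpa using ((hasDerivAt_id t).const_mul c).exp
    exact ((hu.hasDerivAt t ht x).sub ((hexp.const_mul δ).mul_const _)).congr_deriv (by ring)

lemma laplacian_sub_mul_coshBarrier {g : EuclideanSpace ℝ ι → ℝ} (hg : ContDiff ℝ 2 g) (k κ : ℝ)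
    (x : EuclideanSpace ℝ ι) : (Δ fun y => g y - k * coshBarrier κ y) x
      = (Δ g) x - κ ^ 2 * (k * coshBarrier κ x) := by
  have hψ : ContDiffAt ℝ 2 (coshBarrier κ) x := (contDiff_coshBarrier κ).contDiffAt
  have hsub := hg.contDiffAt.laplacian_sub (contDiffAt_const.mul hψ : ContDiffAt ℝ 2
    (fun y => k * coshBarrier κ y) x)
  rw [laplacian_const_mul hψ, laplacian_coshBarrier] at hsub
  exact hsub.trans (by ring)

lemma IsParabolic.nonpos_of_le_laplacian [Nonempty ι] {T a C : ℝ} (ha : 0 < a)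
    {u u' : ℝ → EuclideanSpace ℝ ι → ℝ} (hu : IsParabolic T u u')
    (hineq : ∀ t ∈ Set.Ioc 0 T, ∀ x, 0 < u t x → u' t x ≤ 1 / 2 * (Δ (u t)) x)
    (hinit : ∀ x, u 0 x ≤ 0)
    (hgrowth : ∀ t ∈ Set.Icc 0 T, ∀ x, u t x ≤ C * Real.exp (a * ‖x‖)) :
    ∀ t ∈ Set.Icc 0 T, ∀ x, u t x ≤ 0 := by
  set κ : ℝ := Fintype.card ι * (2 * a)
  set c : ℝ := κ ^ 2 / 2 + 1
  have hc : 0 ≤ c := by positivity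
  have le_barrier {δ : ℝ} (hδ : 0 < δ) : ∀ t ∈ Set.Icc 0 T, ∀ x,
      u t x - δ * Real.exp (c * t) * coshBarrier κ x ≤ 0 := by
    have barrier_pos (t : ℝ) (x : EuclideanSpace ℝ ι) :
        0 < δ * Real.exp (c * t) * coshBarrier κ x :=
      mul_pos (by positivity) (coshBarrier_pos κ x)
    obtain ⟨R, hR⟩ := exists_forall_exp_le_coshBarrier (ι := ι) ha C hδ
    refine (hu.sub_coshBarrier c κ δ).nonpos_of_lt (R := R) (fun t ht x hpos => ?_)
      (fun x => by linarith [hinit x, barrier_pos 0 x]) fun t ht x hx => ?_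
    · have hx := barrier_pos t x
      have hle := hineq t ht x (by linarith)
      rw [laplacian_sub_mul_coshBarrier (hu.contDiff t ht)]
      simp only [c]
      linarith
    · have one_le_exp : 1 ≤ Real.exp (c * t) := Real.one_le_exp (mul_nonneg hc ht.1)
      have hle : δ * coshBarrier κ x ≤ δ * Real.exp (c * t) * coshBarrier κ x := by
        have := mul_nonneg hδ.le (coshBarrier_nonneg κ x)
        nlinarith
      linarith [hgrowth t ht x, hR x hx]
  intro t ht x
  have htend : Filter.Tendsto (fun δ : ℝ => δ * Real.exp (c * t) * coshBarrier κ x)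
      (nhdsWithin 0 (Set.Ioi 0)) (nhds 0) := by
    have hcont : Continuous fun δ : ℝ => δ * Real.exp (c * t) * coshBarrier κ x := by fun_prop
    simpa using (hcont.tendsto 0).mono_left nhdsWithin_le_nhds
  refine ge_of_tendsto htend ?_
  filter_upwards [self_mem_nhdsWithin] with δ hδ
  exact sub_nonpos.1 (le_barrier hδ t ht x)

theorem IsParabolic.nonpos [Nonempty ι] {T a b C : ℝ} (ha : 0 < a)
    {u u' : ℝ → EuclideanSpace ℝ ι → ℝ} (hu : IsParabolic T u u')
    (hineq : ∀ t ∈ Set.Ioc 0 T, ∀ x, 0 < u t x → u' t x ≤ 1 / 2 * (Δ (u t)) x + b * u t x)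
    (hinit : ∀ x, u 0 x ≤ 0)
    (hgrowth : ∀ t ∈ Set.Icc 0 T, ∀ x, u t x ≤ C * Real.exp (a * ‖x‖)) :
    ∀ t ∈ Set.Icc 0 T, ∀ x, u t x ≤ 0 := by
  have hexp_ineq : ∀ t ∈ Set.Ioc 0 T, ∀ x, 0 < Real.exp (-b * t) * u t x →
      Real.exp (-b * t) * (u' t x + -b * u t x)
        ≤ 1 / 2 * (Δ fun y => Real.exp (-b * t) * u t y) x := by
    intro t ht x hpos
    have hle := hineq t ht x (pos_of_mul_pos_right hpos (Real.exp_pos _).le)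
    rw [laplacian_const_mul (hu.contDiff t ht).contDiffAt, mul_left_comm]
    exact mul_le_mul_of_nonneg_left (by linarith) (Real.exp_pos _).le
  have hexp_growth : ∀ t ∈ Set.Icc 0 T, ∀ x,
      Real.exp (-b * t) * u t x ≤ Real.exp (|b| * T) * |C| * Real.exp (a * ‖x‖) := by
    intro t ht x
    have hexp_le : Real.exp (-b * t) ≤ Real.exp (|b| * T) :=
      Real.exp_le_exp.2 (mul_le_mul (neg_le_abs b) ht.2 ht.1 (abs_nonneg b))
    calc Real.exp (-b * t) * u t x ≤ Real.exp (-b * t) * (|C| * Real.exp (a * ‖x‖)) := by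
          gcongr
          exact (hgrowth t ht x).trans (by gcongr; exact le_abs_self C)
      _ ≤ Real.exp (|b| * T) * |C| * Real.exp (a * ‖x‖) := by
          rw [mul_assoc]
          gcongr
  exact fun t ht x => nonpos_of_mul_nonpos_right ((hu.exp_mul (-b)).nonpos_of_le_laplacian ha
    hexp_ineq (fun x => by simpa using hinit x) hexp_growth t ht x) (Real.exp_pos _)

end MaximumPrinciple

/-! ### Gaussian integrals -/

section GaussianIntegrals

variable {E : Type*} [NormedAddCommGroup E] [InnerProductSpace ℝ E]

lemma norm_sub_sq_div_add_norm_sub_sq_div {s t : ℝ} (hs : 0 < s) (ht : 0 < t) (a b y : E) :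
    ‖y - a‖ ^ 2 / s + ‖y - b‖ ^ 2 / t = ‖a - b‖ ^ 2 / (s + t)
      + ‖y - ((t / (s + t)) • a + (s / (s + t)) • b)‖ ^ 2 / (s * t / (s + t)) := by
  set p := y - ((t / (s + t)) • a + (s / (s + t)) • b) with hp
  have ya_eq : y - a = p - (s / (s + t)) • (a - b) := by
    rw [hp]
    match_scalars <;> field_simp <;> ring
  have yb_eq : y - b = p + (t / (s + t)) • (a - b) := by
    rw [hp]
    match_scalars <;> field_simp <;> ring
  rw [ya_eq, yb_eq, norm_sub_sq_real, norm_add_sq_real, inner_smul_right, inner_smul_right,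
    norm_smul, norm_smul, Real.norm_of_nonneg (by positivity), Real.norm_of_nonneg (by positivity)]
  field_simp
  ring

lemma exp_mul_norm_sub_smul_le {a R S : ℝ} (ha : 0 ≤ a) {x : E} (hx : ‖x‖ ≤ R) {s : ℝ}
    (hs : |s| ≤ S) (z : E) :
    Real.exp (a * ‖x - s • z‖) ≤ Real.exp (a * R) * Real.exp (a * S * ‖z‖) := by
  have norm_le : ‖x - s • z‖ ≤ R + S * ‖z‖ := by
    refine (norm_sub_le _ _).trans ?_
    rw [norm_smul, Real.norm_eq_abs]
    gcongr
  rw [← Real.exp_add, mul_assoc, ← mul_add]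
  gcongr

variable [FiniteDimensional ℝ E] [MeasurableSpace E] [BorelSpace E]

lemma integrable_exp_neg_mul_sq_norm {b : ℝ} (hb : 0 < b) :
    Integrable (fun y : E => Real.exp (-b * ‖y‖ ^ 2)) := by
  have hcexp := (GaussianFourier.integrable_cexp_neg_mul_sq_norm_add (V := E) (b := (b : ℂ))
    (by simpa using hb) 0 0).norm
  simpa [Complex.norm_exp, ← Complex.ofReal_pow] using hcexp

lemma integrable_exp_neg_mul_sq_norm_add {b : ℝ} (hb : 0 < b) (c : ℝ) :
    Integrable (fun y : E => Real.exp (-b * ‖y‖ ^ 2 + c * ‖y‖)) := by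
  refine ((integrable_exp_neg_mul_sq_norm (half_pos hb)).const_mul
    (Real.exp (c ^ 2 / (2 * b)))).mono' (by fun_prop) (ae_of_all _ fun y => ?_)
  rw [Real.norm_eq_abs, Real.abs_exp, ← Real.exp_add, Real.exp_le_exp, ← sub_nonneg]
  have complete_square : c ^ 2 / (2 * b) + -(b / 2) * ‖y‖ ^ 2 - (-b * ‖y‖ ^ 2 + c * ‖y‖)
      = (c - b * ‖y‖) ^ 2 / (2 * b) := by
    field_simp
    ring
  rw [complete_square]
  positivity

end GaussianIntegrals

lemma heatKernel_nonneg {t : ℝ} (ht : 0 ≤ t) (x : Plane) : 0 ≤ heatKernel t x := by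
  unfold heatKernel
  positivity

lemma heatKernel_sub_comm (t : ℝ) (x y : Plane) : heatKernel t (x - y) = heatKernel t (y - x) := by
  rw [heatKernel, norm_sub_rev, heatKernel]

lemma continuous_heatKernel (t : ℝ) : Continuous (heatKernel t) :=
  (contDiff_heatKernel t).continuous

lemma heatKernel_eq_exp_neg_mul (t : ℝ) : heatKernel t =
    fun x => 1 / (2 * Real.pi * t) * Real.exp (-(1 / (2 * t)) * ‖x‖ ^ 2) := by
  funext x
  rw [heatKernel]
  ring_nf

lemma integral_heatKernel {t : ℝ} (ht : 0 < t) : ∫ x, heatKernel t x = 1 := by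
  rw [heatKernel_eq_exp_neg_mul, integral_const_mul,
    GaussianFourier.integral_rexp_neg_mul_sq_norm (by positivity), finrank_euclideanSpace_fin]
  norm_num
  field_simp

lemma integral_heatKernel_mul_heatKernel {s t : ℝ} (hs : 0 < s) (ht : 0 < t) (a b : Plane) :
    ∫ y, heatKernel s (y - a) * heatKernel t (y - b) = heatKernel (s + t) (a - b) := by
  set c : Plane := (t / (s + t)) • a + (s / (s + t)) • b
  have kernel_mul_kernel (y : Plane) : heatKernel s (y - a) * heatKernel t (y - b)
      = heatKernel (s + t) (a - b) * heatKernel (s * t / (s + t)) (y - c) := by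
    have exponent := norm_sub_sq_div_add_norm_sub_sq_div hs ht a b y
    simp only [heatKernel]
    rw [mul_mul_mul_comm, mul_mul_mul_comm (1 / (2 * Real.pi * (s + t))), ← Real.exp_add,
      ← Real.exp_add]
    congr 1
    · field_simp
    · congr 1
      simp only [div_mul_eq_div_div_swap, ← add_div, neg_div, ← neg_add]
      rw [exponent]
  simp_rw [kernel_mul_kernel]
  rw [integral_const_mul, integral_sub_right_eq_self (heatKernel (s * t / (s + t))) c,
    integral_heatKernel (by positivity), mul_one]

/-- The standard Gaussian measure on the plane. -/
def gaussPlane : Measure Plane :=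
  volume.withDensity fun z => ENNReal.ofReal (heatKernel 1 z)

lemma integral_gaussPlane (h : Plane → ℝ) :
    ∫ z, h z ∂gaussPlane = ∫ z, heatKernel 1 z * h z := by
  rw [gaussPlane, integral_withDensity_eq_integral_toReal_smul
    (continuous_heatKernel 1).measurable.ennreal_ofReal
    (ae_of_all _ fun _ => ENNReal.ofReal_lt_top)]
  simp only [ENNReal.toReal_ofReal (heatKernel_nonneg zero_le_one _), smul_eq_mul]

lemma integrable_gaussPlane_iff (h : Plane → ℝ) :
    Integrable h gaussPlane ↔ Integrable fun z => heatKernel 1 z * h z := by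
  rw [gaussPlane, integrable_withDensity_iff_integrable_smul'
    (continuous_heatKernel 1).measurable.ennreal_ofReal
    (ae_of_all _ fun _ => ENNReal.ofReal_lt_top)]
  simp only [ENNReal.toReal_ofReal (heatKernel_nonneg zero_le_one _), smul_eq_mul]

lemma integrable_exp_norm_gaussPlane (c : ℝ) :
    Integrable (fun z : Plane => Real.exp (c * ‖z‖)) gaussPlane := by
  rw [integrable_gaussPlane_iff]
  refine ((integrable_exp_neg_mul_sq_norm_add (b := 1 / (2 * 1)) (by norm_num) c).const_mul
    (1 / (2 * Real.pi * 1))).congr (ae_of_all _ fun z => ?_)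
  simp only [heatKernel_eq_exp_neg_mul, Real.exp_add, mul_assoc]

instance isProbabilityMeasure_gaussPlane : IsProbabilityMeasure gaussPlane := by
  have : IsFiniteMeasure gaussPlane := by
    have hint : Integrable (fun _ => (1 : ℝ)) gaussPlane := by
      simpa using integrable_exp_norm_gaussPlane 0
    exact (integrable_const_iff.1 hint).resolve_left one_ne_zero
  have hreal : gaussPlane.real Set.univ = 1 := by
    simpa [integral_heatKernel one_pos] using integral_gaussPlane fun _ => 1
  exact isProbabilityMeasure_iff_real.2 hreal

lemma heatFlow_eq_integral_gaussPlane (m : ℝ) {t : ℝ} (ht : 0 ≤ t) (g : Plane → ℝ) (x : Plane) :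
    heatFlow m t g x = Real.exp (m * t) * ∫ z, g (x - Real.sqrt t • z) ∂gaussPlane := by
  rcases ht.eq_or_lt with rfl | ht
  · simp [heatFlow]
  have kernel_scaling (z : Plane) : t * heatKernel t (Real.sqrt t • z) = heatKernel 1 z := by
    simp only [heatKernel, norm_smul, Real.norm_of_nonneg (Real.sqrt_nonneg t), mul_pow,
      Real.sq_sqrt ht.le]
    field_simp
  have change_of_variables : ∫ y, heatKernel t y * g (x - y)
      = ∫ z, heatKernel 1 z * g (x - Real.sqrt t • z) := by
    have h := Measure.integral_comp_smul (μ := (volume : Measure Plane))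
      (fun y => heatKernel t y * g (x - y)) (Real.sqrt t)
    rw [finrank_euclideanSpace_fin, Real.sq_sqrt ht.le, abs_of_pos (by positivity), smul_eq_mul,
      eq_inv_mul_iff_mul_eq₀ ht.ne', ← integral_const_mul] at h
    rw [← h]
    simp_rw [← kernel_scaling, mul_assoc]
  rw [heatFlow, if_neg ht.ne', integral_gaussPlane, ← change_of_variables,
    ← integral_sub_left_eq_self _ volume x, ← integral_const_mul]
  simp only [massHeatKernel, sub_sub_cancel, mul_assoc]

/-! ### The heat flow of functions of exponential growth -/

section TameFun

variable {E : Type*} [NormedAddCommGroup E] {h : E → ℝ}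

/-- Continuous functions of at most exponential growth: the initial data for which the heat flow is
defined for all times. -/
structure TameFun (h : E → ℝ) : Prop where
  continuous : Continuous h
  bound : ∃ C ≥ 0, ∃ a > 0, ∀ y, |h y| ≤ C * Real.exp (a * ‖y‖)

lemma TameFun.abs (H : TameFun h) : TameFun fun y => |h y| :=
  ⟨H.continuous.abs, by simpa using H.bound⟩

variable [InnerProductSpace ℝ E]

lemma TameFun.inner_sub_mul (H : TameFun h) (x v : E) :
    TameFun fun y => inner ℝ (y - x) v * h y := by
  obtain ⟨C, hC, a, ha, hb⟩ := H.bound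
  refine ⟨by have := H.continuous; fun_prop, Real.exp ‖x‖ * ‖v‖ * C, by positivity, a + 1,
    by positivity, fun y => ?_⟩
  have norm_sub_le_exp : ‖y - x‖ ≤ Real.exp ‖x‖ * Real.exp ‖y‖ := by
    rw [← Real.exp_add]
    linarith [norm_sub_le y x, Real.add_one_le_exp (‖x‖ + ‖y‖)]
  calc |inner ℝ (y - x) v * h y| ≤ ‖y - x‖ * ‖v‖ * |h y| := by
        rw [abs_mul]
        gcongr
        exact abs_real_inner_le_norm _ _
    _ ≤ Real.exp ‖x‖ * Real.exp ‖y‖ * ‖v‖ * (C * Real.exp (a * ‖y‖)) := by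
        gcongr
        exact hb y
    _ = Real.exp ‖x‖ * ‖v‖ * C * Real.exp ((a + 1) * ‖y‖) := by
        rw [add_mul, one_mul, Real.exp_add]
        ring

end TameFun

section GaussConv

-- `E` lives in the universe of `ℝ`, as `contDiffOn_expIntegral` requires.
variable {E : Type} [NormedAddCommGroup E] [InnerProductSpace ℝ E]

/-- The sufficient statistic `y ↦ ((α, β, γ) ↦ -α |y|² + ⟪y, β⟫ - γ)` of the Gaussian family. -/
def gaussStat (y : E) : ℝ × E × ℝ →L[ℝ] ℝ :=
  (-‖y‖ ^ 2) • ContinuousLinearMap.fst ℝ ℝ (E × ℝ)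
    + (innerSL ℝ y ∘L ContinuousLinearMap.fst ℝ E ℝ - ContinuousLinearMap.snd ℝ E ℝ)
      ∘L ContinuousLinearMap.snd ℝ ℝ (E × ℝ)

/-- The parameter at which the Gaussian statistic `gaussStat y` is `-|x - y|² / (2t)`. -/
def gaussParam (t : ℝ) (x : E) : ℝ × E × ℝ := (1 / 2 * t⁻¹, t⁻¹ • x, ‖x‖ ^ 2 / 2 * t⁻¹)

lemma gaussStat_apply (y : E) (θ : ℝ × E × ℝ) :
    gaussStat y θ = -θ.1 * ‖y‖ ^ 2 + inner ℝ y θ.2.1 - θ.2.2 := by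
  simp only [gaussStat, add_apply, smul_apply, ContinuousLinearMap.comp_apply, sub_apply,
    ContinuousLinearMap.coe_fst', ContinuousLinearMap.coe_snd', innerSL_apply_apply, smul_eq_mul]
  ring

lemma gaussStat_gaussParam (t : ℝ) (x y : E) :
    gaussStat y (gaussParam t x) = -‖y - x‖ ^ 2 / (2 * t) := by
  simp only [gaussStat_apply, gaussParam, inner_smul_right, norm_sub_sq_real]
  ring

lemma continuous_gaussStat : Continuous (gaussStat : E → ℝ × E × ℝ →L[ℝ] ℝ) := by
  unfold gaussStat
  have := (innerSL ℝ (E := E)).continuous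
  fun_prop

lemma norm_gaussStat_le (y : E) : ‖gaussStat y‖ ≤ ‖y‖ ^ 2 + ‖y‖ + 1 := by
  refine ContinuousLinearMap.opNorm_le_bound _ (by positivity) fun θ => ?_
  have norm_snd : ‖θ.2‖ ≤ ‖θ‖ := norm_snd_le θ
  calc ‖gaussStat y θ‖ ≤ |-θ.1 * ‖y‖ ^ 2| + |inner ℝ y θ.2.1| + |θ.2.2| := by
        rw [gaussStat_apply, Real.norm_eq_abs]
        exact (abs_sub _ _).trans (by gcongr; exact abs_add_le _ _)
    _ ≤ ‖θ‖ * ‖y‖ ^ 2 + ‖y‖ * ‖θ‖ + ‖θ‖ := by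
        rw [abs_mul, abs_neg, abs_of_nonneg (by positivity : 0 ≤ ‖y‖ ^ 2)]
        gcongr
        · exact norm_fst_le θ
        · exact (abs_real_inner_le_norm _ _).trans (by gcongr; exact (norm_fst_le _).trans norm_snd)
        · exact (norm_snd_le θ.2).trans norm_snd
    _ = _ := by ring

variable [MeasurableSpace E] [BorelSpace E] [FiniteDimensional ℝ E] {h : E → ℝ}

lemma aestronglyMeasurable_gaussStat :
    AEStronglyMeasurable (gaussStat : E → ℝ × E × ℝ →L[ℝ] ℝ) volume :=
  continuous_gaussStat.aestronglyMeasurable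

/-- The integral `∫ e^{-|y-x|²/(2t)} h(y) dy`, that is, the heat flow up to normalisation. -/
def gaussConv (h : E → ℝ) (t : ℝ) (x : E) : ℝ :=
  expIntegral volume gaussStat h (gaussParam t x)

lemma gaussConv_eq_integral (h : E → ℝ) (t : ℝ) (x : E) :
    gaussConv h t x = ∫ y, Real.exp (-‖y - x‖ ^ 2 / (2 * t)) * h y := by
  simp only [gaussConv, expIntegral, gaussStat_gaussParam, smul_eq_mul]

lemma TameFun.expIntegrableAt (H : TameFun h) {θ : ℝ × E × ℝ} (hθ : 0 < θ.1) :
    ExpIntegrableAt volume gaussStat h θ := by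
  obtain ⟨C, -, a, -, hb⟩ := H.bound
  refine ⟨θ.1 / 2, by positivity, ((integrable_exp_neg_mul_sq_norm_add (half_pos hθ)
    (‖θ.2.1‖ + θ.1 / 2 + a)).const_mul (Real.exp (θ.1 / 2 - θ.2.2) * C)).mono' ?_
    (ae_of_all _ fun y => ?_)⟩
  · have := H.continuous
    have := continuous_gaussStat (E := E)
    exact Continuous.aestronglyMeasurable (by fun_prop)
  · have stat_le : θ.1 / 2 * ‖gaussStat y‖ ≤ θ.1 / 2 * (‖y‖ ^ 2 + ‖y‖ + 1) := by
      gcongr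
      exact norm_gaussStat_le y
    rw [Real.norm_eq_abs, abs_of_nonneg (by positivity), Real.norm_eq_abs]
    calc Real.exp (gaussStat y θ + θ.1 / 2 * ‖gaussStat y‖) * |h y|
        ≤ Real.exp (θ.1 / 2 - θ.2.2 + (-(θ.1 / 2) * ‖y‖ ^ 2 + (‖θ.2.1‖ + θ.1 / 2) * ‖y‖))
          * (C * Real.exp (a * ‖y‖)) := by
          refine mul_le_mul (Real.exp_le_exp.2 ?_) (hb y) (abs_nonneg _) (Real.exp_nonneg _)
          rw [gaussStat_apply]
          linarith [real_inner_le_norm y θ.2.1]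
      _ = Real.exp (θ.1 / 2 - θ.2.2) * C
          * Real.exp (-(θ.1 / 2) * ‖y‖ ^ 2 + (‖θ.2.1‖ + θ.1 / 2 + a) * ‖y‖) := by
          rw [Real.exp_add, add_mul _ a, ← add_assoc, Real.exp_add _ (a * ‖y‖)]
          ring

lemma TameFun.expIntegrableAt_gaussParam (H : TameFun h) {t : ℝ} (ht : 0 < t) (x : E) :
    ExpIntegrableAt volume gaussStat h (gaussParam t x) :=
  H.expIntegrableAt (by simp only [gaussParam]; positivity)

lemma TameFun.integrable_gaussConv (H : TameFun h) {t : ℝ} (ht : 0 < t) (x : E) :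
    Integrable fun y => Real.exp (-‖y - x‖ ^ 2 / (2 * t)) * h y := by
  simpa only [gaussStat_gaussParam, smul_eq_mul] using
    (H.expIntegrableAt_gaussParam ht x).integrable aestronglyMeasurable_gaussStat
      H.continuous.aestronglyMeasurable

lemma TameFun.contDiffOn_gaussConv (H : TameFun h) : ContDiffOn ℝ (⊤ : ℕ∞)
    (fun p : ℝ × E => gaussConv h p.1 p.2) (Set.Ioi 0 ×ˢ Set.univ) := by
  have hinv : ContDiffOn ℝ (⊤ : ℕ∞) (fun p : ℝ × E => p.1⁻¹) (Set.Ioi 0 ×ˢ Set.univ) :=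
    contDiff_fst.contDiffOn.inv fun p hp => ne_of_gt hp.1
  have hnorm : ContDiff ℝ (⊤ : ℕ∞) fun p : ℝ × E => ‖p.2‖ ^ 2 / 2 :=
    ((contDiff_norm_sq ℝ).comp contDiff_snd).div_const 2
  have hparam : ContDiffOn ℝ (⊤ : ℕ∞) (fun p : ℝ × E => gaussParam p.1 p.2)
      (Set.Ioi 0 ×ˢ Set.univ) :=
    (contDiffOn_const.mul hinv).prodMk
      ((hinv.smul contDiff_snd.contDiffOn).prodMk (hnorm.contDiffOn.mul hinv))
  exact (contDiffOn_expIntegral (Θ := {θ : ℝ × E × ℝ | 0 < θ.1}) aestronglyMeasurable_gaussStat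
    H.continuous.aestronglyMeasurable fun θ hθ => H.expIntegrableAt hθ).comp hparam fun p hp =>
      Set.mem_ofPred.2 (mul_pos one_half_pos (inv_pos.2 (Set.mem_Ioi.1 hp.1)))

lemma TameFun.contDiff_gaussConv (H : TameFun h) {t : ℝ} (ht : 0 < t) :
    ContDiff ℝ (⊤ : ℕ∞) (gaussConv h t) :=
  contDiffOn_univ.1 (H.contDiffOn_gaussConv.comp (contDiff_prodMk_right t).contDiffOn
    fun x _ => ⟨ht, Set.mem_univ x⟩)

lemma TameFun.hasDerivAt_gaussConv_time (H : TameFun h) {t : ℝ} (ht : 0 < t) (x : E) :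
    HasDerivAt (fun s => gaussConv h s x)
      (1 / (2 * t ^ 2) * gaussConv (fun y => ‖y - x‖ ^ 2 * h y) t x) t := by
  have hinv : HasDerivAt (fun s : ℝ => s⁻¹) (-(t ^ 2)⁻¹) t := hasDerivAt_inv ht.ne'
  have hparam : HasDerivAt (fun s => gaussParam s x) (1 / 2 * -(t ^ 2)⁻¹, -(t ^ 2)⁻¹ • x,
      ‖x‖ ^ 2 / 2 * -(t ^ 2)⁻¹) t :=
    (hinv.const_mul _).prodMk ((hinv.smul_const x).prodMk (hinv.const_mul _))
  refine (ExpIntegrableAt.hasDerivAt_expIntegral_comp (γ := fun s => gaussParam s x)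
    aestronglyMeasurable_gaussStat H.continuous.aestronglyMeasurable
    (H.expIntegrableAt_gaussParam ht x) hparam).congr_deriv ?_
  rw [gaussConv, expIntegral, expIntegral, ← integral_const_mul]
  congr with y
  simp only [gaussStat_apply, inner_smul_right, norm_sub_sq_real, smul_eq_mul]
  ring

lemma TameFun.hasLineDerivAt_gaussConv (H : TameFun h) {t : ℝ} (ht : 0 < t) (x v : E) :
    HasLineDerivAt ℝ (gaussConv h t)
      (t⁻¹ * gaussConv (fun y => inner ℝ (y - x) v * h y) t x) x v := by
  have hline : HasDerivAt (fun r : ℝ => x + r • v) v 0 := by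
    simpa using ((hasDerivAt_id (0 : ℝ)).smul_const v).const_add x
  have hparam : HasDerivAt (fun r : ℝ => gaussParam t (x + r • v))
      (0, t⁻¹ • v, inner ℝ x v * t⁻¹) 0 := by
    refine (hasDerivAt_const 0 _).prodMk ((hline.const_smul t⁻¹).prodMk ?_)
    refine ((hline.norm_sq.div_const 2).mul_const t⁻¹).congr_deriv ?_
    simp
  refine (ExpIntegrableAt.hasDerivAt_expIntegral_comp (γ := fun r => gaussParam t (x + r • v))
    aestronglyMeasurable_gaussStat H.continuous.aestronglyMeasurable
    (H.expIntegrableAt_gaussParam ht _) hparam).congr_deriv ?_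
  rw [gaussConv, expIntegral, expIntegral, ← integral_const_mul, zero_smul, add_zero]
  congr with y
  simp only [gaussStat_apply, inner_smul_right, inner_sub_left, smul_eq_mul]
  ring

lemma TameFun.gaussConv_inner_sub_mul (H : TameFun h) {t : ℝ} (ht : 0 < t) (x₀ x v : E) :
    gaussConv (fun y => inner ℝ (y - x) v * h y) t x =
      gaussConv (fun y => inner ℝ (y - x₀) v * h y) t x - inner ℝ (x - x₀) v * gaussConv h t x := by
  simp only [gaussConv_eq_integral]
  rw [← integral_const_mul, ← integral_sub ((H.inner_sub_mul x₀ v).integrable_gaussConv ht x)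
    ((H.integrable_gaussConv ht x).const_mul _)]
  congr with y
  simp only [inner_sub_left]
  ring

lemma TameFun.hasLineDerivAt_hasLineDerivAt_gaussConv (H : TameFun h) {t : ℝ} (ht : 0 < t)
    (x v : E) : HasLineDerivAt ℝ
      (fun x => t⁻¹ * gaussConv (fun y => inner ℝ (y - x) v * h y) t x)
      (t⁻¹ * (t⁻¹ * gaussConv (fun y => inner ℝ (y - x) v * (inner ℝ (y - x) v * h y)) t x
        - ‖v‖ ^ 2 * gaussConv h t x)) x v := by
  simp_rw [H.gaussConv_inner_sub_mul ht x]
  have hinner : HasLineDerivAt ℝ (fun z => inner ℝ (z - x) v) (‖v‖ ^ 2) x v := by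
    refine HasDerivAt.congr_deriv (f' := 1 * ‖v‖ ^ 2) ?_ (one_mul _)
    simpa [inner_smul_left] using (hasDerivAt_id (0 : ℝ)).mul_const (‖v‖ ^ 2)
  refine ((((H.inner_sub_mul x v).hasLineDerivAt_gaussConv ht x v).fun_sub
    (hinner.fun_mul (H.hasLineDerivAt_gaussConv ht x v))).const_mul t⁻¹).congr_deriv ?_
  simp

lemma TameFun.laplacian_gaussConv (H : TameFun h) {t : ℝ} (ht : 0 < t) (x : E) :
    (Δ (gaussConv h t)) x = 1 / t ^ 2 * gaussConv (fun y => ‖y - x‖ ^ 2 * h y) t x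
      - Module.finrank ℝ E / t * gaussConv h t x := by
  set b := stdOrthonormalBasis ℝ E
  have hparseval : gaussConv (fun y => ‖y - x‖ ^ 2 * h y) t x
      = ∑ i, gaussConv (fun y => inner ℝ (y - x) (b i) * (inner ℝ (y - x) (b i) * h y)) t x := by
    simp only [gaussConv_eq_integral]
    rw [← integral_finsetSum _ fun i _ =>
      ((H.inner_sub_mul x (b i)).inner_sub_mul x (b i)).integrable_gaussConv ht x]
    congr with y
    rw [← b.sum_sq_inner_left (y - x), Finset.sum_mul, Finset.mul_sum]
    simp only [pow_two, mul_assoc]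
  rw [laplacian_eq_sum_of_hasLineDerivAt b (contDiff_infty.1 (H.contDiff_gaussConv ht) 2)
    (fun i y => H.hasLineDerivAt_gaussConv ht y (b i))
    (fun i => H.hasLineDerivAt_hasLineDerivAt_gaussConv ht x (b i)), hparseval]
  simp only [b.norm_eq_one, mul_sub, Finset.sum_sub_distrib, ← Finset.mul_sum, Finset.sum_const,
    Finset.card_univ, Fintype.card_fin, nsmul_eq_mul]
  field_simp

end GaussConv

section HeatFlow

lemma heatFlow_eq_gaussConv (m : ℝ) {t : ℝ} (ht : 0 < t) (g : Plane → ℝ) (x : Plane) :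
    heatFlow m t g x = Real.exp (m * t) * (1 / (2 * Real.pi) * t⁻¹ * gaussConv g t x) := by
  rw [heatFlow, if_neg ht.ne', gaussConv_eq_integral, ← integral_const_mul, ← integral_const_mul]
  congr with y
  rw [massHeatKernel, heatKernel_sub_comm, heatKernel]
  field_simp

variable {g : Plane → ℝ}

lemma TameFun.integrable_gaussPlane (H : TameFun g) (x : Plane) (s : ℝ) :
    Integrable (fun z => g (x - s • z)) gaussPlane := by
  obtain ⟨C, hC, a, ha, hb⟩ := H.bound
  have := H.continuous
  refine ((integrable_exp_norm_gaussPlane (a * |s|)).const_mul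
    (C * Real.exp (a * ‖x‖))).mono' (Continuous.aestronglyMeasurable (by fun_prop))
    (ae_of_all _ fun z => (hb _).trans ?_)
  rw [mul_assoc]
  gcongr
  exact exp_mul_norm_sub_smul_le ha.le le_rfl le_rfl z

lemma TameFun.continuousOn_heatFlow (H : TameFun g) (m : ℝ) :
    ContinuousOn (fun p : ℝ × Plane => heatFlow m p.1 g p.2) (Set.Ici 0 ×ˢ Set.univ) := by
  obtain ⟨C, hC, a, ha, hb⟩ := H.bound
  have := H.continuous
  have continuous_average : Continuous fun p : ℝ × Plane =>
      ∫ z, g (p.2 - Real.sqrt p.1 • z) ∂gaussPlane := by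
    refine continuous_iff_continuousAt.2 fun p₀ => continuousAt_of_dominated
      (bound := fun z => C * (Real.exp (a * (‖p₀.2‖ + 1)) *
        Real.exp (a * (Real.sqrt p₀.1 + 1) * ‖z‖)))
      (.of_forall fun p => Continuous.aestronglyMeasurable (by fun_prop)) ?_
      (((integrable_exp_norm_gaussPlane _).const_mul _).const_mul _)
      (ae_of_all _ fun z => Continuous.continuousAt (by fun_prop))
    have space_near : ∀ᶠ p : ℝ × Plane in nhds p₀, ‖p.2‖ < ‖p₀.2‖ + 1 :=
      continuous_snd.norm.continuousAt.eventually_lt_const (lt_add_one _)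
    have time_near : ∀ᶠ p : ℝ × Plane in nhds p₀, Real.sqrt p.1 < Real.sqrt p₀.1 + 1 :=
      continuous_fst.sqrt.continuousAt.eventually_lt_const (lt_add_one _)
    filter_upwards [space_near, time_near] with p hp_space hp_time
    refine ae_of_all _ fun z => (hb _).trans ?_
    gcongr
    refine exp_mul_norm_sub_smul_le ha.le hp_space.le ?_ z
    rw [abs_of_nonneg (Real.sqrt_nonneg _)]
    exact hp_time.le
  refine ((by fun_prop : Continuous fun p : ℝ × Plane =>
    Real.exp (m * p.1)).mul continuous_average).continuousOn.congr fun p hp => ?_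
  exact heatFlow_eq_integral_gaussPlane m hp.1 g p.2

lemma TameFun.expGrowth_heatFlow (H : TameFun g) (m : ℝ) :
    ExpGrowth fun t => heatFlow m t g := by
  intro T
  obtain ⟨C, hC, a, ha, hb⟩ := H.bound
  refine ⟨a, ha, Real.exp (|m| * T) * (C * ∫ z, Real.exp (a * Real.sqrt T * ‖z‖) ∂gaussPlane),
    fun t ht x => ?_⟩
  have average_le : ‖∫ z, g (x - Real.sqrt t • z) ∂gaussPlane‖
      ≤ C * (Real.exp (a * ‖x‖) * ∫ z, Real.exp (a * Real.sqrt T * ‖z‖) ∂gaussPlane) := by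
    rw [← integral_const_mul, ← integral_const_mul]
    refine norm_integral_le_of_norm_le
      (((integrable_exp_norm_gaussPlane _).const_mul _).const_mul _)
      (ae_of_all _ fun z => (hb _).trans ?_)
    gcongr
    refine exp_mul_norm_sub_smul_le ha.le le_rfl ?_ z
    rw [abs_of_nonneg (Real.sqrt_nonneg _)]
    exact Real.sqrt_le_sqrt ht.2
  calc |heatFlow m t g x|
      = Real.exp (m * t) * ‖∫ z, g (x - Real.sqrt t • z) ∂gaussPlane‖ := by
        rw [heatFlow_eq_integral_gaussPlane m ht.1, abs_mul, Real.abs_exp, Real.norm_eq_abs]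
    _ ≤ Real.exp (|m| * T)
        * (C * (Real.exp (a * ‖x‖) * ∫ z, Real.exp (a * Real.sqrt T * ‖z‖) ∂gaussPlane)) := by
        gcongr
        exacts [ht.1, le_abs_self m, ht.2]
    _ = _ := by ring

lemma TameFun.contDiffOn_heatFlow (H : TameFun g) (m : ℝ) :
    ContDiffOn ℝ (⊤ : ℕ∞) (fun p : ℝ × Plane => heatFlow m p.1 g p.2) (Set.Ioi 0 ×ˢ Set.univ) := by
  have hexp : ContDiff ℝ (⊤ : ℕ∞) fun p : ℝ × Plane => Real.exp (m * p.1) := by fun_prop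
  have hinv : ContDiffOn ℝ (⊤ : ℕ∞) (fun p : ℝ × Plane => p.1⁻¹) (Set.Ioi 0 ×ˢ Set.univ) :=
    contDiff_fst.contDiffOn.inv fun p hp => ne_of_gt hp.1
  exact (hexp.contDiffOn.mul ((contDiffOn_const.mul hinv).mul H.contDiffOn_gaussConv)).congr
    fun p hp => heatFlow_eq_gaussConv m hp.1 g p.2

lemma TameFun.contDiff_heatFlow (H : TameFun g) (m : ℝ) {t : ℝ} (ht : 0 < t) :
    ContDiff ℝ (⊤ : ℕ∞) (heatFlow m t g) :=
  contDiffOn_univ.1 ((H.contDiffOn_heatFlow m).comp (contDiff_prodMk_right t).contDiffOn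
    fun x _ => ⟨ht, Set.mem_univ x⟩)

lemma TameFun.hasDerivAt_heatFlow (H : TameFun g) (m : ℝ) {t : ℝ} (ht : 0 < t) (x : Plane) :
    HasDerivAt (fun s => heatFlow m s g x)
      (1 / 2 * (Δ (heatFlow m t g)) x + m * heatFlow m t g x) t := by
  have hexp : HasDerivAt (fun s => Real.exp (m * s)) (Real.exp (m * t) * (m * 1)) t :=
    ((hasDerivAt_id t).const_mul m).exp
  have hproduct := hexp.fun_mul (((hasDerivAt_inv ht.ne').const_mul (1 / (2 * Real.pi))).fun_mul
    (H.hasDerivAt_gaussConv_time ht x))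
  have heatFlow_eq : heatFlow m t g
      = fun y => Real.exp (m * t) * (1 / (2 * Real.pi) * t⁻¹) * gaussConv g t y := by
    funext y
    rw [heatFlow_eq_gaussConv m ht, ← mul_assoc]
  refine (hproduct.congr_of_eventuallyEq ?_).congr_deriv ?_
  · filter_upwards [lt_mem_nhds ht] with s hs using heatFlow_eq_gaussConv m hs g x
  · rw [heatFlow_eq, laplacian_const_mul (contDiff_infty.1 (H.contDiff_gaussConv ht) 2).contDiffAt,
      H.laplacian_gaussConv ht, finrank_euclideanSpace_fin]
    field_simp
    push_cast
    ring

end HeatFlow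

/-! ### Mollified tempered distributions -/

section Translate

variable {E : Type*} [NormedAddCommGroup E]

lemma one_add_norm_pow_le_of_norm_sub_le {y z : E} {R : ℝ} (h : ‖z - y‖ ≤ R) (k : ℕ) :
    (1 + ‖y‖) ^ k ≤ (1 + R) ^ k * (1 + ‖z‖) ^ k := by
  rw [← mul_pow]
  refine pow_le_pow_left₀ (by positivity) ?_ _
  have norm_le : ‖y‖ ≤ ‖z‖ + ‖z - y‖ := by simpa using norm_sub_le z (z - y)
  nlinarith [norm_nonneg z, norm_nonneg (z - y)]

variable [NormedSpace ℝ E]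

lemma exists_seminorm_translate_sub_le (φ : 𝓢(E, ℝ)) (k n : ℕ) :
    ∃ A ≥ 0, ∀ x x₀, SchwartzMap.seminorm ℝ k n
      (SchwartzMap.compSubConstCLM ℝ x φ - SchwartzMap.compSubConstCLM ℝ x₀ φ)
      ≤ A * (1 + (‖x‖ + ‖x₀‖)) ^ k * ‖x - x₀‖ := by
  obtain ⟨A, hA, deriv_le⟩ :
      ∃ A ≥ 0, ∀ z, (1 + ‖z‖) ^ k * ‖iteratedFDeriv ℝ (n + 1) φ z‖ ≤ A :=
    ⟨_, by positivity, SchwartzMap.one_add_le_sup_seminorm_apply (𝕜 := ℝ) (m := (k, n + 1))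
      le_rfl le_rfl φ⟩
  refine ⟨A, hA, fun x x₀ => SchwartzMap.seminorm_le_bound ℝ k n _ (by positivity) fun y => ?_⟩
  have hdiff : Differentiable ℝ (iteratedFDeriv ℝ n φ) :=
    (φ.smooth (n + 1)).differentiable_iteratedFDeriv (by exact_mod_cast Nat.lt_succ_self n)
  have fderiv_le (z : E) (hz : z ∈ Metric.closedBall y (‖x‖ + ‖x₀‖)) :
      ‖fderiv ℝ (iteratedFDeriv ℝ n φ) z‖ ≤ A * (1 + (‖x‖ + ‖x₀‖)) ^ k / (1 + ‖y‖) ^ k := by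
    rw [norm_fderiv_iteratedFDeriv, le_div_iff₀' (by positivity)]
    calc (1 + ‖y‖) ^ k * ‖iteratedFDeriv ℝ (n + 1) φ z‖
        ≤ (1 + (‖x‖ + ‖x₀‖)) ^ k * (1 + ‖z‖) ^ k * ‖iteratedFDeriv ℝ (n + 1) φ z‖ := by
          gcongr
          exact one_add_norm_pow_le_of_norm_sub_le (mem_closedBall_iff_norm.1 hz) k
      _ ≤ (1 + (‖x‖ + ‖x₀‖)) ^ k * A := by
          rw [mul_assoc]
          gcongr
          exact deriv_le z
      _ = _ := mul_comm _ _
  have mean_value := (convex_closedBall y (‖x‖ + ‖x₀‖)).norm_image_sub_le_of_norm_fderiv_le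
    (𝕜 := ℝ) (fun z _ => hdiff z) fderiv_le (x := y - x₀) (y := y - x) (by simp) (by simp)
  rw [sub_sub_sub_cancel_left, norm_sub_rev x₀, div_mul_eq_mul_div,
    le_div_iff₀' (by positivity)] at mean_value
  have hsmooth (a : E) : ContDiffAt ℝ n (fun y => φ (y - a)) y :=
    ((φ.smooth n).comp (contDiff_id.sub contDiff_const)).contDiffAt
  change ‖y‖ ^ k * ‖iteratedFDeriv ℝ n ((fun y => φ (y - x)) - fun y => φ (y - x₀)) y‖ ≤ _
  rw [iteratedFDeriv_sub_apply (hsmooth x) (hsmooth x₀), iteratedFDeriv_comp_sub,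
    iteratedFDeriv_comp_sub]
  refine le_trans ?_ mean_value
  gcongr
  linarith

lemma exists_abs_le_sum_seminorm (T : 𝓢(E, ℝ) →L[ℝ] ℝ) :
    ∃ s : Finset (ℕ × ℕ), ∃ C ≥ (0 : ℝ), ∀ ψ,
      |T ψ| ≤ C * ∑ i ∈ s, SchwartzMap.seminorm ℝ i.1 i.2 ψ := by
  obtain ⟨s, C, -, abs_le⟩ := Seminorm.bound_of_continuous (schwartz_withSeminorms ℝ E ℝ)
    ((normSeminorm ℝ ℝ).comp T.toLinearMap) (continuous_norm.comp T.continuous)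
  refine ⟨s, C, C.2, fun ψ => (abs_le ψ).trans ?_⟩
  refine mul_le_mul_of_nonneg_left (Seminorm.finset_sup_apply_le
    (Finset.sum_nonneg fun i _ => apply_nonneg _ _) fun i hi => ?_) C.2
  exact Finset.single_le_sum (f := fun i : ℕ × ℕ => SchwartzMap.seminorm ℝ i.1 i.2 ψ)
    (fun i _ => apply_nonneg _ _) hi

lemma exists_abs_apply_translate_sub_le (T : 𝓢(E, ℝ) →L[ℝ] ℝ) (φ : 𝓢(E, ℝ)) :
    ∃ C ≥ 0, ∃ N : ℕ, ∀ x x₀,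
      |T (SchwartzMap.compSubConstCLM ℝ x φ) - T (SchwartzMap.compSubConstCLM ℝ x₀ φ)|
        ≤ C * (1 + (‖x‖ + ‖x₀‖)) ^ N * ‖x - x₀‖ := by
  obtain ⟨s, C, hC, apply_le⟩ := exists_abs_le_sum_seminorm T
  choose A hA seminorm_le using fun i : ℕ × ℕ => exists_seminorm_translate_sub_le φ i.1 i.2
  refine ⟨C * ∑ i ∈ s, A i, mul_nonneg hC (Finset.sum_nonneg fun i _ => hA i), s.sup Prod.fst,
    fun x x₀ => ?_⟩
  rw [← map_sub, mul_assoc, mul_assoc, Finset.sum_mul]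
  refine (apply_le _).trans (mul_le_mul_of_nonneg_left (Finset.sum_le_sum fun i hi => ?_) hC)
  refine (seminorm_le i x x₀).trans ?_
  rw [mul_assoc]
  gcongr
  · exact hA i
  · linarith [norm_nonneg x, norm_nonneg x₀]
  · exact Finset.le_sup (f := Prod.fst) hi

lemma tameFun_apply_translate (T : 𝓢(E, ℝ) →L[ℝ] ℝ) (φ : 𝓢(E, ℝ)) :
    TameFun fun x => T (SchwartzMap.compSubConstCLM ℝ x φ) := by
  obtain ⟨C, hC, N, sub_le⟩ := exists_abs_apply_translate_sub_le T φ
  refine ⟨continuous_iff_continuousAt.2 fun x₀ => ?_,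
    |T φ| + C * ((N + 1).factorial * Real.exp 1), by positivity, 1, one_pos, fun x => ?_⟩
  · have hbound : Continuous fun x : E => C * (1 + (‖x‖ + ‖x₀‖)) ^ N * ‖x - x₀‖ := by fun_prop
    exact tendsto_iff_norm_sub_tendsto_zero.2
      (squeeze_zero (fun x => norm_nonneg _) (fun x => sub_le x x₀)
        (by simpa using hbound.tendsto x₀))
  · have pow_le : (1 + ‖x‖) ^ (N + 1) ≤ (N + 1).factorial * Real.exp 1 * Real.exp ‖x‖ := by
      have := Real.pow_div_factorial_le_exp (1 + ‖x‖) (by positivity) (N + 1)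
      rwa [div_le_iff₀ (by positivity), Real.exp_add, mul_comm, ← mul_assoc] at this
    have sub_zero_le := sub_le x 0
    simp only [SchwartzMap.compSubConstCLM_zero, ContinuousLinearMap.id_apply, norm_zero, add_zero,
      sub_zero] at sub_zero_le
    calc |T (SchwartzMap.compSubConstCLM ℝ x φ)|
        ≤ |T φ| + C * (1 + ‖x‖) ^ N * ‖x‖ := by
          linarith [abs_sub_abs_le_abs_sub (T (SchwartzMap.compSubConstCLM ℝ x φ)) (T φ)]
      _ ≤ |T φ| * Real.exp ‖x‖ + C * (1 + ‖x‖) ^ (N + 1) := by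
          rw [pow_succ, ← mul_assoc]
          gcongr
          · exact le_mul_of_one_le_right (abs_nonneg _) (Real.one_le_exp (norm_nonneg x))
          · linarith
      _ ≤ |T φ| * Real.exp ‖x‖ + C * ((N + 1).factorial * Real.exp 1 * Real.exp ‖x‖) := by
          gcongr
      _ = _ := by
          rw [one_mul]
          ring

end Translate

lemma tameFun_mollify (ε : ℝ) (hε : 0 < ε) (T : 𝓢(Plane, ℝ) →L[ℝ] ℝ) :
    TameFun (mollify ε hε T) :=
  tameFun_apply_translate T _

/-! ### Gaussian averages of random fields -/

section JointMeasurability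

open TopologicalSpace

variable {Ω E : Type*} [MeasurableSpace Ω] {P : Measure Ω}
  [MetricSpace E] [SeparableSpace E] [Nonempty E]

lemma measurable_apply_of_measurable_denseSeq {X : Ω → E → ℝ} (hcont : ∀ ω, Continuous (X ω))
    (hmeas : ∀ n, Measurable fun ω => X ω (denseSeq E n)) (y : E) :
    Measurable fun ω => X ω y := by
  obtain ⟨u, hu, hlim⟩ := mem_closure_iff_seq_limit.1 (denseRange_denseSeq E y)
  choose k hk using hu
  refine measurable_of_tendsto_metrizable (f := fun j ω => X ω (u j)) (fun j => ?_)
    (tendsto_pi_nhds.2 fun ω => ((hcont ω).tendsto y).comp hlim)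
  simpa only [hk] using hmeas (k j)

-- The values on a dense sequence have a measurable version with values in the set of sequences
-- that come from a continuous function.
lemma exists_continuous_measurable_version {X : Ω → E → ℝ}
    (hmeas : ∀ y, AEMeasurable (fun ω => X ω y) P) (hcont : ∀ ω, Continuous (X ω)) :
    ∃ Y : Ω → E → ℝ, (∀ ω, Continuous (Y ω)) ∧ (∀ y, Measurable fun ω => Y ω y) ∧
      X =ᵐ[P] Y := by
  obtain ⟨g, hg, range_subset, ae_eq⟩ :=
    (aemeasurable_pi_lambda (fun ω n => X ω (denseSeq E n)) fun n => hmeas _)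
      |>.exists_ae_eq_range_subset
        (t := {u | ∃ h : E → ℝ, Continuous h ∧ ∀ n, h (denseSeq E n) = u n})
      (ae_of_all _ fun ω => ⟨X ω, hcont ω, fun n => rfl⟩) ⟨0, 0, continuous_zero, fun n => rfl⟩
  choose Y Y_cont Y_eq using fun ω => range_subset ⟨ω, rfl⟩
  refine ⟨Y, Y_cont, measurable_apply_of_measurable_denseSeq Y_cont fun n => ?_, ?_⟩
  · simp_rw [Y_eq]
    exact (measurable_pi_apply n).comp hg
  · filter_upwards [ae_eq] with ω hω
    refine (hcont ω).ext_on (denseRange_denseSeq E) (Y_cont ω) ?_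
    rintro _ ⟨n, rfl⟩
    rw [Y_eq, ← hω]

lemma aestronglyMeasurable_uncurry_of_continuous [MeasurableSpace E] [BorelSpace E]
    {X : Ω → E → ℝ} (hmeas : ∀ y, AEMeasurable (fun ω => X ω y) P)
    (hcont : ∀ ω, Continuous (X ω)) (ν : Measure E) :
    AEStronglyMeasurable (Function.uncurry X) (P.prod ν) := by
  obtain ⟨Y, Y_cont, Y_meas, ae_eq⟩ := exists_continuous_measurable_version hmeas hcont
  have measurable_uncurry : Measurable (Function.uncurry Y) :=
    (measurable_uncurry_of_continuous_of_measurable (u := fun y ω => Y ω y) Y_cont Y_meas).comp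
      measurable_swap
  refine measurable_uncurry.aestronglyMeasurable.congr ?_
  filter_upwards [Measure.quasiMeasurePreserving_fst.ae ae_eq] with q hq
  simp only [Function.uncurry, hq]

end JointMeasurability

section Moments

variable {Ω : Type*} [MeasurableSpace Ω] {P : Measure Ω} {v : NNReal}

/-- The moment `E (1 + |Z|)^p` of a centred Gaussian variable `Z` with variance `v`. -/
def gaussMoment (v : NNReal) (p : ℕ) : ℝ := ∫ z, (1 + |z|) ^ p ∂gaussianReal 0 v

lemma integrable_one_add_abs_pow_gaussianReal (v : NNReal) (p : ℕ) :
    Integrable (fun z => (1 + |z|) ^ p) (gaussianReal 0 v) := by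
  have habs : MemLp (fun z : ℝ => |z|) p (gaussianReal 0 v) :=
    (memLp_id_gaussianReal' (μ := 0) (v := v) p (by simp)).norm
  have hmem : MemLp (fun z : ℝ => 1 + |z|) p (gaussianReal 0 v) := (memLp_const (1 : ℝ)).add habs
  refine hmem.integrable_norm_pow'.congr (ae_of_all _ fun z => ?_)
  simp only [Real.norm_of_nonneg (by positivity : 0 ≤ 1 + |z|)]

lemma integrable_one_add_abs_pow {X : Ω → ℝ} (hX : HasLaw X (gaussianReal 0 v) P) (p : ℕ) :
    Integrable (fun ω => (1 + |X ω|) ^ p) P := by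
  have hint := integrable_one_add_abs_pow_gaussianReal v p
  rw [← hX.map_eq] at hint
  exact hint.comp_aemeasurable hX.aemeasurable

lemma integral_one_add_abs_pow {X : Ω → ℝ} (hX : HasLaw X (gaussianReal 0 v) P) (p : ℕ) :
    ∫ ω, (1 + |X ω|) ^ p ∂P = gaussMoment v p :=
  hX.integral_comp (f := fun z => (1 + |z|) ^ p)
    (integrable_one_add_abs_pow_gaussianReal v p).aestronglyMeasurable

lemma integrable_one_add_abs_pow_prod {E : Type*} [MeasurableSpace E] {ν : Measure E}
    [IsFiniteMeasure ν] [SFinite P] {X : Ω → E → ℝ}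
    (hX : AEStronglyMeasurable (Function.uncurry X) (P.prod ν))
    (hlaw : ∀ z, HasLaw (fun ω => X ω z) (gaussianReal 0 v) P) (p : ℕ) :
    Integrable (Function.uncurry fun ω z => (1 + |X ω z|) ^ p) (P.prod ν) := by
  have hmeas : AEStronglyMeasurable (Function.uncurry fun ω z => (1 + |X ω z|) ^ p) (P.prod ν) :=
    (by fun_prop : Continuous fun u : ℝ => (1 + |u|) ^ p).comp_aestronglyMeasurable hX
  have integral_norm (z : E) : ∫ ω, ‖(1 + |X ω z|) ^ p‖ ∂P = gaussMoment v p := by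
    rw [← integral_one_add_abs_pow (hlaw z)]
    exact integral_congr_ae (ae_of_all _ fun ω => Real.norm_of_nonneg (by positivity))
  rw [integrable_prod_iff' hmeas]
  refine ⟨ae_of_all _ fun z => integrable_one_add_abs_pow (hlaw z) p, ?_⟩
  simp only [Function.uncurry_apply_pair, integral_norm]
  exact integrable_const _

end Moments

section Average

/-- The average of `g` under the Gaussian distribution with mean `x` and covariance `t · id`. -/
def gaussAverage (t : ℝ) (g : Plane → ℝ) (x : Plane) : ℝ :=
  ∫ z, g (x - Real.sqrt t • z) ∂gaussPlane

lemma heatFlow_eq_exp_mul_gaussAverage (m : ℝ) {t : ℝ} (ht : 0 ≤ t) (g : Plane → ℝ) (x : Plane) :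
    heatFlow m t g x = Real.exp (m * t) * gaussAverage t g x :=
  heatFlow_eq_integral_gaussPlane m ht g x

lemma gaussAverage_abs_nonneg (t : ℝ) (g : Plane → ℝ) (x : Plane) : 0 ≤ gaussAverage t |g| x :=
  integral_nonneg fun _ => abs_nonneg _

lemma abs_gaussAverage_le (t : ℝ) (g : Plane → ℝ) (x : Plane) :
    |gaussAverage t g x| ≤ gaussAverage t |g| x :=
  norm_integral_le_integral_norm (μ := gaussPlane) fun z => g (x - Real.sqrt t • z)

lemma TameFun.one_add_gaussAverage_abs_pow_le {g : Plane → ℝ} (H : TameFun g) (t : ℝ) (x : Plane)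
    {p : ℕ} (hint : Integrable (fun z => (1 + |g (x - Real.sqrt t • z)|) ^ p) gaussPlane) :
    (1 + gaussAverage t |g| x) ^ p ≤ ∫ z, (1 + |g (x - Real.sqrt t • z)|) ^ p ∂gaussPlane := by
  have habs : Integrable (fun z => |g (x - Real.sqrt t • z)|) gaussPlane :=
    H.abs.integrable_gaussPlane x _
  have one_add_eq :
      1 + gaussAverage t |g| x = ∫ z, (1 + |g (x - Real.sqrt t • z)|) ∂gaussPlane := by
    rw [integral_add (integrable_const _) habs, integral_const, probReal_univ, one_smul]
    rfl
  rw [one_add_eq]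
  exact (convexOn_pow p).map_integral_le (continuous_pow p).continuousOn isClosed_Ici
    (ae_of_all _ fun z => Set.mem_Ici.2 (by positivity)) ((integrable_const _).add habs) hint

variable {Ω : Type*} [MeasurableSpace Ω]

/-- A random field of continuous functions of exponential growth all of whose values have the same
centred Gaussian law. -/
structure IsTameField (P : Measure Ω) (v : NNReal) (X : Ω → Plane → ℝ) : Prop where
  tame : ∀ ω, TameFun (X ω)
  law : ∀ y, HasLaw (fun ω => X ω y) (gaussianReal 0 v) P

namespace IsTameField

variable {P : Measure Ω} {v : NNReal} {X : Ω → Plane → ℝ}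

lemma aestronglyMeasurable_translate (hX : IsTameField P v X) (t : ℝ) (x : Plane) :
    AEStronglyMeasurable (Function.uncurry fun ω z => X ω (x - Real.sqrt t • z))
      (P.prod gaussPlane) :=
  aestronglyMeasurable_uncurry_of_continuous (fun _ => (hX.law _).aemeasurable)
    (fun ω => (hX.tame ω).continuous.comp (by fun_prop)) _

lemma aestronglyMeasurable_gaussAverage (hX : IsTameField P v X) (t : ℝ) (x : Plane) :
    AEStronglyMeasurable (fun ω => gaussAverage t (X ω) x) P :=
  (hX.aestronglyMeasurable_translate t x).integral_prod_right'

lemma aestronglyMeasurable_gaussAverage_abs (hX : IsTameField P v X) (t : ℝ) (x : Plane) :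
    AEStronglyMeasurable (fun ω => gaussAverage t |X ω| x) P :=
  (continuous_abs.comp_aestronglyMeasurable
    (hX.aestronglyMeasurable_translate t x)).integral_prod_right'

variable [SFinite P]

lemma integrable_translate (hX : IsTameField P v X) (t : ℝ) (x : Plane) (p : ℕ) :
    Integrable (Function.uncurry fun ω z => (1 + |X ω (x - Real.sqrt t • z)|) ^ p)
      (P.prod gaussPlane) :=
  integrable_one_add_abs_pow_prod (hX.aestronglyMeasurable_translate t x) (fun _ => hX.law _) p

lemma ae_gaussAverage_pow_le (hX : IsTameField P v X) (t : ℝ) (x : Plane) (p : ℕ) :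
    ∀ᵐ ω ∂P, (1 + gaussAverage t |X ω| x) ^ p
      ≤ ∫ z, (1 + |X ω (x - Real.sqrt t • z)|) ^ p ∂gaussPlane := by
  filter_upwards [(hX.integrable_translate t x p).prod_right_ae] with ω hω
  exact (hX.tame ω).one_add_gaussAverage_abs_pow_le t x hω

lemma integrable_gaussAverage_pow (hX : IsTameField P v X) (t : ℝ) (x : Plane) (p : ℕ) :
    Integrable (fun ω => (1 + gaussAverage t |X ω| x) ^ p) P := by
  refine (hX.integrable_translate t x p).integral_prod_left.mono' ((aestronglyMeasurable_const.add
    (hX.aestronglyMeasurable_gaussAverage_abs t x)).pow p) ?_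
  filter_upwards [hX.ae_gaussAverage_pow_le t x p] with ω hω
  have := gaussAverage_abs_nonneg t (X ω) x
  rwa [Real.norm_of_nonneg (by positivity)]

lemma integral_gaussAverage_pow_le (hX : IsTameField P v X) (t : ℝ) (x : Plane) (p : ℕ) :
    ∫ ω, (1 + gaussAverage t |X ω| x) ^ p ∂P ≤ gaussMoment v p :=
  calc ∫ ω, (1 + gaussAverage t |X ω| x) ^ p ∂P
      ≤ ∫ ω, (∫ z, (1 + |X ω (x - Real.sqrt t • z)|) ^ p ∂gaussPlane) ∂P :=
        integral_mono_ae (hX.integrable_gaussAverage_pow t x p)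
          (hX.integrable_translate t x p).integral_prod_left (hX.ae_gaussAverage_pow_le t x p)
    _ = ∫ z, (∫ ω, (1 + |X ω (x - Real.sqrt t • z)|) ^ p ∂P) ∂gaussPlane :=
        integral_integral_swap (hX.integrable_translate t x p)
    _ = gaussMoment v p := by
        simp only [integral_one_add_abs_pow (hX.law _), integral_const, probReal_univ, one_smul]

lemma memLp_gaussAverage (hX : IsTameField P v X) (t : ℝ) (x : Plane) :
    MemLp (fun ω => gaussAverage t (X ω) x) 2 P := by
  have hmeas := hX.aestronglyMeasurable_gaussAverage t x
  rw [memLp_two_iff_integrable_sq hmeas]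
  refine (hX.integrable_gaussAverage_pow t x 2).mono' (hmeas.pow 2) (ae_of_all _ fun ω => ?_)
  rw [Real.norm_of_nonneg (sq_nonneg _), ← sq_abs]
  have := abs_gaussAverage_le t (X ω) x
  exact pow_le_pow_left₀ (abs_nonneg _) (by linarith) 2

lemma integral_gaussAverage_mul (hX : IsTameField P v X) (t : ℝ) (x : Plane) {Y : Ω → ℝ}
    (hY : MemLp Y 2 P) : ∫ ω, gaussAverage t (X ω) x * Y ω ∂P
      = gaussAverage t (fun y => ∫ ω, X ω y * Y ω ∂P) x := by
  have hint : Integrable (Function.uncurry fun ω z => X ω (x - Real.sqrt t • z) * Y ω)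
      (P.prod gaussPlane) := by
    refine ((hX.integrable_translate t x 2).add (hY.integrable_sq.comp_fst gaussPlane)).mono'
      ((hX.aestronglyMeasurable_translate t x).mul hY.aestronglyMeasurable.comp_fst)
      (ae_of_all _ fun ⟨ω, z⟩ => ?_)
    simp only [Pi.add_apply, Function.uncurry_apply_pair, norm_mul, Real.norm_eq_abs]
    rw [← sq_abs (Y ω)]
    nlinarith [sq_nonneg (|X ω (x - Real.sqrt t • z)| - |Y ω|), abs_nonneg (Y ω),
      abs_nonneg (X ω (x - Real.sqrt t • z))]
  simp only [gaussAverage, ← integral_mul_const]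
  exact integral_integral_swap hint

end IsTameField

end Average

/-! ### White noise -/

section SquareIntegrable

variable {α : Type*} [MeasurableSpace α] {μ : Measure α} {X Y : α → ℝ}

lemma integral_add_sq (hX : MemLp X 2 μ) (hY : MemLp Y 2 μ) :
    ∫ a, (X a + Y a) ^ 2 ∂μ = ∫ a, X a ^ 2 ∂μ + 2 * ∫ a, X a * Y a ∂μ + ∫ a, Y a ^ 2 ∂μ := by
  have hXY : Integrable (fun a => 2 * (X a * Y a)) μ := (hX.integrable_mul hY).const_mul 2
  rw [← integral_const_mul, ← integral_add hX.integrable_sq hXY,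
    ← integral_add (hX.integrable_sq.fun_add hXY) hY.integrable_sq]
  simp only [add_sq, mul_assoc]

lemma ae_eq_of_integral_mul_eq (hX : MemLp X 2 μ) (hY : MemLp Y 2 μ) {c : ℝ}
    (hXX : ∫ a, X a * X a ∂μ = c) (hXY : ∫ a, X a * Y a ∂μ = c)
    (hYY : ∫ a, Y a * Y a ∂μ = c) : X =ᵐ[μ] Y := by
  have integral_sub_sq : ∫ a, (X a - Y a) ^ 2 ∂μ = 0 := by
    simp only [sub_eq_add_neg]
    rw [integral_add_sq (Y := fun a => -Y a) hX hY.neg]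
    simp only [mul_neg, integral_neg, neg_mul, neg_neg, sq, hXX, hXY, hYY]
    ring
  filter_upwards [(integral_eq_zero_iff_of_nonneg (fun a => sq_nonneg (X a - Y a))
    (hX.sub hY).integrable_sq).1 integral_sub_sq] with a ha
  exact sub_eq_zero.1 (pow_eq_zero_iff two_ne_zero |>.1 ha)

end SquareIntegrable

section HeatBump

/-- The heat kernel `G_s(· - a)` centred at `a`, as a Schwartz function. -/
def heatBump (s : ℝ) (hs : 0 < s) (a : Plane) : 𝓢(Plane, ℝ) :=
  SchwartzMap.compSubConstCLM ℝ a (heatKernelSchwartz s hs)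

lemma heatBump_apply (s : ℝ) (hs : 0 < s) (a y : Plane) :
    heatBump s hs a y = heatKernel s (y - a) := rfl

lemma integral_heatBump_sq (s : ℝ) (hs : 0 < s) (a : Plane) :
    ∫ y, heatBump s hs a y ^ 2 = 1 / (4 * Real.pi * s) := by
  simp_rw [sq, heatBump_apply]
  rw [integral_heatKernel_mul_heatKernel hs hs, sub_self, heatKernel, norm_zero]
  norm_num
  ring

lemma gaussAverage_heatKernel {s t : ℝ} (hs : 0 < s) (ht : 0 ≤ t) (a x : Plane) :
    gaussAverage t (fun y => heatKernel s (y - a)) x = heatKernel (t + s) (x - a) := by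
  have heatFlow_eq := heatFlow_eq_exp_mul_gaussAverage 0 ht (fun y => heatKernel s (y - a)) x
  rw [zero_mul, Real.exp_zero, one_mul] at heatFlow_eq
  rw [← heatFlow_eq]
  rcases ht.eq_or_lt with rfl | ht
  · rw [heatFlow, if_pos rfl, zero_add]
  · simp only [heatFlow, if_neg ht.ne', massHeatKernel, zero_mul, Real.exp_zero, one_mul,
      heatKernel_sub_comm t x]
    exact integral_heatKernel_mul_heatKernel ht hs x a

end HeatBump

/-- The standard deviation of `G^m_t * η_ε (x)`. -/
def flowStd (m ε t : ℝ) : ℝ := Real.exp (m * t) * Real.sqrt (1 / (4 * Real.pi * (t + ε ^ 2)))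

/-- The variance of `η_ε (x)`. -/
def noiseVar (ε : ℝ) : NNReal := Real.toNNReal (1 / (4 * Real.pi * ε ^ 2))

namespace IsWhiteNoise

variable {Ω : Type*} [MeasurableSpace Ω] {P : Measure Ω} {η : Ω → 𝓢(Plane, ℝ) →L[ℝ] ℝ}

lemma memLp (hη : IsWhiteNoise P η) (φ : 𝓢(Plane, ℝ)) : MemLp (fun ω => η ω φ) 2 P := by
  have hid := memLp_id_gaussianReal' (μ := 0) (v := Real.toNNReal (∫ y, φ y ^ 2)) 2 (by simp)
  rw [← (hη φ).map_eq] at hid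
  exact hid.comp_of_map (hη φ).aemeasurable

lemma integral_sq (hη : IsWhiteNoise P η) (φ : 𝓢(Plane, ℝ)) :
    ∫ ω, η ω φ ^ 2 ∂P = ∫ y, φ y ^ 2 := by
  have mean_zero : ∫ ω, η ω φ ∂P = 0 := by rw [(hη φ).integral_eq, integral_id_gaussianReal]
  have hvar := (hη φ).variance_eq
  rwa [variance_id_gaussianReal, variance_of_integral_eq_zero (hη φ).aemeasurable mean_zero,
    Real.coe_toNNReal _ (integral_nonneg fun _ => sq_nonneg _)] at hvar

lemma integral_mul (hη : IsWhiteNoise P η) (φ ψ : 𝓢(Plane, ℝ)) :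
    ∫ ω, η ω φ * η ω ψ ∂P = ∫ y, φ y * ψ y := by
  have isometry_add := hη.integral_sq (φ + ψ)
  simp only [map_add, add_apply] at isometry_add
  rw [integral_add_sq (hη.memLp φ) (hη.memLp ψ),
    integral_add_sq (φ.memLp 2 volume) (ψ.memLp 2 volume), hη.integral_sq φ, hη.integral_sq ψ]
    at isometry_add
  linarith

lemma integral_heatBump_mul (hη : IsWhiteNoise P η) {s r : ℝ} (hs : 0 < s) (hr : 0 < r)
    (a b : Plane) :
    ∫ ω, η ω (heatBump s hs a) * η ω (heatBump r hr b) ∂P = heatKernel (s + r) (a - b) := by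
  rw [hη.integral_mul]
  exact integral_heatKernel_mul_heatKernel hs hr a b

lemma isTameField (hη : IsWhiteNoise P η) {ε : ℝ} (hε : 0 < ε) :
    IsTameField P (noiseVar ε) fun ω => mollify ε hε (η ω) := by
  refine ⟨fun ω => tameFun_mollify ε hε (η ω), fun y => ?_⟩
  have hlaw := hη (heatBump (ε ^ 2) (pow_pos hε 2) y)
  rwa [integral_heatBump_sq] at hlaw

variable [IsProbabilityMeasure P]

lemma integral_gaussAverage_mul_heatBump (hη : IsWhiteNoise P η) {ε : ℝ} (hε : 0 < ε) {r t : ℝ}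
    (hr : 0 < r) (ht : 0 ≤ t) (x b : Plane) :
    ∫ ω, gaussAverage t (mollify ε hε (η ω)) x * η ω (heatBump r hr b) ∂P
      = heatKernel (t + (ε ^ 2 + r)) (x - b) := by
  rw [(hη.isTameField hε).integral_gaussAverage_mul t x (hη.memLp _),
    ← gaussAverage_heatKernel (by positivity) ht]
  congr 1 with y
  exact hη.integral_heatBump_mul (pow_pos hε 2) hr y b

lemma integral_gaussAverage_mul_self (hη : IsWhiteNoise P η) {ε : ℝ} (hε : 0 < ε) {t : ℝ}
    (ht : 0 ≤ t) (x : Plane) :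
    ∫ ω, gaussAverage t (mollify ε hε (η ω)) x * gaussAverage t (mollify ε hε (η ω)) x ∂P
      = heatKernel (2 * (t + ε ^ 2)) 0 := by
  have hX := hη.isTameField hε
  have covariance (y : Plane) :
      ∫ ω, mollify ε hε (η ω) y * gaussAverage t (mollify ε hε (η ω)) x ∂P
        = heatKernel (t + (ε ^ 2 + ε ^ 2)) (y - x) := by
    simp only [mul_comm (mollify ε hε _ y)]
    rw [heatKernel_sub_comm]
    exact hη.integral_gaussAverage_mul_heatBump hε (pow_pos hε 2) ht x y
  rw [hX.integral_gaussAverage_mul t x (hX.memLp_gaussAverage t x)]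
  simp only [covariance]
  rw [gaussAverage_heatKernel (by positivity) ht, sub_self]
  ring_nf

lemma gaussAverage_ae_eq (hη : IsWhiteNoise P η) {ε : ℝ} (hε : 0 < ε) {t : ℝ} (ht : 0 ≤ t)
    (x : Plane) : (fun ω => gaussAverage t (mollify ε hε (η ω)) x) =ᵐ[P]
      fun ω => η ω (heatBump (t + ε ^ 2) (by positivity) x) := by
  refine ae_eq_of_integral_mul_eq ((hη.isTameField hε).memLp_gaussAverage t x) (hη.memLp _)
    (hη.integral_gaussAverage_mul_self hε ht x) ?_ ?_
  · rw [hη.integral_gaussAverage_mul_heatBump hε (by positivity) ht, sub_self]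
    ring_nf
  · rw [hη.integral_heatBump_mul, sub_self, two_mul]

lemma hasLaw_heatFlow (hη : IsWhiteNoise P η) {ε : ℝ} (hε : 0 < ε) (m : ℝ) {t : ℝ}
    (ht : 0 ≤ t) (x : Plane) :
    HasLaw (fun ω => heatFlow m t (mollify ε hε (η ω)) x)
      ((gaussianReal 0 1).map fun z => flowStd m ε t * z) P := by
  have law_noise := hη (heatBump (t + ε ^ 2) (by positivity) x)
  rw [integral_heatBump_sq] at law_noise
  have law_flow := gaussianReal_const_mul (law_noise.congr (hη.gaussAverage_ae_eq hε ht x))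
    (Real.exp (m * t))
  simp_rw [heatFlow_eq_exp_mul_gaussAverage m ht]
  convert law_flow using 1
  rw [gaussianReal_map_const_mul, mul_zero, mul_zero]
  congr 1
  ext
  rw [mul_one, NNReal.coe_mk, NNReal.coe_mul, NNReal.coe_mk, Real.coe_toNNReal _ (by positivity),
    flowStd, mul_pow, Real.sq_sqrt (by positivity)]

end IsWhiteNoise

/-! ### Nonlinearities -/

/-- `D` and its difference quotients grow at most polynomially, with degree `n` and constant `C`. -/
structure PolyLip (C : ℝ) (n : ℕ) (D : ℝ → ℝ) : Prop where
  abs_apply_le : ∀ u, |D u| ≤ C * (1 + |u|) ^ n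
  abs_sub_apply_le : ∀ u u', |D u - D u'| ≤ C * (1 + |u| + |u'|) ^ n * |u - u'|

lemma one_le_one_add_abs (u : ℝ) : 1 ≤ 1 + |u| := le_add_of_nonneg_right (abs_nonneg u)

lemma one_le_one_add_abs_add_abs (u u' : ℝ) : 1 ≤ 1 + |u| + |u'| :=
  (one_le_one_add_abs u).trans (le_add_of_nonneg_right (abs_nonneg u'))

lemma PolyLip.mono {C C' : ℝ} {n n' : ℕ} {D : ℝ → ℝ} (h : PolyLip C n D) (hC : 0 ≤ C)
    (hC' : C ≤ C') (hn : n ≤ n') : PolyLip C' n' D where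
  abs_apply_le u := by
    have hu := one_le_one_add_abs u
    have hC'₀ := hC.trans hC'
    exact (h.abs_apply_le u).trans (by gcongr)
  abs_sub_apply_le u u' := by
    have hu := one_le_one_add_abs_add_abs u u'
    have hC'₀ := hC.trans hC'
    exact (h.abs_sub_apply_le u u').trans (by gcongr)

lemma PolyLip.add {C₁ C₂ : ℝ} {n : ℕ} {D₁ D₂ : ℝ → ℝ} (h₁ : PolyLip C₁ n D₁)
    (h₂ : PolyLip C₂ n D₂) : PolyLip (C₁ + C₂) n fun u => D₁ u + D₂ u where
  abs_apply_le u := by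
    refine (abs_add_le _ _).trans ((add_le_add (h₁.abs_apply_le u) (h₂.abs_apply_le u)).trans_eq ?_)
    ring
  abs_sub_apply_le u u' := by
    rw [add_sub_add_comm]
    refine (abs_add_le _ _).trans
      ((add_le_add (h₁.abs_sub_apply_le u u') (h₂.abs_sub_apply_le u u')).trans_eq ?_)
    ring

lemma polyLip_of_abs_sub_le {B C : ℝ} {n : ℕ} {D : ℝ → ℝ} {a : ℝ} (hC : 0 ≤ C) (ha : |a| ≤ 1)
    (hDa : |D a| ≤ B) (hD : ∀ u u', |D u - D u'| ≤ C * (1 + |u| + |u'|) ^ n * |u - u'|) :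
    PolyLip (B + 2 ^ n * C) (n + 1) D where
  abs_apply_le u := by
    have hB : 0 ≤ B := (abs_nonneg _).trans hDa
    have hu := one_le_one_add_abs u
    calc |D u| ≤ |D a| + |D u - D a| := by simpa using abs_add_le (D a) (D u - D a)
      _ ≤ B + C * (1 + |u| + |a|) ^ n * |u - a| := add_le_add hDa (hD u a)
      _ ≤ B * (1 + |u|) ^ (n + 1) + C * (2 * (1 + |u|)) ^ n * (1 + |u|) := by
        refine add_le_add (le_mul_of_one_le_right hB (one_le_pow₀ hu)) ?_
        gcongr
        · linarith
        · exact (abs_sub u a).trans (by linarith)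
      _ = _ := by rw [mul_pow, pow_succ]; ring
  abs_sub_apply_le u u' := by
    refine (hD u u').trans ?_
    have hu := one_le_one_add_abs_add_abs u u'
    have hB : 0 ≤ B := (abs_nonneg _).trans hDa
    have hCB : C ≤ B + 2 ^ n * C := by
      have : C ≤ 2 ^ n * C := le_mul_of_one_le_left hC (one_le_pow₀ one_le_two)
      linarith
    gcongr
    exact n.le_succ

lemma PolyLip.comp_mul_left {C A a c : ℝ} {n : ℕ} {D : ℝ → ℝ} (h : PolyLip C n D) (hC : 0 ≤ C)
    (ha : |a| ≤ A) : PolyLip (|c| * C * (1 + A) ^ (n + 1)) n fun u => c * D (a * u) where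
  abs_apply_le u := by
    have hA : 0 ≤ A := (abs_nonneg a).trans ha
    have hau : 1 + |a * u| ≤ (1 + A) * (1 + |u|) := by
      rw [abs_mul]
      nlinarith [abs_nonneg u]
    calc |c * D (a * u)| ≤ |c| * (C * ((1 + A) * (1 + |u|)) ^ n) := by
          rw [abs_mul]
          gcongr
          exact (h.abs_apply_le _).trans (by gcongr)
      _ = |c| * C * (1 + A) ^ n * (1 + |u|) ^ n := by rw [mul_pow]; ring
      _ ≤ _ := by
        gcongr
        · linarith
        · exact n.le_succ
  abs_sub_apply_le u u' := by
    have hA : 0 ≤ A := (abs_nonneg a).trans ha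
    have hau : 1 + |a * u| + |a * u'| ≤ (1 + A) * (1 + |u| + |u'|) := by
      rw [abs_mul, abs_mul]
      nlinarith [abs_nonneg u, abs_nonneg u']
    have hsub : |a * u - a * u'| ≤ (1 + A) * |u - u'| := by
      rw [← mul_sub, abs_mul]
      gcongr
      linarith
    calc |c * D (a * u) - c * D (a * u')|
        ≤ |c| * (C * ((1 + A) * (1 + |u| + |u'|)) ^ n * ((1 + A) * |u - u'|)) := by
          rw [← mul_sub, abs_mul]
          gcongr
          exact (h.abs_sub_apply_le _ _).trans (by gcongr)
      _ = _ := by rw [mul_pow, pow_succ]; ring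

lemma PolyLip.abs_deriv_sub_slope_le {C : ℝ} {n : ℕ} {g : ℝ → ℝ} (h : PolyLip C n (deriv g))
    (hC : 0 ≤ C) (hg : Differentiable ℝ g) {r u δ : ℝ} (hu : |u| ≤ r) (hδ : 0 < δ) (hδ₁ : δ ≤ 1) :
    |deriv g u - (g (u + δ) - g u) / δ| ≤ C * (1 + r + (r + 1)) ^ n * δ := by
  obtain ⟨ξ, ⟨hξ₁, hξ₂⟩, hξ⟩ := exists_deriv_eq_slope g (lt_add_of_pos_right u hδ)
    hg.continuous.continuousOn hg.differentiableOn
  rw [add_sub_cancel_left] at hξ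
  have hdist : |u - ξ| ≤ δ := by rw [abs_le]; constructor <;> linarith
  have habs : |ξ| ≤ r + 1 := by
    rw [abs_le] at hu ⊢
    constructor <;> linarith
  have hr : 0 ≤ r := (abs_nonneg u).trans hu
  rw [← hξ]
  exact (h.abs_sub_apply_le u ξ).trans (by gcongr)

lemma continuousOn_deriv_of_polyLip {F : ℝ → ℝ → ℝ} {s : Set ℝ}
    (hF : ContinuousOn (fun p : ℝ × ℝ => F p.1 p.2) (s ×ˢ Set.univ))
    (hd : ∀ t ∈ s, Differentiable ℝ (F t)) {C : ℝ} (hC : 0 ≤ C) {n : ℕ}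
    (hD : ∀ t ∈ s, PolyLip C n (deriv (F t))) :
    ContinuousOn (fun p : ℝ × ℝ => deriv (F p.1) p.2) (s ×ˢ Set.univ) := by
  have hslope (δ : ℝ) : ContinuousOn (fun p : ℝ × ℝ => (F p.1 (p.2 + δ) - F p.1 p.2) / δ)
      (s ×ˢ Set.univ) :=
    ((hF.comp (f := fun p : ℝ × ℝ => (p.1, p.2 + δ)) (by fun_prop)
      fun p hp => ⟨hp.1, trivial⟩).sub hF).div_const δ
  have hlim : TendstoLocallyUniformlyOn (fun δ (p : ℝ × ℝ) => (F p.1 (p.2 + δ) - F p.1 p.2) / δ)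
      (fun p => deriv (F p.1) p.2) (nhdsWithin 0 (Set.Ioi 0)) (s ×ˢ Set.univ) := by
    rw [Metric.tendstoLocallyUniformlyOn_iff]
    rintro e he ⟨t₀, u₀⟩ -
    set K := C * (1 + (|u₀| + 1) + (|u₀| + 1 + 1)) ^ n
    have hnear : ∀ᶠ p : ℝ × ℝ in nhdsWithin (t₀, u₀) (s ×ˢ Set.univ), |p.2| < |u₀| + 1 :=
      (continuous_snd.abs.tendsto (t₀, u₀)).mono_left nhdsWithin_le_nhds
        |>.eventually_lt_const (lt_add_one |u₀|)
    have hsmall : ∀ᶠ δ in nhdsWithin (0 : ℝ) (Set.Ioi 0), K * δ < e := by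
      have : Filter.Tendsto (fun δ => K * δ) (nhdsWithin (0 : ℝ) (Set.Ioi 0)) (nhds (K * 0)) :=
        ((continuous_const_mul K).tendsto 0).mono_left nhdsWithin_le_nhds
      exact this.eventually_lt_const (by simpa using he)
    refine ⟨_, Filter.inter_mem hnear self_mem_nhdsWithin, ?_⟩
    filter_upwards [hsmall, Ioc_mem_nhdsGT zero_lt_one] with δ hδe hδ p hp
    exact ((hD p.1 hp.2.1).abs_deriv_sub_slope_le hC (hd p.1 hp.2.1) hp.1.le hδ.1 hδ.2).trans_lt hδe
  exact hlim.continuousOn (Filter.Frequently.of_forall hslope)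

lemma MemS₁.abs_deriv_le {L₁ L₂ : ℝ} {F : ℝ → ℝ → ℝ} (hF : MemS₁ L₁ L₂ F) {t : ℝ} (ht : 0 < t)
    (u : ℝ) : |deriv (F t) u| ≤ L₁ := by
  simpa only [Real.coe_toNNReal _ hF.L₁_nonneg, Real.norm_eq_abs] using
    norm_deriv_le_of_lipschitz (x₀ := u) (hF.lipschitz t ht)

lemma MemS₁.polyLip {L₁ L₂ : ℝ} {F : ℝ → ℝ → ℝ} (hF : MemS₁ L₁ L₂ F) {t : ℝ} (ht : 0 < t) :
    PolyLip (L₁ + L₂) 0 (deriv (F t)) where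
  abs_apply_le u := by
    rw [pow_zero, mul_one]
    exact (hF.abs_deriv_le ht u).trans (le_add_of_nonneg_right hF.L₂_nonneg)
  abs_sub_apply_le u u' := by
    have hlip := (hF.lipschitz_deriv t ht).dist_le_mul u u'
    rw [Real.coe_toNNReal _ hF.L₂_nonneg, Real.dist_eq, Real.dist_eq] at hlip
    rw [pow_zero, mul_one]
    exact hlip.trans (by gcongr; exact le_add_of_nonneg_left hF.L₁_nonneg)

lemma even_deriv_of_odd {h : ℝ → ℝ} (hodd : Function.Odd h) : Function.Even (deriv h) := by
  intro u
  have hneg : (fun x => h (-x)) = fun x => -h x := funext hodd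
  have := congrArg (fun k => deriv k u) hneg
  simp only [deriv_comp_neg, deriv.fun_neg] at this
  linarith

lemma rpow_le_pow_ceil {γ M q : ℝ} (hγ : 0 ≤ γ) (hM : 0 ≤ M) (hMq : M ≤ q) (hq : 1 ≤ q) :
    M ^ γ ≤ q ^ ⌈γ⌉₊ :=
  calc M ^ γ ≤ q ^ γ := Real.rpow_le_rpow hM hMq hγ
    _ ≤ q ^ (⌈γ⌉₊ : ℝ) := Real.rpow_le_rpow_of_exponent_le hq (Nat.le_ceil γ)
    _ = _ := Real.rpow_natCast _ _

lemma MemS₂.abs_deriv_sub_le {γ₁ γ₂ l₁ l₂ : ℝ} {F : ℝ → ℝ → ℝ} (hF : MemS₂ γ₁ γ₂ l₁ l₂ F) {t : ℝ}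
    (ht : 0 < t) (u u' : ℝ) :
    |deriv (F t) u - deriv (F t) u'| ≤ 2 * l₂ * (1 + |u| + |u'|) ^ ⌈γ₂⌉₊ * |u - u'| := by
  have habs (u : ℝ) : deriv (F t) |u| = deriv (F t) u := by
    rcases abs_choice u with hu | hu <;> rw [hu]
    exact even_deriv_of_odd (hF.odd t ht) u
  set M := max |u| |u'|
  have hM : 0 ≤ M := (abs_nonneg u).trans (le_max_left _ _)
  have hl₂ := hF.l₂_nonneg
  have hlip := (hF.lipschitzOn_deriv t ht M hM).dist_le_mul |u| ⟨abs_nonneg _, le_max_left _ _⟩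
    |u'| ⟨abs_nonneg _, le_max_right _ _⟩
  rw [Real.coe_toNNReal _ (by positivity), Real.dist_eq, Real.dist_eq, habs, habs] at hlip
  have hpow : M ^ γ₂ ≤ (1 + |u| + |u'|) ^ ⌈γ₂⌉₊ :=
    rpow_le_pow_ceil (zero_le_one.trans hF.one_le_γ₂) hM
      (max_le (by linarith [abs_nonneg u']) (by linarith [abs_nonneg u]))
      (one_le_one_add_abs_add_abs u u')
  have hone : 1 ≤ (1 + |u| + |u'|) ^ ⌈γ₂⌉₊ := one_le_pow₀ (one_le_one_add_abs_add_abs u u')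
  calc _ ≤ l₂ * (1 + M ^ γ₂) * |(|u| - |u'|)| := hlip
    _ ≤ l₂ * ((1 + |u| + |u'|) ^ ⌈γ₂⌉₊ + (1 + |u| + |u'|) ^ ⌈γ₂⌉₊) * |u - u'| :=
      mul_le_mul (by gcongr) (abs_abs_sub_abs_le_abs_sub u u') (abs_nonneg _) (by positivity)
    _ = _ := by ring

lemma MemS₂.abs_deriv_half_le {γ₁ γ₂ l₁ l₂ : ℝ} {F : ℝ → ℝ → ℝ} (hF : MemS₂ γ₁ γ₂ l₁ l₂ F) {t : ℝ}
    (ht : 0 < t) : |deriv (F t) (1 / 2)| ≤ 2 * l₁ := by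
  have hl₁ := hF.l₁_nonneg
  have := norm_deriv_le_of_lipschitzOn (x₀ := (1 / 2 : ℝ))
    (Icc_mem_nhds (by norm_num) (by norm_num)) (hF.lipschitzOn t ht 1 zero_le_one)
  rw [Real.one_rpow, Real.coe_toNNReal _ (by positivity), Real.norm_eq_abs] at this
  linarith

lemma MemS₂.polyLip {γ₁ γ₂ l₁ l₂ : ℝ} {F : ℝ → ℝ → ℝ} (hF : MemS₂ γ₁ γ₂ l₁ l₂ F) {t : ℝ}
    (ht : 0 < t) : PolyLip (2 * l₁ + 2 ^ ⌈γ₂⌉₊ * (2 * l₂)) (⌈γ₂⌉₊ + 1) (deriv (F t)) :=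
  polyLip_of_abs_sub_le (mul_nonneg zero_le_two hF.l₂_nonneg)
    (by rw [abs_of_pos] <;> norm_num) (hF.abs_deriv_half_le ht) (hF.abs_deriv_sub_le ht)

lemma MemS.exists_polyLip {F : ℝ → ℝ → ℝ} (hF : MemS F) :
    ∃ C ≥ 0, ∃ n : ℕ, ∀ t > 0, PolyLip C n (deriv (F t)) := by
  obtain ⟨F₁, F₂, ⟨L₁, L₂, h₁⟩, ⟨γ₁, γ₂, l₁, l₂, h₂⟩, hsum⟩ := hF
  have hL := add_nonneg h₁.L₁_nonneg h₁.L₂_nonneg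
  have hl₁ := h₂.l₁_nonneg
  have hl₂ := h₂.l₂_nonneg
  refine ⟨L₁ + L₂ + (2 * l₁ + 2 ^ ⌈γ₂⌉₊ * (2 * l₂)), by positivity, ⌈γ₂⌉₊ + 1, fun t ht => ?_⟩
  have hderiv : deriv (F t) = fun u => deriv (F₁ t) u + deriv (F₂ t) u := by
    rw [show F t = fun u => F₁ t u + F₂ t u from funext (hsum t ht)]
    exact funext fun u => deriv_fun_add (h₁.differentiable t ht u) (h₂.differentiable t ht u)
  rw [hderiv]
  exact ((h₁.polyLip ht).mono hL le_rfl (Nat.zero_le _)).add (h₂.polyLip ht)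

lemma MemS.differentiable {F : ℝ → ℝ → ℝ} (hF : MemS F) {t : ℝ} (ht : 0 < t) :
    Differentiable ℝ (F t) := by
  obtain ⟨F₁, F₂, ⟨L₁, L₂, h₁⟩, ⟨γ₁, γ₂, l₁, l₂, h₂⟩, hsum⟩ := hF
  rw [show F t = fun u => F₁ t u + F₂ t u from funext (hsum t ht)]
  exact (h₁.differentiable t ht).add (h₂.differentiable t ht)

lemma MemS.continuousOn {F : ℝ → ℝ → ℝ} (hF : MemS F) :
    ContinuousOn (fun p : ℝ × ℝ => F p.1 p.2) (Set.Ioi 0 ×ˢ Set.univ) := by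
  obtain ⟨F₁, F₂, ⟨L₁, L₂, h₁⟩, ⟨γ₁, γ₂, l₁, l₂, h₂⟩, hsum⟩ := hF
  exact (h₁.continuousOn.add h₂.continuousOn).congr fun p hp => hsum p.1 hp.1 p.2

/-- A coefficient `D r u`, modelled on `f'(r, u)`, which is jointly continuous at positive times and
polynomially Lipschitz in `u`, uniformly for `r` in compact subsets of `(0, ∞)`. -/
structure TameCoeff (n : ℕ) (D : ℝ → ℝ → ℝ) : Prop where
  continuousOn : ContinuousOn (fun p : ℝ × ℝ => D p.1 p.2) (Set.Ioi 0 ×ˢ Set.univ)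
  polyLip : ∀ r₀ > 0, ∀ R, ∃ C ≥ 0, ∀ r ∈ Set.Icc r₀ R, PolyLip C n (D r)

lemma eq_rescale (f : ℝ → ℝ → ℝ) {t : ℝ} (ht : 0 < t) (u : ℝ) :
    f t u = t ^ (-(3 / 2) : ℝ) * rescale f t (√t * u) := by
  rw [rescale, ← mul_assoc, ← Real.rpow_add ht, mul_div_cancel_left₀ _ (Real.sqrt_pos.2 ht).ne',
    neg_add_cancel, Real.rpow_zero, one_mul]

lemma deriv_eq_rescale (f : ℝ → ℝ → ℝ) {t : ℝ} (ht : 0 < t) (u : ℝ) :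
    deriv (f t) u = t⁻¹ * deriv (rescale f t) (√t * u) := by
  have hpow : t ^ (-(3 / 2) : ℝ) * √t = t⁻¹ := by
    rw [Real.sqrt_eq_rpow, ← Real.rpow_add ht, ← Real.rpow_neg_one]
    norm_num
  rw [funext (eq_rescale f ht), deriv_const_mul_field, deriv_comp_mul_left, smul_eq_mul,
    ← mul_assoc, hpow]

lemma MemSbar.exists_tameCoeff {f : ℝ → ℝ → ℝ} (hf : MemSbar f) :
    ∃ n, TameCoeff n fun r => deriv (f r) := by
  obtain ⟨C, hC, n, hn⟩ := MemS.exists_polyLip hf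
  refine ⟨n, ?_, fun r₀ hr₀ R => ⟨r₀⁻¹ * C * (1 + √R) ^ (n + 1), by positivity, ?_⟩⟩
  · have hF := continuousOn_deriv_of_polyLip (MemS.continuousOn hf)
      (fun t ht => MemS.differentiable hf ht) hC hn
    have hmaps : Set.MapsTo (fun p : ℝ × ℝ => (p.1, √p.1 * p.2)) (Set.Ioi 0 ×ˢ Set.univ)
        (Set.Ioi 0 ×ˢ Set.univ) := fun p hp => ⟨hp.1, trivial⟩
    have hinv : ContinuousOn (fun p : ℝ × ℝ => p.1⁻¹) (Set.Ioi 0 ×ˢ Set.univ) :=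
      continuousOn_fst.inv₀ fun p hp => (show 0 < p.1 from hp.1).ne'
    exact (hinv.mul (hF.comp (by fun_prop) hmaps)).congr fun p hp => deriv_eq_rescale f hp.1 p.2
  · rintro r ⟨hr₀r, hrR⟩
    have hr : 0 < r := hr₀.trans_le hr₀r
    have hsqrt : |√r| ≤ √R := by
      rw [abs_of_nonneg (Real.sqrt_nonneg r)]
      exact Real.sqrt_le_sqrt hrR
    have hinv : |r⁻¹| ≤ r₀⁻¹ := by
      rw [abs_of_pos (inv_pos.2 hr)]
      exact inv_anti₀ hr₀ hr₀r
    rw [funext (deriv_eq_rescale f hr)]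
    exact ((hn r hr).comp_mul_left hC hsqrt).mono (by positivity) (by gcongr) le_rfl

lemma neg_div_le_deriv_of_rescale {L₁ L₂ γ₁ γ₂ l₁ l₂ : ℝ} {f F₁ F₂ : ℝ → ℝ → ℝ}
    (h₁ : MemS₁ L₁ L₂ F₁) (h₂ : MemS₂ γ₁ γ₂ l₁ l₂ F₂)
    (hsum : ∀ t > 0, ∀ u, rescale f t u = F₁ t u + F₂ t u) {t : ℝ} (ht : 0 < t) (u : ℝ) :
    -(L₁ / t) ≤ deriv (f t) u := by
  rw [deriv_eq_rescale f ht, funext (hsum t ht),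
    deriv_fun_add (h₁.differentiable t ht _) (h₂.differentiable t ht _), div_eq_inv_mul, ← mul_neg]
  have hF₁ : -L₁ ≤ deriv (F₁ t) (√t * u) := (abs_le.1 (h₁.abs_deriv_le ht _)).1
  have hF₂ : 0 ≤ deriv (F₂ t) (√t * u) := (h₂.monotone t ht).deriv_nonneg
  exact mul_le_mul_of_nonneg_left (by linarith) (inv_nonneg.2 ht.le)

lemma neg_div_le_deriv {L₁ L₂ γ₁ γ₂ l₁ l₂ : ℝ} {f f₁ f₂ : ℝ → ℝ → ℝ} (h₁ : MemSbar₁ L₁ L₂ f₁)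
    (h₂ : MemSbar₂ γ₁ γ₂ l₁ l₂ f₂) (hsum : ∀ t > 0, ∀ u, f t u = f₁ t u + f₂ t u) {t : ℝ}
    (ht : 0 < t) (u : ℝ) : -(L₁ / t) ≤ deriv (f t) u :=
  neg_div_le_deriv_of_rescale h₁ h₂
    (fun t ht u => by simp only [rescale, hsum t ht, mul_add]) ht u

lemma MemSbar.exists_neg_div_le_deriv {f : ℝ → ℝ → ℝ} (hf : MemSbar f) :
    ∃ L ≥ 0, ∀ t > 0, ∀ u, -(L / t) ≤ deriv (f t) u := by
  obtain ⟨F₁, F₂, ⟨L₁, L₂, h₁⟩, ⟨γ₁, γ₂, l₁, l₂, h₂⟩, hsum⟩ := hf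
  exact ⟨L₁, h₁.L₁_nonneg, fun t ht u => neg_div_le_deriv_of_rescale h₁ h₂ hsum ht u⟩

/-! ### The ordinary differential equation -/

/-- The rate `a(t, s)` in `σ' = -κ a(t, σ) σ` is continuous, and Lipschitz in `s` on bounded sets,
uniformly on bounded time intervals. -/
structure IsRate (a : ℝ → ℝ → ℝ) : Prop where
  continuousOn : ContinuousOn (fun p : ℝ × ℝ => a p.1 p.2) (Set.Ici 0 ×ˢ Set.univ)
  lipschitz : ∀ T R, ∃ L ≥ 0, ∀ t ∈ Set.Icc 0 T, ∀ s s', |s| ≤ R → |s'| ≤ R →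
    |a t s - a t s'| ≤ L * |s - s'|

/-- `σ` solves the initial value problem `σ' = -κ a(t, σ) σ`, `σ(0) = 1` on the time set `I` (an
interval containing `0`). Derivatives at end points of `I` are one-sided. -/
structure SolvesRate (a : ℝ → ℝ → ℝ) (κ : ℝ) (I : Set ℝ) (σ : ℝ → ℝ) : Prop where
  initial : σ 0 = 1
  hasDerivWithinAt : ∀ t ∈ I, HasDerivWithinAt σ (-κ * a t (σ t) * σ t) I t

namespace SolvesRate

variable {a : ℝ → ℝ → ℝ} {κ : ℝ} {I J : Set ℝ} {σ : ℝ → ℝ}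

lemma mono (hσ : SolvesRate a κ J σ) (hIJ : I ⊆ J) : SolvesRate a κ I σ where
  initial := hσ.initial
  hasDerivWithinAt t ht := (hσ.hasDerivWithinAt t (hIJ ht)).mono hIJ

lemma continuousOn (hσ : SolvesRate a κ I σ) : ContinuousOn σ I :=
  fun t ht => (hσ.hasDerivWithinAt t ht).continuousWithinAt

lemma hasDerivAt (hσ : SolvesRate a κ (Set.Ici 0) σ) {t : ℝ} (ht : 0 < t) :
    HasDerivAt σ (-κ * a t (σ t) * σ t) t :=
  (hσ.hasDerivWithinAt t ht.le).hasDerivAt (Ici_mem_nhds ht)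

lemma exists_abs_le (hσ : SolvesRate a κ (Set.Ici 0) σ) (T : ℝ) :
    ∃ S, ∀ t ∈ Set.Icc 0 T, |σ t| ≤ S :=
  isCompact_Icc.exists_bound_of_continuousOn (hσ.continuousOn.mono fun _ ht => ht.1)

end SolvesRate

lemma IsRate.exists_abs_le {a : ℝ → ℝ → ℝ} (ha : IsRate a) (T R : ℝ) :
    ∃ A ≥ 0, ∀ t ∈ Set.Icc 0 T, ∀ s, |s| ≤ R → |a t s| ≤ A := by
  have hcompact : IsCompact (Set.Icc 0 T ×ˢ Set.Icc (-R) R) := isCompact_Icc.prod isCompact_Icc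
  obtain ⟨A, hA⟩ := hcompact.exists_bound_of_continuousOn
    (ha.continuousOn.mono (Set.prod_mono Set.Icc_subset_Ici_self (Set.subset_univ _)))
  exact ⟨max A 0, le_max_right _ _, fun t ht s hs =>
    (hA (t, s) ⟨ht, abs_le.1 hs⟩).trans (le_max_left _ _)⟩

lemma IsRate.exists_lipschitzOnWith_mul {a : ℝ → ℝ → ℝ} (ha : IsRate a) (κ T R : ℝ) :
    ∃ K, ∀ t ∈ Set.Icc 0 T, LipschitzOnWith K (fun s => -κ * a t s * s) (Set.Icc (-R) R) := by
  obtain ⟨A, hA, hAb⟩ := ha.exists_abs_le T R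
  obtain ⟨L, hL, hLip⟩ := ha.lipschitz T R
  refine ⟨(|κ| * (A + L * |R|)).toNNReal, fun t ht => .of_dist_le_mul fun s hs s' hs' => ?_⟩
  rw [Set.mem_Icc, ← abs_le] at hs hs'
  rw [Real.coe_toNNReal _ (by positivity), Real.dist_eq, Real.dist_eq,
    show -κ * a t s * s - -κ * a t s' * s' =
      -κ * (a t s * (s - s') + (a t s - a t s') * s') by ring, abs_mul, abs_neg, mul_assoc]
  gcongr
  have hs'R : |s'| ≤ |R| := hs'.trans (le_abs_self R)
  calc |a t s * (s - s') + (a t s - a t s') * s'|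
      ≤ |a t s| * |s - s'| + |a t s - a t s'| * |s'| := by
        simpa only [abs_mul] using abs_add_le (a t s * (s - s')) ((a t s - a t s') * s')
    _ ≤ A * |s - s'| + L * |s - s'| * |R| := by
        gcongr
        exacts [hAb t ht s hs, hLip t ht s s' hs hs']
    _ = (A + L * |R|) * |s - s'| := by ring

lemma hasDerivWithinAt_Ici_of_Icc {E : Type*} [NormedAddCommGroup E] [NormedSpace ℝ E]
    {g : ℝ → E} {g' : E} {a b t : ℝ} (ht : t ∈ Set.Ico a b)
    (hg : HasDerivWithinAt g g' (Set.Icc a b) t) : HasDerivWithinAt g g' (Set.Ici t) t :=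
  hg.mono_of_mem_nhdsWithin (Filter.mem_of_superset (Icc_mem_nhdsGE ht.2)
    (Set.Icc_subset_Icc_left ht.1))

lemma IsRate.eqOn {a : ℝ → ℝ → ℝ} (ha : IsRate a) {κ T : ℝ} {σ τ : ℝ → ℝ}
    (hσ : SolvesRate a κ (Set.Icc 0 T) σ) (hτ : SolvesRate a κ (Set.Icc 0 T) τ) :
    Set.EqOn σ τ (Set.Icc 0 T) := by
  obtain ⟨R₁, hR₁⟩ := isCompact_Icc.exists_bound_of_continuousOn hσ.continuousOn
  obtain ⟨R₂, hR₂⟩ := isCompact_Icc.exists_bound_of_continuousOn hτ.continuousOn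
  obtain ⟨K, hK⟩ := ha.exists_lipschitzOnWith_mul κ T (max R₁ R₂)
  have hIco : ∀ t ∈ Set.Ico 0 T, t ∈ Set.Icc 0 T := fun t ht => Set.Ico_subset_Icc_self ht
  exact ODE_solution_unique_of_mem_Icc_right (fun t ht => hK t (hIco t ht))
    hσ.continuousOn
    (fun t ht => hasDerivWithinAt_Ici_of_Icc ht (hσ.hasDerivWithinAt t (hIco t ht)))
    (fun t ht => abs_le.1 ((hR₁ t (hIco t ht)).trans (le_max_left _ _)))
    hτ.continuousOn
    (fun t ht => hasDerivWithinAt_Ici_of_Icc ht (hτ.hasDerivWithinAt t (hIco t ht)))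
    (fun t ht => abs_le.1 ((hR₂ t (hIco t ht)).trans (le_max_right _ _)))
    (hσ.initial.trans hτ.initial.symm)

open scoped NNReal in
lemma exists_hasDerivWithinAt_Icc_of_lipschitzWith {E : Type*} [NormedAddCommGroup E]
    [NormedSpace ℝ E] [CompleteSpace E] {c : ℝ → E → E} {T : ℝ} (hT : 0 ≤ T) {A K : ℝ≥0}
    (hcont : ∀ x, ContinuousOn (c · x) (Set.Icc 0 T))
    (hlip : ∀ t ∈ Set.Icc 0 T, LipschitzWith K (c t))
    (hbound : ∀ t ∈ Set.Icc 0 T, ∀ x, ‖c t x‖ ≤ A) (x₀ : E) :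
    ∃ ρ : ℝ → E, ρ 0 = x₀ ∧
      ∀ t ∈ Set.Icc 0 T, HasDerivWithinAt ρ (c t (ρ t)) (Set.Icc 0 T) t := by
  have hpicard : IsPicardLindelof c (tmin := 0) (tmax := T) ⟨0, le_rfl, hT⟩ x₀
      (A * T.toNNReal) 0 A K :=
    { lipschitzOnWith t ht := (hlip t ht).lipschitzOnWith
      continuousOn x _ := hcont x
      norm_le t ht x _ := hbound t ht x
      mul_max_le := by simp [hT] }
  exact hpicard.exists_eq_forall_mem_Icc_hasDerivWithinAt₀

lemma lipschitzWith_exp_min (K : ℝ) :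
    LipschitzWith (Real.exp K).toNNReal fun x => Real.exp (min x K) := by
  have hexp : LipschitzOnWith (Real.exp K).toNNReal Real.exp (Set.Iic K) :=
    (convex_Iic K).lipschitzOnWith_of_nnnorm_deriv_le
      (fun _ _ => Real.differentiable_exp.differentiableAt) fun x hx => by
        rw [← NNReal.coe_le_coe, coe_nnnorm, Real.deriv_exp, Real.norm_eq_abs, Real.abs_exp,
          Real.coe_toNNReal _ (Real.exp_nonneg K)]
        exact Real.exp_le_exp.2 hx
  have hmin : LipschitzOnWith 1 (fun x => min x K) Set.univ :=
    (LipschitzWith.id.min_const K).lipschitzOnWith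
  simpa [Function.comp_def] using hexp.comp hmin fun x _ => Set.mem_Iic.2 (min_le_right x K)

lemma IsRate.exists_lipschitzWith_exp_min {a : ℝ → ℝ → ℝ} (ha : IsRate a) (κ T K : ℝ) :
    ∃ L, ∀ t ∈ Set.Icc 0 T, LipschitzWith L fun x => -κ * a t (Real.exp (min x K)) := by
  obtain ⟨L, hL, hLip⟩ := ha.lipschitz T (Real.exp K)
  refine ⟨(|κ| * L).toNNReal * (Real.exp K).toNNReal, fun t ht => .of_dist_le_mul fun x y => ?_⟩
  have htrunc : ∀ x, |Real.exp (min x K)| ≤ Real.exp K := fun x => by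
    rw [Real.abs_exp]
    exact Real.exp_le_exp.2 (min_le_right _ _)
  calc |-κ * a t (Real.exp (min x K)) - -κ * a t (Real.exp (min y K))|
      ≤ |κ| * (L * |Real.exp (min x K) - Real.exp (min y K)|) := by
        rw [← mul_sub, abs_mul, abs_neg]
        gcongr
        exact hLip t ht _ _ (htrunc x) (htrunc y)
    _ ≤ |κ| * (L * ((Real.exp K).toNNReal * |x - y|)) := by
        gcongr
        exact (lipschitzWith_exp_min K).dist_le_mul x y
    _ = ((|κ| * L).toNNReal * (Real.exp K).toNNReal : NNReal) * |x - y| := by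
        rw [NNReal.coe_mul, Real.coe_toNNReal (|κ| * L) (by positivity)]
        ring

/-- The function `ρ = log σ` solves `ρ' = -κ a(t, e^ρ)`. As the right side is at most `κ B`,
replacing `e^ρ` by `e^(min ρ (κ B T))`, which makes it Lipschitz, does not affect the solution on
`[0, T]`. -/
lemma IsRate.exists_solvesRate_Icc {a : ℝ → ℝ → ℝ} (ha : IsRate a) {κ B : ℝ} (hκ : 0 ≤ κ)
    (hB : 0 ≤ B) (hlow : ∀ t ≥ 0, ∀ s, -B ≤ a t s) {T : ℝ} (hT : 0 ≤ T) :
    ∃ σ : ℝ → ℝ, (∀ t, 0 < σ t) ∧ SolvesRate a κ (Set.Icc 0 T) σ := by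
  set K := κ * B * T
  obtain ⟨A, hA, hAb⟩ := ha.exists_abs_le T (Real.exp K)
  obtain ⟨L, hlip⟩ := ha.exists_lipschitzWith_exp_min κ T K
  have hcont : ∀ x, ContinuousOn (fun t => -κ * a t (Real.exp (min x K))) (Set.Icc 0 T) :=
    fun x => continuousOn_const.mul (ha.continuousOn.comp
      (f := fun t => (t, Real.exp (min x K))) (by fun_prop) fun t ht => ⟨ht.1, Set.mem_univ _⟩)
  have hbound : ∀ t ∈ Set.Icc 0 T, ∀ x,
      ‖-κ * a t (Real.exp (min x K))‖ ≤ (κ * A).toNNReal := fun t ht x => by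
    rw [Real.coe_toNNReal _ (by positivity), Real.norm_eq_abs, abs_mul, abs_neg, abs_of_nonneg hκ]
    gcongr
    refine hAb t ht _ ?_
    rw [Real.abs_exp]
    exact Real.exp_le_exp.2 (min_le_right _ _)
  obtain ⟨ρ, hρ₀, hρ⟩ := exists_hasDerivWithinAt_Icc_of_lipschitzWith hT hcont hlip hbound 0
  have hgrowth : ∀ t ∈ Set.Icc 0 T, ρ t ≤ κ * B * t := by
    refine image_le_of_deriv_right_le_deriv_boundary
      (fun t ht => (hρ t ht).continuousWithinAt)
      (fun t ht => hasDerivWithinAt_Ici_of_Icc ht (hρ t (Set.Ico_subset_Icc_self ht)))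
      (by simpa using hρ₀.le) (by fun_prop)
      (fun t _ => ((hasDerivAt_id t).const_mul (κ * B)).hasDerivWithinAt) fun t ht => ?_
    linarith [mul_le_mul_of_nonneg_left (hlow t ht.1 (Real.exp (min (ρ t) K))) hκ]
  refine ⟨fun t => Real.exp (ρ t), fun t => Real.exp_pos _, by simp [hρ₀], fun t ht => ?_⟩
  have hinactive : min (ρ t) K = ρ t := min_eq_left ((hgrowth t ht).trans
    (mul_le_mul_of_nonneg_left ht.2 (by positivity)))
  have hderiv := (hρ t ht).exp
  rw [hinactive] at hderiv
  exact hderiv.congr_deriv (by ring)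

theorem IsRate.exists_solvesRate {a : ℝ → ℝ → ℝ} (ha : IsRate a) {κ B : ℝ} (hκ : 0 ≤ κ)
    (hB : 0 ≤ B) (hlow : ∀ t ≥ 0, ∀ s, -B ≤ a t s) :
    ∃ σ : ℝ → ℝ, (∀ t, 0 < σ t) ∧ SolvesRate a κ (Set.Ici 0) σ := by
  choose s hpos hs using fun n : ℕ => ha.exists_solvesRate_Icc hκ hB hlow n.cast_nonneg
  have hcompat : ∀ {n N : ℕ}, n ≤ N → Set.EqOn (s n) (s N) (Set.Icc 0 n) := fun {n N} hn =>
    ha.eqOn (hs n) ((hs N).mono (Set.Icc_subset_Icc_right (Nat.cast_le.2 hn)))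
  have hglue : ∀ N : ℕ, Set.EqOn (fun t => s ⌈t⌉₊ t) (s N) (Set.Icc 0 N) := fun N t ht => by
    rcases le_total N ⌈t⌉₊ with h | h
    · exact (hcompat h ht).symm
    · exact hcompat h ⟨ht.1, Nat.le_ceil t⟩
  refine ⟨fun t => s ⌈t⌉₊ t, fun t => hpos _ t, by simpa using (hs 0).initial, fun t ht => ?_⟩
  obtain ⟨N, hN⟩ := exists_nat_gt t
  have htN : t ∈ Set.Icc (0 : ℝ) N := ⟨ht, hN.le⟩
  have hderiv := ((hs N).hasDerivWithinAt t htN).congr (hglue N) (hglue N htN)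
  rw [← hglue N htN] at hderiv
  exact hderiv.mono_of_mem_nhdsWithin
    (Filter.inter_mem self_mem_nhdsWithin (mem_nhdsWithin_of_mem_nhds (Iic_mem_nhds hN)))

/-! ### Gaussian expectations of the nonlinearity -/

/-- The expectation `E[D(r, q Z)]` with `Z` a standard Gaussian. -/
def gaussMean (D : ℝ → ℝ → ℝ) (r q : ℝ) : ℝ :=
  ∫ z, D r (q * z) ∂gaussianReal 0 1

/-- The expectation `E[D(t+ε², s G^m_t * η_ε(x))]`, which does not depend on `x`. -/
def gaussRate (D : ℝ → ℝ → ℝ) (m ε t s : ℝ) : ℝ :=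
  gaussMean D (t + ε ^ 2) (flowStd m ε t * s)

lemma PolyLip.abs_apply_mul_le {C : ℝ} {n : ℕ} {D : ℝ → ℝ} (h : PolyLip C n D) (hC : 0 ≤ C)
    {q Q : ℝ} (hq : |q| ≤ Q) (z : ℝ) : |D (q * z)| ≤ C * (1 + Q) ^ n * (1 + |z|) ^ n := by
  have hQ : 0 ≤ Q := (abs_nonneg q).trans hq
  calc |D (q * z)| ≤ C * (1 + |q| * |z|) ^ n := abs_mul q z ▸ h.abs_apply_le (q * z)
    _ ≤ C * ((1 + Q) * (1 + |z|)) ^ n := by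
        gcongr
        nlinarith [mul_le_mul_of_nonneg_right hq (abs_nonneg z), abs_nonneg z]
    _ = C * (1 + Q) ^ n * (1 + |z|) ^ n := by rw [mul_pow, mul_assoc]

lemma PolyLip.abs_sub_apply_mul_le {C : ℝ} {n : ℕ} {D : ℝ → ℝ} (h : PolyLip C n D) (hC : 0 ≤ C)
    (q q' z : ℝ) :
    |D (q * z) - D (q' * z)| ≤
      C * (1 + |q| + |q'|) ^ n * |q - q'| * (1 + |z|) ^ (n + 1) := by
  refine (h.abs_sub_apply_le _ _).trans ?_
  rw [← sub_mul, abs_mul, abs_mul, abs_mul]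
  calc C * (1 + |q| * |z| + |q'| * |z|) ^ n * (|q - q'| * |z|)
      ≤ C * ((1 + |q| + |q'|) * (1 + |z|)) ^ n * (|q - q'| * (1 + |z|)) := by
        gcongr
        · nlinarith [abs_nonneg q, abs_nonneg q', abs_nonneg z]
        · linarith
    _ = _ := by rw [mul_pow, pow_succ]; ring

lemma PolyLip.integrable_gaussianReal {C : ℝ} {n : ℕ} {D : ℝ → ℝ} (h : PolyLip C n D) (hC : 0 ≤ C)
    (hD : Continuous D) (q : ℝ) : Integrable (fun z => D (q * z)) (gaussianReal 0 1) :=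
  ((integrable_one_add_abs_pow_gaussianReal 1 n).const_mul (C * (1 + |q|) ^ n)).mono'
    (hD.comp (by fun_prop)).aestronglyMeasurable
    (ae_of_all _ fun z => h.abs_apply_mul_le hC le_rfl z)

lemma gaussMoment_nonneg (v : NNReal) (p : ℕ) : 0 ≤ gaussMoment v p :=
  integral_nonneg fun z => by positivity

lemma PolyLip.integral_gaussianReal {C : ℝ} {n : ℕ} {D : ℝ → ℝ} (h : PolyLip C n D) (hC : 0 ≤ C)
    (hD : Continuous D) :
    PolyLip (C * gaussMoment 1 (n + 1)) n fun q => ∫ z, D (q * z) ∂gaussianReal 0 1 := by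
  have hbound : ∀ (c : ℝ) (f : ℝ → ℝ), (∀ z, |f z| ≤ c * (1 + |z|) ^ (n + 1)) →
      |∫ z, f z ∂gaussianReal 0 1| ≤ c * gaussMoment 1 (n + 1) := fun c f hf =>
    (norm_integral_le_of_norm_le (f := f)
      ((integrable_one_add_abs_pow_gaussianReal 1 (n + 1)).const_mul c)
      (ae_of_all _ hf)).trans_eq (integral_const_mul _ _)
  constructor
  · intro q
    refine (hbound (C * (1 + |q|) ^ n) _ fun z =>
      (h.abs_apply_mul_le hC le_rfl z).trans ?_).trans_eq (by ring)
    gcongr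
    exacts [one_le_one_add_abs z, n.le_succ]
  · intro q q'
    rw [← integral_sub (h.integrable_gaussianReal hC hD q) (h.integrable_gaussianReal hC hD q')]
    exact (hbound _ _ fun z => h.abs_sub_apply_mul_le hC q q' z).trans_eq (by ring)

namespace TameCoeff

variable {n : ℕ} {D : ℝ → ℝ → ℝ}

lemma continuous (hD : TameCoeff n D) {r : ℝ} (hr : 0 < r) : Continuous (D r) := by
  rw [← continuousOn_univ]
  exact hD.continuousOn.comp (f := fun u : ℝ => (r, u)) (by fun_prop)
    fun u _ => ⟨hr, Set.mem_univ _⟩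

lemma integrable_gaussianReal (hD : TameCoeff n D) {r : ℝ} (hr : 0 < r) (q : ℝ) :
    Integrable (fun z => D r (q * z)) (gaussianReal 0 1) := by
  obtain ⟨C, hC, h⟩ := hD.polyLip r hr r
  exact (h r ⟨le_rfl, le_rfl⟩).integrable_gaussianReal hC (hD.continuous hr) q

lemma continuousOn_gaussMean (hD : TameCoeff n D) :
    ContinuousOn (fun p : ℝ × ℝ => gaussMean D p.1 p.2) (Set.Ioi 0 ×ˢ Set.univ) := by
  refine continuousOn_of_forall_continuousAt fun ⟨r₀, q₀⟩ ⟨hr₀, _⟩ => ?_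
  simp only [Set.mem_Ioi] at hr₀
  obtain ⟨C, hC, h⟩ := hD.polyLip (r₀ / 2) (half_pos hr₀) (r₀ + 1)
  have hr : ∀ᶠ p : ℝ × ℝ in nhds (r₀, q₀), p.1 ∈ Set.Icc (r₀ / 2) (r₀ + 1) :=
    continuous_fst.continuousAt.eventually_mem (Icc_mem_nhds (half_lt_self hr₀) (lt_add_one r₀))
  have hq : ∀ᶠ p : ℝ × ℝ in nhds (r₀, q₀), |p.2| < |q₀| + 1 :=
    continuous_snd.abs.continuousAt.eventually_lt_const (lt_add_one |q₀|)
  refine continuousAt_of_dominated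
    (bound := fun z => C * (1 + (|q₀| + 1)) ^ n * (1 + |z|) ^ n) ?_ ?_
    ((integrable_one_add_abs_pow_gaussianReal 1 n).const_mul _) (ae_of_all _ fun z => ?_)
  · filter_upwards [hr] with p hp
    exact ((hD.continuous ((half_pos hr₀).trans_le hp.1)).comp
      (by fun_prop)).aestronglyMeasurable
  · filter_upwards [hr, hq] with p hp hpq
    exact ae_of_all _ fun z => (h p.1 hp).abs_apply_mul_le hC hpq.le z
  · exact ContinuousAt.comp (g := fun p : ℝ × ℝ => D p.1 p.2)
      (f := fun p : ℝ × ℝ => (p.1, p.2 * z))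
      (hD.continuousOn.continuousAt (prod_mem_nhds (Ioi_mem_nhds hr₀) Filter.univ_mem))
      (by fun_prop)

lemma gaussMean (hD : TameCoeff n D) : TameCoeff n (gaussMean D) where
  continuousOn := hD.continuousOn_gaussMean
  polyLip r₀ hr₀ R := by
    obtain ⟨C, hC, h⟩ := hD.polyLip r₀ hr₀ R
    exact ⟨C * gaussMoment 1 (n + 1), mul_nonneg hC (gaussMoment_nonneg _ _), fun r hr =>
      (h r hr).integral_gaussianReal hC (hD.continuous (hr₀.trans_le hr.1))⟩

lemma isRate (hD : TameCoeff n D) {q : ℝ → ℝ} (hq : ContinuousOn q (Set.Ici 0)) {r₀ : ℝ}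
    (hr₀ : 0 < r₀) : IsRate fun t s => D (t + r₀) (q t * s) where
  continuousOn := hD.continuousOn.comp (f := fun p : ℝ × ℝ => (p.1 + r₀, q p.1 * p.2))
    ((continuousOn_fst.add continuousOn_const).prodMk
      ((hq.comp continuousOn_fst fun _ hp => hp.1).mul continuousOn_snd))
    fun _ hp => ⟨add_pos_of_nonneg_of_pos hp.1 hr₀, Set.mem_univ _⟩
  lipschitz T R := by
    obtain ⟨A, hA⟩ := isCompact_Icc.exists_bound_of_continuousOn
      (hq.mono fun t (ht : t ∈ Set.Icc 0 T) => ht.1)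
    obtain ⟨C, hC, h⟩ := hD.polyLip r₀ hr₀ (T + r₀)
    refine ⟨C * (1 + |A|) ^ (n + 1) * (1 + |R| + |R|) ^ n, by positivity,
      fun t ht s s' hs hs' => ?_⟩
    have hcoeff := (h (t + r₀) ⟨by linarith [ht.1], by linarith [ht.2]⟩).comp_mul_left (c := 1) hC
      ((hA t ht).trans (le_abs_self A))
    have hsR : |s| ≤ |R| := hs.trans (le_abs_self R)
    have hs'R : |s'| ≤ |R| := hs'.trans (le_abs_self R)
    have hlip := hcoeff.abs_sub_apply_le s s'
    simp only [abs_one, one_mul] at hlip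
    exact hlip.trans (by gcongr)

end TameCoeff

lemma continuousOn_flowStd (m : ℝ) {ε : ℝ} (hε : 0 < ε) :
    ContinuousOn (flowStd m ε) (Set.Ici 0) := by
  refine ContinuousOn.mul (by fun_prop) (Real.continuous_sqrt.comp_continuousOn
    (continuousOn_const.div (by fun_prop) fun t ht => ?_))
  have : 0 ≤ t := ht
  positivity

lemma TameCoeff.isRate_gaussRate {n : ℕ} {D : ℝ → ℝ → ℝ} (hD : TameCoeff n D) (m : ℝ) {ε : ℝ}
    (hε : 0 < ε) : IsRate (gaussRate D m ε) :=
  hD.gaussMean.isRate (continuousOn_flowStd m hε) (pow_pos hε 2)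

lemma TameCoeff.neg_div_le_gaussRate {n : ℕ} {D : ℝ → ℝ → ℝ} (hD : TameCoeff n D) (m : ℝ) {ε : ℝ}
    (hε : 0 < ε) {L : ℝ} (hL : ∀ r > 0, ∀ u, -(L / r) ≤ D r u) {t : ℝ} (ht : 0 ≤ t) (s : ℝ) :
    -(L / (t + ε ^ 2)) ≤ gaussRate D m ε t s := by
  have hr : 0 < t + ε ^ 2 := by positivity
  simpa [gaussRate, McKeanVlasov.gaussMean] using integral_mono
    (integrable_const (-(L / (t + ε ^ 2))))
    (hD.integrable_gaussianReal hr (flowStd m ε t * s)) fun z => hL _ hr _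

section Expectation

variable {Ω : Type*} [MeasurableSpace Ω] {P : Measure Ω} [IsProbabilityMeasure P]
  {η : Ω → 𝓢(Plane, ℝ) →L[ℝ] ℝ}

lemma IsWhiteNoise.integrable_coeff (hη : IsWhiteNoise P η) {ε : ℝ} (hε : 0 < ε) (m : ℝ) {n : ℕ}
    {D : ℝ → ℝ → ℝ} (hD : TameCoeff n D) {t : ℝ} (ht : 0 ≤ t) (s : ℝ) (x : Plane) :
    Integrable (fun ω => D (t + ε ^ 2) (s * heatFlow m t (mollify ε hε (η ω)) x)) P := by
  have hr : 0 < t + ε ^ 2 := by positivity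
  have hlaw := hη.hasLaw_heatFlow hε m ht x
  have hcont : Continuous fun u => D (t + ε ^ 2) (s * u) := (hD.continuous hr).comp (by fun_prop)
  have hint : Integrable (fun u => D (t + ε ^ 2) (s * u))
      (P.map fun ω => heatFlow m t (mollify ε hε (η ω)) x) := by
    rw [hlaw.map_eq, integrable_map_measure hcont.aestronglyMeasurable (by fun_prop)]
    simpa only [Function.comp_def, mul_assoc] using
      hD.integrable_gaussianReal hr (s * flowStd m ε t)
  exact hint.comp_aemeasurable hlaw.aemeasurable

lemma IsWhiteNoise.integral_coeff (hη : IsWhiteNoise P η) {ε : ℝ} (hε : 0 < ε) (m : ℝ) {n : ℕ}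
    {D : ℝ → ℝ → ℝ} (hD : TameCoeff n D) {t : ℝ} (ht : 0 ≤ t) (s : ℝ) (x : Plane) :
    ∫ ω, D (t + ε ^ 2) (s * heatFlow m t (mollify ε hε (η ω)) x) ∂P = gaussRate D m ε t s := by
  have hr : 0 < t + ε ^ 2 := by positivity
  have hcont : Continuous fun u => D (t + ε ^ 2) (s * u) := (hD.continuous hr).comp (by fun_prop)
  calc ∫ ω, D (t + ε ^ 2) (s * heatFlow m t (mollify ε hε (η ω)) x) ∂P
      = ∫ u, D (t + ε ^ 2) (s * u) ∂(gaussianReal 0 1).map fun z => flowStd m ε t * z :=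
        (hη.hasLaw_heatFlow hε m ht x).integral_comp hcont.aestronglyMeasurable
    _ = ∫ z, D (t + ε ^ 2) (s * (flowStd m ε t * z)) ∂gaussianReal 0 1 :=
        integral_map (by fun_prop) hcont.aestronglyMeasurable
    _ = gaussRate D m ε t s := by
        simp only [gaussRate, gaussMean, mul_left_comm s, mul_assoc]

end Expectation

/-! ### Self-similar nonlinearities -/

/-- The statistic `y ↦ (θ ↦ -θ y²)`, whose exponential integrals are centred Gaussian integrals. -/
def sqStat (y : ℝ) : ℝ →L[ℝ] ℝ := (-y ^ 2) • ContinuousLinearMap.id ℝ ℝ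

lemma sqStat_apply (y θ : ℝ) : sqStat y θ = -y ^ 2 * θ := rfl

lemma continuous_sqStat : Continuous sqStat :=
  (continuous_pow 2).neg.smul continuous_const

lemma norm_sqStat (y : ℝ) : ‖sqStat y‖ = y ^ 2 := by
  rw [sqStat, norm_smul, ContinuousLinearMap.norm_id, mul_one, Real.norm_eq_abs, abs_neg,
    abs_of_nonneg (sq_nonneg y)]

lemma expIntegrableAt_sqStat {C : ℝ} {n : ℕ} {h : ℝ → ℝ} (hcont : Continuous h)
    (hbound : ∀ y, |h y| ≤ C * (1 + |y|) ^ n) {θ : ℝ} (hθ : 0 < θ) :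
    ExpIntegrableAt volume sqStat h θ := by
  have hθ' : 0 < θ / 4 := by positivity
  have hC : 0 ≤ C := by simpa using (abs_nonneg _).trans (hbound 0)
  refine ⟨θ / 2, by positivity, ((integrable_exp_neg_mul_sq hθ').const_mul
    (C * ((2 / (θ / 4)) ^ n * n.factorial * Real.exp (θ / 4)))).mono' ?_ (ae_of_all _ fun y => ?_)⟩
  · simp only [sqStat_apply, norm_sqStat]
    fun_prop
  have hmoment := one_add_pow_mul_exp_le hθ' n (abs_nonneg y)
  rw [sq_abs] at hmoment
  rw [Real.norm_of_nonneg (by positivity), sqStat_apply, norm_sqStat, Real.norm_eq_abs]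
  rw [show -y ^ 2 * θ + θ / 2 * y ^ 2 = -(θ / 4 * y ^ 2) + -(θ / 4) * y ^ 2 by ring]
  calc Real.exp (-(θ / 4 * y ^ 2) + -(θ / 4) * y ^ 2) * |h y|
      ≤ Real.exp (-(θ / 4 * y ^ 2) + -(θ / 4) * y ^ 2) * (C * (1 + |y|) ^ n) := by
        gcongr
        exact hbound y
    _ = C * ((1 + |y|) ^ n * Real.exp (-(θ / 4 * y ^ 2))) * Real.exp (-(θ / 4) * y ^ 2) := by
        rw [Real.exp_add]
        ring
    _ ≤ _ := by gcongr

lemma integral_gaussianReal_comp_mul {h : ℝ → ℝ} (hcont : Continuous h) {q : ℝ} (hq : 0 < q) :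
    ∫ z, h (q * z) ∂gaussianReal 0 1 =
      (√(2 * Real.pi))⁻¹ * q⁻¹ * expIntegral volume sqStat h (1 / (2 * q ^ 2)) := by
  have hvar : NNReal.mk (q ^ 2) (sq_nonneg q) * 1 ≠ 0 := by
    simpa [← NNReal.coe_ne_zero] using hq.ne'
  rw [← integral_map (φ := fun z => q * z) (f := h) (by fun_prop) hcont.aestronglyMeasurable,
    gaussianReal_map_const_mul, mul_zero, integral_gaussianReal_eq_integral_smul hvar,
    expIntegral, ← integral_const_mul]
  refine integral_congr_ae (ae_of_all _ fun y => ?_)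
  simp only [gaussianPDFReal, smul_eq_mul, mul_one, sub_zero, NNReal.coe_mk]
  rw [Real.sqrt_mul (by positivity), Real.sqrt_sq hq.le, mul_inv, sqStat_apply, mul_one_div,
    mul_assoc]

lemma contDiffOn_integral_gaussianReal {C : ℝ} {n : ℕ} {h : ℝ → ℝ} (hcont : Continuous h)
    (hbound : ∀ y, |h y| ≤ C * (1 + |y|) ^ n) :
    ContDiffOn ℝ (⊤ : ℕ∞) (fun q => ∫ z, h (q * z) ∂gaussianReal 0 1) (Set.Ioi 0) := by
  have hlaplace : ContDiffOn ℝ (⊤ : ℕ∞) (expIntegral volume sqStat h) (Set.Ioi 0) :=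
    contDiffOn_expIntegral continuous_sqStat.aestronglyMeasurable hcont.aestronglyMeasurable
      fun θ hθ => expIntegrableAt_sqStat hcont hbound hθ
  have hparam : ContDiffOn ℝ (⊤ : ℕ∞) (fun q : ℝ => 1 / (2 * q ^ 2)) (Set.Ioi 0) :=
    contDiffOn_const.div (by fun_prop) fun q (hq : 0 < q) => by positivity
  have hnormal : ContDiffOn ℝ (⊤ : ℕ∞) (fun q : ℝ => (√(2 * Real.pi))⁻¹ * q⁻¹) (Set.Ioi 0) :=
    contDiffOn_const.mul (contDiffOn_id.inv fun q (hq : 0 < q) => hq.ne')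
  exact (hnormal.mul (hlaplace.comp hparam fun q (hq : 0 < q) =>
    Set.mem_Ioi.2 (by positivity))).congr fun q hq => integral_gaussianReal_comp_mul hcont hq

lemma sqrt_mul_flowStd (m : ℝ) {ε t : ℝ} (hr : 0 < t + ε ^ 2) :
    √(t + ε ^ 2) * flowStd m ε t = Real.exp (m * t) * √(1 / (4 * Real.pi)) := by
  rw [flowStd, mul_left_comm, ← Real.sqrt_mul hr.le]
  congr 2
  field_simp

lemma rescale_of_selfSimilar {f : ℝ → ℝ → ℝ} {F : ℝ → ℝ}
    (hF : ∀ t > 0, ∀ u, f t u = t ^ (-(3 / 2) : ℝ) * F (√t * u)) {t : ℝ} (ht : 0 < t) :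
    rescale f t = F := by
  funext u
  have hsqrt : √t ≠ 0 := (Real.sqrt_pos.2 ht).ne'
  rw [rescale, hF t ht, ← mul_assoc, ← Real.rpow_add ht, mul_div_cancel₀ _ hsqrt, add_neg_cancel,
    Real.rpow_zero, one_mul]

lemma exists_gaussRate_of_selfSimilar {f : ℝ → ℝ → ℝ} (hf : MemSbar f) (m ε : ℝ) {F : ℝ → ℝ}
    (hF : ∀ t > 0, ∀ u, f t u = t ^ (-(3 / 2) : ℝ) * F (√t * u)) :
    ∃ A : ℝ → ℝ, ContDiffOn ℝ (⊤ : ℕ∞) A (Set.Ioi 0) ∧ ∀ t, 0 < t + ε ^ 2 → ∀ s,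
      gaussRate (fun r => deriv (f r)) m ε t s =
        (t + ε ^ 2)⁻¹ * A (Real.exp (m * t) * √(1 / (4 * Real.pi)) * s) := by
  have hderiv : ∀ r > 0, ∀ u, deriv (f r) u = r⁻¹ * deriv F (√r * u) := fun r hr u => by
    rw [deriv_eq_rescale f hr, rescale_of_selfSimilar hF hr]
  have hderivF : deriv F = deriv (f 1) := by
    funext u
    simp [hderiv 1 one_pos]
  obtain ⟨n, hD⟩ := hf.exists_tameCoeff
  obtain ⟨C, _, hpoly⟩ := hD.polyLip 1 one_pos 1
  refine ⟨fun q => ∫ z, deriv F (q * z) ∂gaussianReal 0 1, ?_, fun t hr s => ?_⟩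
  · rw [hderivF]
    exact contDiffOn_integral_gaussianReal (hD.continuous one_pos)
      (hpoly 1 ⟨le_rfl, le_rfl⟩).abs_apply_le
  · simp only [gaussRate, gaussMean, hderiv _ hr, integral_const_mul, ← sqrt_mul_flowStd m hr,
      mul_assoc]

/-! ### Comparison for linear parabolic equations -/

section LinearHeat

variable {E : Type*} [NormedAddCommGroup E] [InnerProductSpace ℝ E] [FiniteDimensional ℝ E]

/-- `u` is a classical solution on `[0,T] × E` of the linear equation `∂_t u = ½ Δu + a u + r` with
potential `a` and forcing `r`. -/
def SolvesLinearHeat (T : ℝ) (a r u : ℝ → E → ℝ) : Prop :=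
  IsParabolic T u fun t x => 1 / 2 * (Δ (u t)) x + a t x * u t x + r t x

namespace SolvesLinearHeat

variable {T : ℝ} {a a₁ a₂ r r₁ r₂ u u₁ u₂ : ℝ → E → ℝ}

lemma neg (hu : SolvesLinearHeat T a r u) :
    SolvesLinearHeat T a (fun t x => -r t x) fun t x => -u t x where
  continuousOn := hu.continuousOn.neg
  contDiff t ht := (hu.contDiff t ht).neg
  hasDerivAt t ht x := by
    have hlap : (Δ fun x => -u t x) x = -(Δ (u t)) x := by
      simpa only [neg_one_mul] using laplacian_const_mul (hu.contDiff t ht).contDiffAt (-1)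
    refine (hu.hasDerivAt t ht x).neg.congr_deriv ?_
    rw [hlap]
    ring

lemma sub (hu₁ : SolvesLinearHeat T a₁ r₁ u₁) (hu₂ : SolvesLinearHeat T a₂ r₂ u₂) :
    SolvesLinearHeat T a₁ (fun t x => r₁ t x - r₂ t x + (a₁ t x - a₂ t x) * u₂ t x)
      fun t x => u₁ t x - u₂ t x where
  continuousOn := hu₁.continuousOn.sub hu₂.continuousOn
  contDiff t ht := (hu₁.contDiff t ht).sub (hu₂.contDiff t ht)
  hasDerivAt t ht x := by
    have hlap : (Δ fun x => u₁ t x - u₂ t x) x = (Δ (u₁ t)) x - (Δ (u₂ t)) x :=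
      (hu₁.contDiff t ht).contDiffAt.laplacian_sub (hu₂.contDiff t ht).contDiffAt
    refine ((hu₁.hasDerivAt t ht x).sub (hu₂.hasDerivAt t ht x)).congr_deriv ?_
    rw [hlap]
    ring

end SolvesLinearHeat

variable {ι : Type*} [Fintype ι] [Nonempty ι] {T b c C : ℝ}
  {a₁ a₂ r₁ r₂ u₁ u₂ : ℝ → EuclideanSpace ℝ ι → ℝ}

lemma SolvesLinearHeat.le (hu₁ : SolvesLinearHeat T a₁ r₁ u₁)
    (hu₂ : SolvesLinearHeat T a₂ r₂ u₂) (hnonneg : ∀ t ∈ Set.Icc 0 T, ∀ x, 0 ≤ u₂ t x)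
    (ha : ∀ t ∈ Set.Ioc 0 T, ∀ x, a₁ t x ≤ a₂ t x) (ha₂ : ∀ t ∈ Set.Ioc 0 T, ∀ x, a₂ t x ≤ b)
    (hr : ∀ t ∈ Set.Ioc 0 T, ∀ x, r₁ t x ≤ r₂ t x) (hinit : ∀ x, u₁ 0 x ≤ u₂ 0 x) (hc : 0 < c)
    (hgrowth : ∀ t ∈ Set.Icc 0 T, ∀ x, u₁ t x ≤ C * Real.exp (c * ‖x‖)) :
    ∀ t ∈ Set.Icc 0 T, ∀ x, u₁ t x ≤ u₂ t x := by
  have hsub := (hu₁.sub hu₂).nonpos (b := b) hc (fun t ht x hpos => ?_)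
    (fun x => sub_nonpos.2 (hinit x))
    fun t ht x => (sub_le_self _ (hnonneg t ht x)).trans (hgrowth t ht x)
  · exact fun t ht x => sub_nonpos.1 (hsub t ht x)
  · have forcing_nonpos : r₁ t x - r₂ t x + (a₁ t x - a₂ t x) * u₂ t x ≤ 0 :=
      add_nonpos (sub_nonpos.2 (hr t ht x)) (mul_nonpos_of_nonpos_of_nonneg
        (sub_nonpos.2 (ha t ht x)) (hnonneg t (Set.Ioc_subset_Icc_self ht) x))
    have potential_le : a₁ t x * (u₁ t x - u₂ t x) ≤ b * (u₁ t x - u₂ t x) :=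
      mul_le_mul_of_nonneg_right ((ha t ht x).trans (ha₂ t ht x)) hpos.le
    linarith

lemma SolvesLinearHeat.abs_le (hu₁ : SolvesLinearHeat T a₁ r₁ u₁)
    (hu₂ : SolvesLinearHeat T a₂ r₂ u₂) (hnonneg : ∀ t ∈ Set.Icc 0 T, ∀ x, 0 ≤ u₂ t x)
    (ha : ∀ t ∈ Set.Ioc 0 T, ∀ x, a₁ t x ≤ a₂ t x) (ha₂ : ∀ t ∈ Set.Ioc 0 T, ∀ x, a₂ t x ≤ b)
    (hr : ∀ t ∈ Set.Ioc 0 T, ∀ x, |r₁ t x| ≤ r₂ t x) (hinit : ∀ x, |u₁ 0 x| ≤ u₂ 0 x) (hc : 0 < c)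
    (hgrowth : ∀ t ∈ Set.Icc 0 T, ∀ x, |u₁ t x| ≤ C * Real.exp (c * ‖x‖)) :
    ∀ t ∈ Set.Icc 0 T, ∀ x, |u₁ t x| ≤ u₂ t x := fun t ht x =>
  abs_le'.2
    ⟨hu₁.le hu₂ hnonneg ha ha₂ (fun t ht x => (le_abs_self _).trans (hr t ht x))
      (fun x => (le_abs_self _).trans (hinit x)) hc
      (fun t ht x => (le_abs_self _).trans (hgrowth t ht x)) t ht x,
    hu₁.neg.le hu₂ hnonneg ha ha₂ (fun t ht x => (neg_le_abs _).trans (hr t ht x))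
      (fun x => (neg_le_abs _).trans (hinit x)) hc
      (fun t ht x => (neg_le_abs _).trans (hgrowth t ht x)) t ht x⟩

end LinearHeat

/-! ### Majorants -/

/-- The solution `((t+ε²)/ε²)^{κL}` of `E' = κ L (t+ε²)⁻¹ E`, `E(0) = 1`, which controls the
effect of a potential bounded from below by `-L/(t+ε²)`. -/
def growthFactor (κ L ε t : ℝ) : ℝ :=
  Real.exp (κ * L * (Real.log (t + ε ^ 2) - Real.log (ε ^ 2)))

section GrowthFactor

variable {κ L ε t : ℝ}

lemma growthFactor_pos (κ L ε t : ℝ) : 0 < growthFactor κ L ε t := Real.exp_pos _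

lemma growthFactor_zero (κ L ε : ℝ) : growthFactor κ L ε 0 = 1 := by simp [growthFactor]

lemma hasDerivAt_growthFactor (κ L : ℝ) (hε : 0 < ε) (ht : 0 ≤ t) :
    HasDerivAt (growthFactor κ L ε) (κ * (L / (t + ε ^ 2)) * growthFactor κ L ε t) t := by
  have hr : t + ε ^ 2 ≠ 0 := by positivity
  have hexponent : HasDerivAt (fun s => κ * L * (Real.log (s + ε ^ 2) - Real.log (ε ^ 2)))
      (κ * L * (1 / (t + ε ^ 2))) t :=
    ((((hasDerivAt_id t).add_const (ε ^ 2)).log hr).sub_const _).const_mul _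
  exact hexponent.exp.congr_deriv (by unfold growthFactor; ring)

lemma continuousOn_growthFactor (κ L : ℝ) (hε : 0 < ε) :
    ContinuousOn (growthFactor κ L ε) (Set.Ici 0) :=
  fun _ ht => (hasDerivAt_growthFactor κ L hε ht).continuousAt.continuousWithinAt

lemma growthFactor_eq_exp_integral (κ L : ℝ) (hε : 0 < ε) (ht : 0 ≤ t) :
    growthFactor κ L ε t = Real.exp (κ * L * ∫ s in (0 : ℝ)..t, 1 / (s + ε ^ 2)) := by
  have hpos (s : ℝ) (hs : s ∈ Set.uIcc 0 t) : 0 < s + ε ^ 2 := by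
    have : 0 ≤ s := (Set.uIcc_of_le ht ▸ hs).1
    positivity
  rw [growthFactor, intervalIntegral.integral_eq_sub_of_hasDerivAt
    (f := fun s => Real.log (s + ε ^ 2)) (f' := fun s => 1 / (s + ε ^ 2))
    (fun s hs => ((hasDerivAt_id s).add_const (ε ^ 2)).log (hpos s hs).ne')
    (continuousOn_const.div (by fun_prop) fun s hs => (hpos s hs).ne').intervalIntegrable, zero_add]

lemma growthFactor_le_exp (hε : 0 < ε) (hε₁ : ε < 1) (hL : 0 ≤ L) (ht : 0 ≤ t)
    (h : t + ε ^ 2 ≤ ε⁻¹) : growthFactor (1 / Real.log ε⁻¹) L ε t ≤ Real.exp (3 * L) := by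
  have hlog : 0 < Real.log ε⁻¹ := Real.log_pos ((one_lt_inv₀ hε).2 hε₁)
  have log_add_le : Real.log (t + ε ^ 2) ≤ Real.log ε⁻¹ := Real.log_le_log (by positivity) h
  have log_sq : Real.log (ε ^ 2) = -(2 * Real.log ε⁻¹) := by
    rw [Real.log_pow, Real.log_inv]
    push_cast
    ring
  refine Real.exp_le_exp.2 ?_
  calc 1 / Real.log ε⁻¹ * L * (Real.log (t + ε ^ 2) - Real.log (ε ^ 2))
      ≤ 1 / Real.log ε⁻¹ * L * (3 * Real.log ε⁻¹) := by
        gcongr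
        linarith
    _ = 3 * L * (Real.log ε⁻¹ / Real.log ε⁻¹) := by ring
    _ = 3 * L := by rw [div_self hlog.ne', mul_one]

lemma hasDerivAt_div_growthFactor {σ : ℝ → ℝ} {c : ℝ} (hε : 0 < ε) (ht : 0 ≤ t)
    (hσ : HasDerivAt σ (-κ * c * σ t) t) :
    HasDerivAt (fun s => σ s / growthFactor κ L ε s)
      (-(κ * (c + L / (t + ε ^ 2)) * (σ t / growthFactor κ L ε t))) t := by
  have hne := (growthFactor_pos κ L ε t).ne'
  refine (hσ.div (hasDerivAt_growthFactor κ L hε ht) hne).congr_deriv ?_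
  field_simp
  ring

lemma SolvesRate.le_growthFactor {a : ℝ → ℝ → ℝ} {σ : ℝ → ℝ} (hσ : SolvesRate a κ (Set.Ici 0) σ)
    (hκ : 0 ≤ κ) (hε : 0 < ε) (hpos : ∀ t, 0 < σ t)
    (ha : ∀ t ≥ 0, ∀ s, -(L / (t + ε ^ 2)) ≤ a t s) (ht : 0 ≤ t) :
    σ t ≤ growthFactor κ L ε t := by
  have hE := growthFactor_pos κ L ε
  have hder (s : ℝ) (hs : 0 < s) := hasDerivAt_div_growthFactor (L := L) hε hs.le (hσ.hasDerivAt hs)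
  have hanti : AntitoneOn (fun s => σ s / growthFactor κ L ε s) (Set.Ici 0) := by
    refine antitoneOn_of_hasDerivWithinAt_nonpos (convex_Ici 0)
      (hσ.continuousOn.div (continuousOn_growthFactor κ L hε) fun s _ => (hE s).ne')
      (fun s hs => (hder s (by simpa using hs)).hasDerivWithinAt) fun s hs => ?_
    have hs' : 0 < s := by simpa using hs
    have potential_nonneg : 0 ≤ a s (σ s) + L / (s + ε ^ 2) := by linarith [ha s hs'.le (σ s)]
    exact neg_nonpos.2 (mul_nonneg (mul_nonneg hκ potential_nonneg)
      (div_nonneg (hpos s).le (hE s).le))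
  have hle := hanti Set.self_mem_Ici ht ht
  simp only [hσ.initial, growthFactor_zero, div_one] at hle
  exact (div_le_one (hE t)).1 hle

end GrowthFactor

section Majorant

variable {T κ L ε : ℝ} {g : Plane → ℝ}

/-- The solution with initial datum `|g|` of the linear equation
`∂_t W = ½ Δ W + (m + κ L (t+ε²)⁻¹) W`. -/
def majorant (κ L ε m : ℝ) (g : Plane → ℝ) (t : ℝ) (x : Plane) : ℝ :=
  growthFactor κ L ε t * heatFlow m t (fun y => |g y|) x

lemma majorant_eq_mul_gaussAverage (κ L ε m : ℝ) (g : Plane → ℝ) {t : ℝ} (ht : 0 ≤ t)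
    (x : Plane) :
    majorant κ L ε m g t x = growthFactor κ L ε t * Real.exp (m * t) * gaussAverage t |g| x := by
  rw [majorant, heatFlow_eq_exp_mul_gaussAverage m ht, mul_assoc]
  rfl

lemma majorant_nonneg (κ L ε m : ℝ) (g : Plane → ℝ) {t : ℝ} (ht : 0 ≤ t) (x : Plane) :
    0 ≤ majorant κ L ε m g t x := by
  rw [majorant_eq_mul_gaussAverage κ L ε m g ht]
  exact mul_nonneg (mul_nonneg (growthFactor_pos κ L ε t).le (Real.exp_pos _).le)
    (gaussAverage_abs_nonneg t g x)

lemma majorant_zero (κ L ε m : ℝ) (g : Plane → ℝ) (x : Plane) : majorant κ L ε m g 0 x = |g x| := by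
  simp [majorant, growthFactor_zero, heatFlow]

lemma exists_majorant_le (κ L m : ℝ) (hε : 0 < ε) (T : ℝ) :
    ∃ M ≥ 0, ∀ t ∈ Set.Icc 0 T, ∀ (g : Plane → ℝ) (x : Plane),
      majorant κ L ε m g t x ≤ M * gaussAverage t |g| x := by
  have hcont : ContinuousOn (fun t => growthFactor κ L ε t * Real.exp (m * t)) (Set.Icc 0 T) :=
    ((continuousOn_growthFactor κ L hε).mono Set.Icc_subset_Ici_self).mul (by fun_prop)
  obtain ⟨M, hM⟩ := isCompact_Icc.exists_bound_of_continuousOn hcont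
  refine ⟨max M 0, le_max_right _ _, fun t ht g x => ?_⟩
  rw [majorant_eq_mul_gaussAverage κ L ε m g ht.1]
  exact mul_le_mul_of_nonneg_right ((le_abs_self _).trans ((hM t ht).trans (le_max_left _ _)))
    (gaussAverage_abs_nonneg t g x)

lemma TameFun.solvesLinearHeat_mul_majorant (hg : TameFun g) (κ L m : ℝ) (hε : 0 < ε)
    {φ φ' : ℝ → ℝ} (hφ : ∀ t, HasDerivAt φ (φ' t) t) :
    SolvesLinearHeat T (fun t _ => m + κ * (L / (t + ε ^ 2)))
      (fun t x => φ' t * majorant κ L ε m g t x) fun t x => φ t * majorant κ L ε m g t x where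
  continuousOn := by
    have hφ_cont : Continuous φ := continuous_iff_continuousAt.2 fun t => (hφ t).continuousAt
    refine ContinuousOn.mul (hφ_cont.comp continuous_fst).continuousOn (ContinuousOn.mul
      ((continuousOn_growthFactor κ L hε).comp continuousOn_fst fun p hp => hp.1.1)
      ((hg.abs.continuousOn_heatFlow m).mono (Set.prod_mono_left Set.Icc_subset_Ici_self)))
  contDiff t ht := contDiff_const.mul
    (contDiff_const.mul (contDiff_infty.1 (hg.abs.contDiff_heatFlow m ht.1) 2))
  hasDerivAt t ht x := by
    have hflow : ContDiff ℝ 2 (heatFlow m t fun y => |g y|) :=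
      contDiff_infty.1 (hg.abs.contDiff_heatFlow m ht.1) 2
    have hlap : (Δ fun x => φ t * majorant κ L ε m g t x) x =
        φ t * (growthFactor κ L ε t * (Δ (heatFlow m t fun y => |g y|)) x) := by
      simp only [majorant]
      rw [laplacian_const_mul (contDiff_const.mul hflow).contDiffAt,
        laplacian_const_mul hflow.contDiffAt]
    refine ((hφ t).mul ((hasDerivAt_growthFactor κ L hε ht.1.le).mul
      (hg.abs.hasDerivAt_heatFlow m ht.1 x))).congr_deriv ?_
    rw [hlap]
    simp only [majorant, Pi.mul_apply]
    ring

lemma SolvesLinearHeat.abs_le_mul_majorant {m : ℝ} {α r u : ℝ → Plane → ℝ}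
    (hu : SolvesLinearHeat T (fun t x => m - κ * α t x) r u) (hκ : 0 ≤ κ) (hL : 0 ≤ L) (hε : 0 < ε)
    (hg : TameFun g) {φ φ' : ℝ → ℝ} (hφ : ∀ t, HasDerivAt φ (φ' t) t) (hφ_nonneg : ∀ t, 0 ≤ φ t)
    (hα : ∀ t ∈ Set.Ioc 0 T, ∀ x, -(L / (t + ε ^ 2)) ≤ α t x)
    (hr : ∀ t ∈ Set.Ioc 0 T, ∀ x, |r t x| ≤ φ' t * majorant κ L ε m g t x)
    (hinit : ∀ x, |u 0 x| ≤ φ 0 * |g x|) (hgrowth : ExpGrowth u) :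
    ∀ t ∈ Set.Icc 0 T, ∀ x, |u t x| ≤ φ t * majorant κ L ε m g t x := by
  obtain ⟨c, hc, C, hC⟩ := hgrowth T
  refine hu.abs_le (hg.solvesLinearHeat_mul_majorant κ L m hε hφ)
    (fun t ht x => mul_nonneg (hφ_nonneg t) (majorant_nonneg κ L ε m g ht.1 x))
    (fun t ht x => ?_) (b := m + κ * (L / ε ^ 2)) (fun t ht _ => ?_) hr
    (fun x => by rw [majorant_zero]; exact hinit x) hc hC
  · linarith [mul_le_mul_of_nonneg_left (hα t ht x) hκ]
  · have := ht.1
    gcongr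
    linarith

end Majorant

/-! ### Regularity in space and time -/

lemma contDiffOn_succ_of_hasDerivAt {E : Type*} [NormedAddCommGroup E] [NormedSpace ℝ E] {n : ℕ}
    {s : Set ℝ} (hs : IsOpen s) {σ b : ℝ → E} (hσ : ∀ t ∈ s, HasDerivAt σ (b t) t)
    (hb : ContDiffOn ℝ n b s) : ContDiffOn ℝ (n + 1) σ s := by
  rw [contDiffOn_succ_iff_deriv_of_isOpen hs]
  exact ⟨fun t ht => (hσ t ht).differentiableAt.differentiableWithinAt, by simp,
    hb.congr fun t ht => (hσ t ht).deriv⟩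

section Space

variable {A B F : Type*} [NormedAddCommGroup A] [NormedSpace ℝ A] [NormedAddCommGroup B]
  [NormedSpace ℝ B] [NormedAddCommGroup F] [NormedSpace ℝ F] {h : A → B → F} {s : Set A}

lemma iteratedFDeriv_space_eq (hs : IsOpen s)
    (hh : ContDiffOn ℝ (⊤ : ℕ∞) (fun p : A × B => h p.1 p.2) (s ×ˢ Set.univ)) (n : ℕ) {t : A}
    (ht : t ∈ s) (x : B) :
    iteratedFDeriv ℝ n (h t) x =
      (iteratedFDeriv ℝ n (fun p : A × B => h p.1 p.2) (t, x)).compContinuousLinearMap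
        fun _ => ContinuousLinearMap.inr ℝ A B := by
  set H : A × B → F := fun p => h p.1 p.2
  set U : Set (A × B) := (fun p => p + (t, 0)) ⁻¹' (s ×ˢ Set.univ)
  have hU : IsOpen U := (hs.prod isOpen_univ).preimage (by fun_prop)
  have hmem (y : B) : ContinuousLinearMap.inr ℝ A B y ∈ U := by simpa [U] using ht
  have hpre : ContinuousLinearMap.inr ℝ A B ⁻¹' U = Set.univ := Set.eq_univ_of_forall hmem
  have hshift : ContDiffOn ℝ (⊤ : ℕ∞) (fun p => H (p + (t, 0))) U :=
    hh.comp (by fun_prop) fun p hp => hp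
  have hcomp := (ContinuousLinearMap.inr ℝ A B).iteratedFDerivWithin_comp_right (i := n) hshift
    hU.uniqueDiffOn (by rw [hpre]; exact uniqueDiffOn_univ) (hmem x) (by exact_mod_cast le_top)
  rw [hpre, iteratedFDerivWithin_univ, iteratedFDerivWithin_of_isOpen n hU (hmem x),
    iteratedFDeriv_comp_add_right] at hcomp
  simpa [H, Function.comp_def] using hcomp

lemma continuousOn_iteratedFDeriv_space (hs : IsOpen s)
    (hh : ContDiffOn ℝ (⊤ : ℕ∞) (fun p : A × B => h p.1 p.2) (s ×ˢ Set.univ)) (n : ℕ) :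
    ContinuousOn (fun p : A × B => iteratedFDeriv ℝ n (h p.1) p.2) (s ×ˢ Set.univ) := by
  have hopen : IsOpen (s ×ˢ (Set.univ : Set B)) := hs.prod isOpen_univ
  have hjoint : ContinuousOn (iteratedFDeriv ℝ n fun p : A × B => h p.1 p.2) (s ×ˢ Set.univ) :=
    (hh.continuousOn_iteratedFDerivWithin (by exact_mod_cast le_top) hopen.uniqueDiffOn).congr
      fun p hp => (iteratedFDerivWithin_of_isOpen n hopen hp).symm
  exact ((ContinuousMultilinearMap.compContinuousLinearMapL fun _ : Fin n =>
    ContinuousLinearMap.inr ℝ A B).continuous.comp_continuousOn hjoint).congr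
      fun p hp => iteratedFDeriv_space_eq hs hh n hp.1 p.2

end Space

lemma TameFun.isRegular_mul_heatFlow {g : Plane → ℝ} (hg : TameFun g) (m : ℝ) {σ : ℝ → ℝ}
    (hσ : ContinuousOn σ (Set.Ici 0)) (hσ_smooth : ContDiffOn ℝ 1 σ (Set.Ioi 0)) :
    IsRegular fun t x => σ t * heatFlow m t g x where
  continuousOn := (hσ.comp continuousOn_fst fun p hp => hp.1).mul (hg.continuousOn_heatFlow m)
  contDiffOn_one := (hσ_smooth.comp contDiffOn_fst fun p hp => hp.1).mul
    ((hg.contDiffOn_heatFlow m).of_le (by exact_mod_cast le_top))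
  contDiff_space t ht := contDiff_const.mul (hg.contDiff_heatFlow m ht)
  continuousOn_space n := by
    have hσ_fst : ContinuousOn (fun p : ℝ × Plane => σ p.1) (Set.Ioi 0 ×ˢ Set.univ) :=
      (hσ.mono Set.Ioi_subset_Ici_self).comp continuousOn_fst fun p hp => hp.1
    refine (hσ_fst.smul (continuousOn_iteratedFDeriv_space (h := fun t => heatFlow m t g) isOpen_Ioi
      (hg.contDiffOn_heatFlow m) n)).congr fun p hp => ?_
    exact iteratedFDeriv_const_smul_apply' (a := σ p.1)
      ((hg.contDiff_heatFlow m hp.1).of_le (by exact_mod_cast le_top)).contDiffAt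

lemma IsRegular.hasDerivAt {w : ℝ → Plane → ℝ} (hw : IsRegular w) {t : ℝ} (ht : 0 < t)
    (x : Plane) : HasDerivAt (fun s => w s x) (deriv (fun s => w s x) t) t := by
  have hjoint : DifferentiableAt ℝ (fun p : ℝ × Plane => w p.1 p.2) (t, x) :=
    (hw.contDiffOn_one.differentiableOn one_ne_zero).differentiableAt
      ((isOpen_Ioi.prod isOpen_univ).mem_nhds ⟨ht, Set.mem_univ _⟩)
  have hline : DifferentiableAt ℝ (fun s : ℝ => (s, x)) t := by fun_prop
  exact (hjoint.comp t hline).hasDerivAt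

/-! ### Uniqueness for the McKean–Vlasov equation -/

lemma one_div_log_inv_nonneg {ε : ℝ} (hε : 0 < ε) (hε₁ : ε < 1) : 0 ≤ 1 / Real.log ε⁻¹ :=
  one_div_nonneg.2 (Real.log_nonneg ((one_le_inv₀ hε).2 hε₁.le))

lemma forall_nonpos_of_halving {α : Type*} {S : Set α} {δ W : α → ℝ} {N₀ : ℝ} (hN₀ : 0 ≤ N₀)
    (hbound : ∀ p ∈ S, δ p ≤ N₀ * W p)
    (hhalf : ∀ N ≥ 0, (∀ p ∈ S, δ p ≤ N * W p) → ∀ p ∈ S, δ p ≤ N / 2 * W p) :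
    ∀ p ∈ S, δ p ≤ 0 := by
  have hgeom (k : ℕ) : ∀ p ∈ S, δ p ≤ N₀ / 2 ^ k * W p := by
    induction k with
    | zero => simpa using hbound
    | succ k ih => simpa only [div_div, ← pow_succ] using hhalf _ (by positivity) ih
  intro p hp
  have hlim : Filter.Tendsto (fun k : ℕ => N₀ / 2 ^ k * W p) Filter.atTop (nhds 0) := by
    simpa [div_eq_mul_inv] using ((tendsto_inv_atTop_zero.comp
      (tendsto_pow_atTop_atTop_of_one_lt one_lt_two)).const_mul N₀).mul_const (W p)
  exact ge_of_tendsto' hlim fun k => hgeom k p hp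

lemma ExpGrowth.sub {g h : ℝ → Plane → ℝ} (hg : ExpGrowth g) (hh : ExpGrowth h) :
    ExpGrowth fun t x => g t x - h t x := by
  intro T
  obtain ⟨a, ha, A, hA⟩ := hg T
  obtain ⟨b, -, B, hB⟩ := hh T
  refine ⟨max a b, lt_max_of_lt_left ha, |A| + |B|, fun t ht x => ?_⟩
  calc |g t x - h t x| ≤ |g t x| + |h t x| := abs_sub _ _
    _ ≤ A * Real.exp (a * ‖x‖) + B * Real.exp (b * ‖x‖) := add_le_add (hA t ht x) (hB t ht x)
    _ ≤ |A| * Real.exp (max a b * ‖x‖) + |B| * Real.exp (max a b * ‖x‖) := by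
      gcongr
      exacts [le_abs_self A, le_max_left a b, le_abs_self B, le_max_right a b]
    _ = _ := (add_mul _ _ _).symm

lemma PolyLip.abs_sub_apply_le_of_le {C M A ρ y z : ℝ} {n : ℕ} {D : ℝ → ℝ} (hD : PolyLip C n D)
    (hC : 0 ≤ C) (hM : 0 ≤ M) (hA : 0 ≤ A) (hρ : 0 ≤ ρ) (hy : |y| ≤ M * A) (hz : |z| ≤ M * A)
    (hyz : |y - z| ≤ ρ * (M * A)) :
    |D y - D z| ≤ ρ * (C * (1 + 2 * M) ^ n * M) * (1 + A) ^ (n + 1) := by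
  have hsum : 1 + |y| + |z| ≤ (1 + 2 * M) * (1 + A) := by nlinarith
  have hdiff : |y - z| ≤ ρ * (M * (1 + A)) := hyz.trans (by gcongr; linarith)
  calc |D y - D z| ≤ C * (1 + |y| + |z|) ^ n * |y - z| := hD.abs_sub_apply_le y z
    _ ≤ C * ((1 + 2 * M) * (1 + A)) ^ n * (ρ * (M * (1 + A))) := by gcongr
    _ = _ := by rw [mul_pow, pow_succ]; ring

section Uniqueness

variable {Ω : Type*} [MeasurableSpace Ω] {P : Measure Ω} {m ε : ℝ} {f : ℝ → ℝ → ℝ}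
  {X : Ω → Plane → ℝ} {w w' : Ω → ℝ → Plane → ℝ}

/-- The coefficient `E[f'(t+ε², w(t,x))]` of the McKean–Vlasov equation. -/
def meanCoeff (P : Measure Ω) (ε : ℝ) (f : ℝ → ℝ → ℝ) (w : Ω → ℝ → Plane → ℝ) (t : ℝ)
    (x : Plane) : ℝ :=
  ∫ ω, deriv (f (t + ε ^ 2)) (w ω t x) ∂P

lemma IsSolution.ae_solvesLinearHeat (hw : IsSolution P m ε f X w) (T : ℝ) :
    ∀ᵐ ω ∂P, SolvesLinearHeat T (fun t x => m - 1 / Real.log ε⁻¹ * meanCoeff P ε f w t x)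
      (fun _ _ => 0) (w ω) := by
  filter_upwards [hw.regular, hw.equation] with ω hreg heq
  exact {
    continuousOn := hreg.continuousOn.mono (Set.prod_mono_left Set.Icc_subset_Ici_self)
    contDiff := fun t ht => contDiff_infty.1 (hreg.contDiff_space t ht.1) 2
    hasDerivAt := fun t ht x => (hreg.hasDerivAt ht.1 x).congr_deriv <| by
      simp only [heq t ht.1 x, meanCoeff]
      ring }

variable [IsProbabilityMeasure P]

lemma IsTameField.abs_integral_sub_le {v : NNReal} (hX : IsTameField P v X) {C M ρ : ℝ}
    (hC : 0 ≤ C) (hM : 0 ≤ M) (hρ : 0 ≤ ρ) {n : ℕ} {D : ℝ → ℝ} (hD : PolyLip C n D) {t : ℝ}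
    {x : Plane} {Y Z : Ω → ℝ} (hY : ∀ᵐ ω ∂P, |Y ω| ≤ M * gaussAverage t |X ω| x)
    (hZ : ∀ᵐ ω ∂P, |Z ω| ≤ M * gaussAverage t |X ω| x)
    (hYZ : ∀ᵐ ω ∂P, |Y ω - Z ω| ≤ ρ * (M * gaussAverage t |X ω| x))
    (hDY : Integrable (fun ω => D (Y ω)) P) (hDZ : Integrable (fun ω => D (Z ω)) P) :
    |∫ ω, D (Y ω) ∂P - ∫ ω, D (Z ω) ∂P|
      ≤ ρ * (C * (1 + 2 * M) ^ n * M) * gaussMoment v (n + 1) := by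
  rw [← integral_sub hDY hDZ, ← Real.norm_eq_abs]
  refine (norm_integral_le_of_norm_le ((hX.integrable_gaussAverage_pow t x (n + 1)).const_mul
    (ρ * (C * (1 + 2 * M) ^ n * M))) ?_).trans ?_
  · filter_upwards [hY, hZ, hYZ] with ω hYω hZω hYZω
    exact hD.abs_sub_apply_le_of_le hC hM (gaussAverage_abs_nonneg t (X ω) x) hρ hYω hZω hYZω
  · rw [integral_const_mul]
    exact mul_le_mul_of_nonneg_left (hX.integral_gaussAverage_pow_le t x (n + 1)) (by positivity)

lemma IsSolution.neg_div_le_meanCoeff (hw : IsSolution P m ε f X w) (hε : 0 < ε) {L : ℝ}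
    (hL : ∀ r > 0, ∀ u, -(L / r) ≤ deriv (f r) u) {t : ℝ} (ht : 0 ≤ t) (x : Plane) :
    -(L / (t + ε ^ 2)) ≤ meanCoeff P ε f w t x := by
  simpa [meanCoeff] using integral_mono (integrable_const (-(L / (t + ε ^ 2))))
    (hw.integrable t ht x) fun ω => hL _ (by positivity) _

variable {v : NNReal} {L : ℝ}

lemma IsSolution.ae_abs_le_majorant (hw : IsSolution P m ε f X w) (hX : IsTameField P v X)
    (hε : 0 < ε) (hε₁ : ε < 1) (hL₀ : 0 ≤ L) (hL : ∀ r > 0, ∀ u, -(L / r) ≤ deriv (f r) u)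
    (T : ℝ) :
    ∀ᵐ ω ∂P, ∀ t ∈ Set.Icc 0 T, ∀ x,
      |w ω t x| ≤ majorant (1 / Real.log ε⁻¹) L ε m (X ω) t x := by
  filter_upwards [hw.ae_solvesLinearHeat T, hw.initial, hw.growth] with ω heq hinit hgrowth
  simpa using heq.abs_le_mul_majorant (one_div_log_inv_nonneg hε hε₁) hL₀ hε (hX.tame ω)
    (fun t => hasDerivAt_const t (1 : ℝ)) (fun _ => zero_le_one)
    (fun t ht x => hw.neg_div_le_meanCoeff hε hL ht.1.le x) (by simp) (by simp [hinit]) hgrowth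

lemma IsSolution.ae_abs_sub_le (hw : IsSolution P m ε f X w) (hw' : IsSolution P m ε f X w')
    (hX : IsTameField P v X) (hε : 0 < ε) (hε₁ : ε < 1) (hL₀ : 0 ≤ L)
    (hL : ∀ r > 0, ∀ u, -(L / r) ≤ deriv (f r) u) {T N b : ℝ} (hN : 0 ≤ N) (hb : 0 < b)
    (hclose : ∀ t ∈ Set.Icc 0 T, ∀ x,
      |meanCoeff P ε f w t x - meanCoeff P ε f w' t x| ≤ N * Real.exp (b * t)) :
    ∀ᵐ ω ∂P, ∀ t ∈ Set.Icc 0 T, ∀ x, |w ω t x - w' ω t x|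
      ≤ 1 / Real.log ε⁻¹ * N / b * Real.exp (b * t)
        * majorant (1 / Real.log ε⁻¹) L ε m (X ω) t x := by
  have hκ := one_div_log_inv_nonneg hε hε₁
  set κ := 1 / Real.log ε⁻¹
  have hφ (t : ℝ) : HasDerivAt (fun t => κ * N / b * Real.exp (b * t))
      (κ * N * Real.exp (b * t)) t :=
    (((hasDerivAt_id t).const_mul b).exp.const_mul (κ * N / b)).congr_deriv (by
      simp only [id]
      field_simp)
  filter_upwards [hw.ae_solvesLinearHeat T, hw'.ae_solvesLinearHeat T, hw.initial, hw'.initial,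
    hw.growth, hw'.growth, hw'.ae_abs_le_majorant hX hε hε₁ hL₀ hL T]
    with ω heq heq' hinit hinit' hgrowth hgrowth' hmaj
  refine (heq.sub heq').abs_le_mul_majorant hκ hL₀ hε (hX.tame ω) hφ (fun t => by positivity)
    (fun t ht x => hw.neg_div_le_meanCoeff hε hL ht.1.le x) (fun t ht x => ?_) (fun x => ?_)
    (hgrowth.sub hgrowth')
  · have ht' := Set.Ioc_subset_Icc_self ht
    calc |0 - 0 + (m - κ * meanCoeff P ε f w t x - (m - κ * meanCoeff P ε f w' t x)) * w' ω t x|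
        = κ * |meanCoeff P ε f w t x - meanCoeff P ε f w' t x| * |w' ω t x| := by
          rw [← abs_of_nonneg hκ, ← abs_mul, ← abs_mul, abs_of_nonneg hκ, ← abs_neg]
          ring_nf
      _ ≤ κ * (N * Real.exp (b * t)) * majorant κ L ε m (X ω) t x :=
          mul_le_mul (mul_le_mul_of_nonneg_left (hclose t ht' x) hκ) (hmaj t ht' x)
            (abs_nonneg _) (by positivity)
      _ = _ := by ring
  · rw [hinit x, hinit' x, sub_self, abs_zero]
    positivity

lemma IsSolution.exists_abs_meanCoeff_sub_le (hw : IsSolution P m ε f X w)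
    (hw' : IsSolution P m ε f X w') (hX : IsTameField P v X) (hε : 0 < ε) (hε₁ : ε < 1)
    (hL₀ : 0 ≤ L) (hL : ∀ r > 0, ∀ u, -(L / r) ≤ deriv (f r) u) {n : ℕ}
    (hD : TameCoeff n fun r => deriv (f r)) (T : ℝ) :
    ∃ K ≥ 0, ∀ ρ ≥ 0, ∀ t ∈ Set.Icc 0 T, ∀ x,
      (∀ᵐ ω ∂P, |w ω t x - w' ω t x| ≤ ρ * majorant (1 / Real.log ε⁻¹) L ε m (X ω) t x) →
        |meanCoeff P ε f w t x - meanCoeff P ε f w' t x| ≤ ρ * K := by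
  obtain ⟨C, hC, hlip⟩ := hD.polyLip (ε ^ 2) (by positivity) (T + ε ^ 2)
  obtain ⟨M, hM, hmaj⟩ := exists_majorant_le (1 / Real.log ε⁻¹) L m hε T
  have ae_le {u : Ω → ℝ → Plane → ℝ} (hu : IsSolution P m ε f X u) {t : ℝ}
      (ht : t ∈ Set.Icc 0 T) (x : Plane) : ∀ᵐ ω ∂P, |u ω t x| ≤ M * gaussAverage t |X ω| x := by
    filter_upwards [hu.ae_abs_le_majorant hX hε hε₁ hL₀ hL T] with ω h
    exact (h t ht x).trans (hmaj t ht (X ω) x)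
  refine ⟨C * (1 + 2 * M) ^ n * M * gaussMoment v (n + 1),
    mul_nonneg (by positivity) (gaussMoment_nonneg v _), fun ρ hρ t ht x hsub => ?_⟩
  rw [← mul_assoc]
  refine hX.abs_integral_sub_le hC hM hρ (hlip (t + ε ^ 2) ⟨by linarith [ht.1], by linarith [ht.2]⟩)
    (ae_le hw ht x) (ae_le hw' ht x) ?_ (hw.integrable t ht.1 x) (hw'.integrable t ht.1 x)
  filter_upwards [hsub] with ω h
  exact h.trans (mul_le_mul_of_nonneg_left (hmaj t ht (X ω) x) hρ)

lemma IsSolution.meanCoeff_eq (hw : IsSolution P m ε f X w) (hw' : IsSolution P m ε f X w')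
    (hX : IsTameField P v X) (hε : 0 < ε) (hε₁ : ε < 1) (hf : MemSbar f) {t : ℝ} (ht : 0 ≤ t)
    (x : Plane) : meanCoeff P ε f w t x = meanCoeff P ε f w' t x := by
  obtain ⟨n, hD⟩ := hf.exists_tameCoeff
  obtain ⟨L, hL₀, hL⟩ := hf.exists_neg_div_le_deriv
  obtain ⟨K, hK, hdiff⟩ := hw.exists_abs_meanCoeff_sub_le hw' hX hε hε₁ hL₀ hL hD t
  have hκ := one_div_log_inv_nonneg hε hε₁
  set κ := 1 / Real.log ε⁻¹
  -- With the weight `e^{bt}`, replacing one coefficient by the other is a contraction by `κK/b`.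
  set b := 2 * κ * K + 1
  have hb : 0 < b := by positivity
  have contraction : κ * K / b ≤ 1 / 2 := (div_le_iff₀ hb).2 (by simp only [b]; linarith)
  refine sub_eq_zero.1 (abs_nonpos_iff.1 (forall_nonpos_of_halving (S := Set.Icc 0 t ×ˢ Set.univ)
    (δ := fun p => |meanCoeff P ε f w p.1 p.2 - meanCoeff P ε f w' p.1 p.2|)
    (W := fun p => Real.exp (b * p.1)) (N₀ := 2 * K) (by positivity) ?_ ?_ (t, x)
    ⟨Set.right_mem_Icc.2 ht, Set.mem_univ x⟩))
  · rintro ⟨s, y⟩ ⟨hs, -⟩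
    refine (hdiff 2 zero_le_two s hs y ?_).trans
      (le_mul_of_one_le_right (by positivity) (Real.one_le_exp (mul_nonneg hb.le hs.1)))
    filter_upwards [hw.ae_abs_le_majorant hX hε hε₁ hL₀ hL t,
      hw'.ae_abs_le_majorant hX hε hε₁ hL₀ hL t] with ω hmaj hmaj'
    linarith [abs_sub (w ω s y) (w' ω s y), hmaj s hs y, hmaj' s hs y]
  · rintro N hN hclose ⟨s, y⟩ ⟨hs, -⟩
    have hsub := hw.ae_abs_sub_le hw' hX hε hε₁ hL₀ hL hN hb
      fun r hr z => hclose (r, z) ⟨hr, Set.mem_univ z⟩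
    calc |meanCoeff P ε f w s y - meanCoeff P ε f w' s y|
        ≤ κ * N / b * Real.exp (b * s) * K :=
          hdiff _ (by positivity) s hs y (hsub.mono fun ω h => h s hs y)
      _ = κ * K / b * (N * Real.exp (b * s)) := by ring
      _ ≤ 1 / 2 * (N * Real.exp (b * s)) := by gcongr
      _ = N / 2 * Real.exp (b * s) := by ring

theorem IsSolution.ae_eq (hw : IsSolution P m ε f X w) (hw' : IsSolution P m ε f X w')
    (hX : IsTameField P v X) (hε : 0 < ε) (hε₁ : ε < 1) (hf : MemSbar f) :
    ∀ᵐ ω ∂P, ∀ t ≥ 0, ∀ x, w ω t x = w' ω t x := by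
  obtain ⟨L, hL₀, hL⟩ := hf.exists_neg_div_le_deriv
  have hsub (k : ℕ) := hw.ae_abs_sub_le (T := k) hw' hX hε hε₁ hL₀ hL le_rfl one_pos
    fun t ht x => by simp [hw.meanCoeff_eq hw' hX hε hε₁ hf ht.1 x]
  filter_upwards [ae_all_iff.2 hsub] with ω h t ht x
  obtain ⟨k, hk⟩ := exists_nat_ge t
  have hle := h k t ⟨ht, hk⟩ x
  rw [mul_zero, zero_div, zero_mul, zero_mul] at hle
  exact sub_eq_zero.1 (abs_nonpos_iff.1 hle)

end Uniqueness

/-! ### The explicit solution -/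

lemma IsRate.contDiffOn_one {a : ℝ → ℝ → ℝ} (ha : IsRate a) {κ : ℝ} {σ : ℝ → ℝ}
    (hσ : SolvesRate a κ (Set.Ici 0) σ) : ContDiffOn ℝ 1 σ (Set.Ioi 0) := by
  have hrate : ContinuousOn (fun t => a t (σ t)) (Set.Ici 0) :=
    ha.continuousOn.comp (f := fun t => (t, σ t)) (continuousOn_id.prodMk hσ.continuousOn)
      fun _ ht => ⟨ht, Set.mem_univ _⟩
  have hderiv : ContinuousOn (fun t => -κ * a t (σ t) * σ t) (Set.Ici 0) :=
    (continuousOn_const.mul hrate).mul hσ.continuousOn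
  simpa using contDiffOn_succ_of_hasDerivAt (n := 0) isOpen_Ioi (fun t ht => hσ.hasDerivAt ht)
    (contDiffOn_zero.2 (hderiv.mono Set.Ioi_subset_Ici_self))

lemma ExpGrowth.mul_of_bounded {φ : ℝ → ℝ} {g : ℝ → Plane → ℝ} (hg : ExpGrowth g)
    (hφ : ∀ T, ∃ S, ∀ t ∈ Set.Icc 0 T, |φ t| ≤ S) : ExpGrowth fun t x => φ t * g t x := by
  intro T
  obtain ⟨S, hS⟩ := hφ T
  obtain ⟨c, hc, C, hC⟩ := hg T
  refine ⟨c, hc, |S| * C, fun t ht x => ?_⟩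
  rw [abs_mul, mul_assoc]
  exact mul_le_mul ((hS t ht).trans (le_abs_self S)) (hC t ht x) (abs_nonneg _) (abs_nonneg _)

lemma TameCoeff.abs {n : ℕ} {D : ℝ → ℝ → ℝ} (hD : TameCoeff n D) :
    TameCoeff n fun r u => |D r u| where
  continuousOn := hD.continuousOn.abs
  polyLip r₀ hr₀ R := by
    obtain ⟨C, hC, hpoly⟩ := hD.polyLip r₀ hr₀ R
    exact ⟨C, hC, fun r hr =>
      { abs_apply_le := fun u => (abs_abs (D r u)).trans_le ((hpoly r hr).abs_apply_le u)
        abs_sub_apply_le := fun u u' =>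
          (abs_abs_sub_abs_le _ _).trans ((hpoly r hr).abs_sub_apply_le u u') }⟩

lemma exists_solvesRate_gaussRate {f : ℝ → ℝ → ℝ} (hf : MemSbar f) (m : ℝ) {ε κ : ℝ} (hε : 0 < ε)
    (hκ : 0 ≤ κ) : ∃ σ, (∀ t, 0 < σ t) ∧
      SolvesRate (gaussRate (fun r => deriv (f r)) m ε) κ (Set.Ici 0) σ := by
  obtain ⟨n, hD⟩ := hf.exists_tameCoeff
  obtain ⟨L, hL₀, hL⟩ := hf.exists_neg_div_le_deriv
  refine (hD.isRate_gaussRate m hε).exists_solvesRate hκ (B := L / ε ^ 2) (by positivity)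
    fun t ht s => le_trans (neg_le_neg ?_) (hD.neg_div_le_gaussRate m hε hL ht s)
  exact div_le_div_of_nonneg_left hL₀ (by positivity) (by linarith)

lemma SolvesRate.le_exp_integral {f f₁ f₂ : ℝ → ℝ → ℝ} {m ε L₁ L₂ γ₁ γ₂ l₁ l₂ : ℝ} {σ : ℝ → ℝ}
    (hσ : SolvesRate (gaussRate (fun r => deriv (f r)) m ε) (1 / Real.log ε⁻¹) (Set.Ici 0) σ)
    (hf : MemSbar f) (hε : 0 < ε) (hε₁ : ε < 1) (hpos : ∀ t, 0 < σ t) (hf₁ : MemSbar₁ L₁ L₂ f₁)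
    (hf₂ : MemSbar₂ γ₁ γ₂ l₁ l₂ f₂) (hsum : ∀ t > 0, ∀ u, f t u = f₁ t u + f₂ t u) {t : ℝ}
    (ht : 0 ≤ t) :
    σ t ≤ Real.exp (L₁ / Real.log ε⁻¹ * ∫ s in (0 : ℝ)..t, 1 / (s + ε ^ 2)) ∧
      (t + ε ^ 2 ≤ ε⁻¹ → σ t ≤ Real.exp (3 * L₁)) := by
  obtain ⟨n, hD⟩ := hf.exists_tameCoeff
  have hle := hσ.le_growthFactor (one_div_log_inv_nonneg hε hε₁) hε hpos
    (fun s hs => hD.neg_div_le_gaussRate m hε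
      (fun r hr u => neg_div_le_deriv hf₁ hf₂ hsum hr u) hs) ht
  refine ⟨hle.trans_eq ?_, fun h => hle.trans (growthFactor_le_exp hε hε₁ hf₁.L₁_nonneg ht h)⟩
  rw [growthFactor_eq_exp_integral _ _ hε ht, one_div_mul_eq_div]

section Existence

variable {Ω : Type*} [MeasurableSpace Ω] {P : Measure Ω} [IsProbabilityMeasure P]
  {η : Ω → 𝓢(Plane, ℝ) →L[ℝ] ℝ}

lemma IsWhiteNoise.solvesODE_iff (hη : IsWhiteNoise P η) (m : ℝ) {ε : ℝ} (hε : 0 < ε) {n : ℕ}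
    {f : ℝ → ℝ → ℝ} (hD : TameCoeff n fun r => deriv (f r)) (x : Plane) {I : Set ℝ}
    (hI : I ⊆ Set.Ici 0) (τ : ℝ → ℝ) :
    SolvesODE P m ε f (fun ω => mollify ε hε (η ω)) x I τ ↔
      SolvesRate (gaussRate (fun r => deriv (f r)) m ε) (1 / Real.log ε⁻¹) I τ := by
  have hmean (t : ℝ) (ht : t ∈ I) := hη.integral_coeff hε m hD (hI ht) (τ t) x
  constructor
  · rintro ⟨hinit, hderiv⟩
    exact ⟨hinit, fun t ht => hmean t ht ▸ hderiv t ht⟩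
  · rintro ⟨hinit, hderiv⟩
    exact ⟨hinit, fun t ht => (hmean t ht).symm ▸ hderiv t ht⟩

lemma isSolution_mul_heatFlow (hη : IsWhiteNoise P η) (m : ℝ) {ε : ℝ} (hε : 0 < ε) {n : ℕ}
    {f : ℝ → ℝ → ℝ} (hD : TameCoeff n fun r => deriv (f r)) {σ : ℝ → ℝ}
    (hσ : SolvesRate (gaussRate (fun r => deriv (f r)) m ε) (1 / Real.log ε⁻¹) (Set.Ici 0) σ) :
    IsSolution P m ε f (fun ω => mollify ε hε (η ω))
      (fun ω t x => σ t * heatFlow m t (mollify ε hε (η ω)) x) where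
  aemeasurable t ht x := (hη.hasLaw_heatFlow hε m ht x).aemeasurable.const_mul _
  regular := ae_of_all _ fun ω => (tameFun_mollify ε hε (η ω)).isRegular_mul_heatFlow m
    hσ.continuousOn ((hD.isRate_gaussRate m hε).contDiffOn_one hσ)
  initial := ae_of_all _ fun ω x => by simp [hσ.initial, heatFlow]
  integrable t ht x := hη.integrable_coeff hε m hD ht (σ t) x
  equation := ae_of_all _ fun ω t ht x => by
    have hg := tameFun_mollify ε hε (η ω)
    refine ((hσ.hasDerivAt ht).mul (hg.hasDerivAt_heatFlow m ht x)).deriv.trans ?_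
    rw [laplacian_const_mul (contDiff_infty.1 (hg.contDiff_heatFlow m ht) 2).contDiffAt,
      hη.integral_coeff hε m hD ht.le (σ t) x]
    ring
  growth := ae_of_all _ fun ω =>
    ((tameFun_mollify ε hε (η ω)).expGrowth_heatFlow m).mul_of_bounded hσ.exists_abs_le
  growth_coeff T := by
    obtain ⟨S, hS⟩ := hσ.exists_abs_le T
    obtain ⟨A, hA, hbound⟩ := (hD.abs.isRate_gaussRate m hε).exists_abs_le T S
    refine ⟨1, one_pos, A, fun t ht x => ?_⟩
    beta_reduce
    rw [hη.integral_coeff hε m hD.abs ht.1 (σ t) x]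
    exact (hbound t ht (σ t) (hS t ht)).trans
      (le_mul_of_one_le_right hA (Real.one_le_exp (by positivity)))

end Existence

section SelfSimilar

variable {f : ℝ → ℝ → ℝ} {F : ℝ → ℝ} {m ε κ : ℝ} {σ : ℝ → ℝ}

lemma SolvesRate.contDiffOn_of_selfSimilar
    (hσ : SolvesRate (gaussRate (fun r => deriv (f r)) m ε) κ (Set.Ici 0) σ) (hf : MemSbar f)
    (hF : ∀ t > 0, ∀ u, f t u = t ^ (-(3 / 2) : ℝ) * F (√t * u)) (hpos : ∀ t, 0 < σ t) :
    ContDiffOn ℝ (⊤ : ℕ∞) σ (Set.Ioi 0) := by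
  obtain ⟨A, hA, hrate⟩ := exists_gaussRate_of_selfSimilar hf m ε hF
  have hr (t : ℝ) (ht : t ∈ Set.Ioi 0) : 0 < t + ε ^ 2 := add_pos_of_pos_of_nonneg ht (sq_nonneg ε)
  rw [contDiffOn_infty]
  -- Bootstrap: the equation makes `σ` one derivative smoother than its right-hand side.
  intro n
  induction n with
  | zero => exact contDiffOn_zero.2 (hσ.continuousOn.mono Set.Ioi_subset_Ici_self)
  | succ n ih =>
    have hA_comp : ContDiffOn ℝ n
        (fun t => A (Real.exp (m * t) * √(1 / (4 * Real.pi)) * σ t)) (Set.Ioi 0) :=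
      (contDiffOn_infty.1 hA n).comp (ContDiffOn.mul (by fun_prop) ih) fun t _ =>
        Set.mem_Ioi.2 (mul_pos (by positivity) (hpos t))
    have hinv : ContDiffOn ℝ n (fun t : ℝ => (t + ε ^ 2)⁻¹) (Set.Ioi 0) :=
      ContDiffOn.inv (by fun_prop) fun t ht => (hr t ht).ne'
    refine contDiffOn_succ_of_hasDerivAt isOpen_Ioi (fun t ht => hσ.hasDerivAt ht)
      (((contDiffOn_const (c := -κ)).mul (hinv.mul hA_comp)).mul ih |>.congr fun t ht => ?_)
    rw [hrate t (hr t ht)]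

lemma SolvesRate.contDiffOn_mul_heatFlow_of_selfSimilar
    (hσ : SolvesRate (gaussRate (fun r => deriv (f r)) m ε) κ (Set.Ici 0) σ) (hf : MemSbar f)
    (hF : ∀ t > 0, ∀ u, f t u = t ^ (-(3 / 2) : ℝ) * F (√t * u)) (hpos : ∀ t, 0 < σ t)
    {g : Plane → ℝ} (hg : TameFun g) :
    ContDiffOn ℝ (⊤ : ℕ∞) (fun p : ℝ × Plane => σ p.1 * heatFlow m p.1 g p.2)
      (Set.Ioi 0 ×ˢ Set.univ) :=
  ((hσ.contDiffOn_of_selfSimilar hf hF hpos).comp contDiffOn_fst fun _ hp => hp.1).mul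
    (hg.contDiffOn_heatFlow m)

end SelfSimilar

end McKeanVlasov

end

open McKeanVlasov in
theorem lemma2p3 {Ω : Type*} [MeasurableSpace Ω] (P : Measure Ω) [IsProbabilityMeasure P]
    (η : Ω → 𝓢(Plane, ℝ) →L[ℝ] ℝ) (hη : IsWhiteNoise P η)
    (m ε : ℝ) (hε : 0 < ε) (hε₁ : ε < 1) (f : ℝ → ℝ → ℝ) (hf : MemSbar f) :
    -- the expectation in the ordinary differential equation makes sense
    (∀ t ≥ 0, ∀ (s : ℝ) (x : Plane), Integrable
      (fun ω => deriv (f (t + ε ^ 2)) (s * heatFlow m t (mollify ε hε (η ω)) x)) P) ∧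
    ∃ σ : ℝ → ℝ,
      -- `σ` is a global solution, whatever the point `x` in the equation
      (∀ x, SolvesODE P m ε f (fun ω => mollify ε hε (η ω)) x (Set.Ici 0) σ) ∧
      -- it is the only one, also among solutions on bounded time intervals
      (∀ (x : Plane) (T : ℝ) (τ : ℝ → ℝ),
        SolvesODE P m ε f (fun ω => mollify ε hε (η ω)) x (Set.Icc 0 T) τ →
          Set.EqOn τ σ (Set.Icc 0 T)) ∧
      -- bounds
      (∀ t ≥ 0, 0 < σ t) ∧
      (∀ (L₁ L₂ γ₁ γ₂ l₁ l₂ : ℝ) (f₁ f₂ : ℝ → ℝ → ℝ),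
        MemSbar₁ L₁ L₂ f₁ → MemSbar₂ γ₁ γ₂ l₁ l₂ f₂ →
        (∀ t > 0, ∀ u, f t u = f₁ t u + f₂ t u) →
        ∀ t ≥ 0, σ t ≤ Real.exp (L₁ / Real.log ε⁻¹ * ∫ s in (0 : ℝ)..t, 1 / (s + ε ^ 2)) ∧
          (t + ε ^ 2 ≤ ε⁻¹ → σ t ≤ Real.exp (3 * L₁))) ∧
      -- `σ(t) (G^m_t * η_ε)(x)` solves the McKean–Vlasov equation
      IsSolution P m ε f (fun ω => mollify ε hε (η ω))
        (fun ω t x => σ t * heatFlow m t (mollify ε hε (η ω)) x) ∧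
      -- and it is the only solution
      (∀ w : Ω → ℝ → Plane → ℝ, IsSolution P m ε f (fun ω => mollify ε hε (η ω)) w →
        ∀ᵐ ω ∂P, ∀ t ≥ 0, ∀ x, w ω t x = σ t * heatFlow m t (mollify ε hε (η ω)) x) ∧
      -- in the self-similar case it is jointly smooth
      ((∃ F : ℝ → ℝ, ∀ t > 0, ∀ u, f t u = t ^ (-(3 / 2) : ℝ) * F (Real.sqrt t * u)) →
        ∀ᵐ ω ∂P, ContDiffOn ℝ (⊤ : ℕ∞)
          (fun p : ℝ × Plane => σ p.1 * heatFlow m p.1 (mollify ε hε (η ω)) p.2)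
          (Set.Ioi 0 ×ˢ Set.univ)) := by
  obtain ⟨n, hD⟩ := hf.exists_tameCoeff
  have hrate := hD.isRate_gaussRate m hε
  obtain ⟨σ, hpos, hσ⟩ := exists_solvesRate_gaussRate hf m hε (one_div_log_inv_nonneg hε hε₁)
  have hsol := isSolution_mul_heatFlow hη m hε hD hσ
  refine ⟨fun t ht s x => hη.integrable_coeff hε m hD ht s x, σ,
    fun x => (hη.solvesODE_iff m hε hD x subset_rfl σ).2 hσ, fun x T τ hτ => ?_,
    fun t _ => hpos t,
    fun _ _ _ _ _ _ _ _ hf₁ hf₂ hsum t ht => hσ.le_exp_integral hf hε hε₁ hpos hf₁ hf₂ hsum ht,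
    hsol, fun w hw => hw.ae_eq hsol (hη.isTameField hε) hε hε₁ hf, fun ⟨F, hF⟩ => ?_⟩
  · exact hrate.eqOn ((hη.solvesODE_iff m hε hD x Set.Icc_subset_Ici_self τ).1 hτ)
      (hσ.mono Set.Icc_subset_Ici_self)
  · exact ae_of_all _ fun ω =>
      hσ.contDiffOn_mul_heatFlow_of_selfSimilar hf hF hpos (tameFun_mollify ε hε (η ω))
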